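/- **Conventions.** Links are smooth oriented links in $S^3$. A *cobordism* (the "concordance" of the theorem) between oriented links $L,L'$ is a compact oriented smooth surface $S$, neatly embedded in $S^3\times[0,1]$, with oriented boundary $L'\times\{1\}\cup-(L\times\{0\})$, each connected component of which has boundary both in $S^3\times\{0\}$ and in $S^3\times\{1\}$; $\chi(S)$ is its Euler characteristic. $H_+$ and $H_-$ are the Hopf links with linking number $+1$ and $-1$. An *annulus presentation* of a knot $K$ is a pair $(A,b)$ of a smoothly embedded annulus $A\subset S^3$ and a smoothly embedded band $b\colon I\times I\to S^3$, $I=[0,1]$, such that $b(I\times I)\cap\partial A=b(\partial I\times I)$, $b(I\times I)\cap\operatorname{Int}A$ consists of ribbon singularities, $A\cup b(I\times I)$ is a smooth immersion of an orientable surface, and $K$ is isotopic (up to orientation) to $(\partial A\setminus b(\partial I\times I))\cup b(I\times\partial I)$ with its corners rounded. It is *negative special* if $A$ is a negative Hopf band, i.e. isotopic to the standard annulus $\{(\cos\theta\,e^{i\alpha},\sin\theta\,e^{i\alpha}) : 0\le\theta\le\pi/2,\ \alpha\in\mathbb R\}\subset S^3\subset\mathbb C^2$, whose oriented boundary is $H_-$.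 **Theorem.** Let $\nu$ be an integer-valued invariant of oriented links such that $|\nu(L)-\nu(L')|\le-\chi(S)$ for all oriented links $L,L'$ and every cobordism $S$ between them, and such that $\nu(H_\pm)=\pm1$. Let $K$ be an oriented knot. If $K$ has a negative special annulus presentation, then $-2\le\nu(K)\le0$. In particular, if $\nu(K)=2$, then $K$ has no negative special annulus presentation. -/

import Mathlib

open Set
open scoped ContDiff

noncomputable section

namespace AnnulusLink

/-! ### Oriented links in the 3-sphere

The 3-sphere is the unit sphere of `ℝ⁴ = ℂ²`, with coordinates `(Re z, Im z, Re w, Im w)`, oriented as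
the boundary of the unit ball. A smooth map into it is a smooth map into `ℝ⁴` of norm one. -/

/-- Euclidean 4-space. -/
abbrev R4 := EuclideanSpace ℝ (Fin 4)

/-- The curves `γ i`, each of period one, are a smooth embedding of a disjoint union of `n` circles
`ℝ / ℤ` into the 3-sphere. -/
structure IsLink {n : ℕ} (γ : Fin n → ℝ → R4) : Prop where
  smooth : ∀ i, ContDiff ℝ ∞ (γ i)
  periodic : ∀ i t, γ i (t + 1) = γ i t
  norm_eq_one : ∀ i t, ‖γ i t‖ = 1
  deriv_ne_zero : ∀ i t, deriv (γ i) t ≠ 0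
  injective : ∀ i j s t, γ i s = γ j t → i = j ∧ ∃ k : ℤ, t = s + k

/-- A (nonempty) smooth oriented link in the 3-sphere, given by a parametrization of its components;
each component is oriented by its parametrization. -/
structure OrientedLink where
  /-- number of components -/
  n : ℕ
  n_pos : 0 < n
  /-- parametrizations of the components -/
  γ : Fin n → ℝ → R4
  isLink : IsLink γ

/-- The underlying set of a link. -/
def OrientedLink.carrier (L : OrientedLink) : Set R4 := ⋃ i, range (L.γ i)

/-- A knot is a link with one component. -/
def OrientedLink.IsKnot (L : OrientedLink) : Prop := L.n = 1

/-- Smooth isotopy of links: a smooth one-parameter family of links joining the two (the components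
may be numbered differently). -/
def Isotopic (L L' : OrientedLink) : Prop :=
  ∃ (e : Fin L.n ≃ Fin L'.n) (G : ℝ → Fin L.n → ℝ → R4),
    (∀ i, ContDiff ℝ ∞ (fun p : ℝ × ℝ => G p.1 i p.2)) ∧
    (∀ t ∈ Icc (0 : ℝ) 1, IsLink (G t)) ∧
    (∀ i s, G 0 i s = L.γ i s) ∧ (∀ i s, G 1 i s = L'.γ (e i) s)

/-! ### The Hopf links -/

/-- The circle `{w = 0}` traversed counterclockwise, and the circle `{z = 0}` traversed
counterclockwise for `σ = 1`, clockwise for `σ = -1`. Their linking number is `σ`. -/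
def hopfCurves (σ : ℝ) : Fin 2 → ℝ → R4 :=
  ![fun t => !₂[Real.cos (2 * Real.pi * t), Real.sin (2 * Real.pi * t), 0, 0],
    fun t => !₂[0, 0, Real.cos (2 * Real.pi * t), σ * Real.sin (2 * Real.pi * t)]]

theorem exists_int_of_cos_sin {s t : ℝ}
    (hc : Real.cos (2 * Real.pi * s) = Real.cos (2 * Real.pi * t))
    (hs : Real.sin (2 * Real.pi * s) = Real.sin (2 * Real.pi * t)) : ∃ k : ℤ, t = s + k := by
  have h1 : Real.cos (2 * Real.pi * t - 2 * Real.pi * s) = 1 := by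
    rw [Real.cos_sub, hc, hs]
    nlinarith [Real.sin_sq_add_cos_sq (2 * Real.pi * t)]
  obtain ⟨k, hk⟩ := (Real.cos_eq_one_iff _).1 h1
  refine ⟨k, ?_⟩
  have hpi : (2 * Real.pi) ≠ 0 := by positivity
  have : (2 * Real.pi) * (t - s - k) = 0 := by linarith
  rcases mul_eq_zero.1 this with h | h
  · exact absurd h hpi
  · linarith

theorem isLink_hopfCurves {σ : ℝ} (hσ : σ ^ 2 = 1) : IsLink (hopfCurves σ) := by
  have hσ0 : σ ≠ 0 := by rintro rfl; norm_num at hσ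
  have hpi : (2 * Real.pi) ≠ 0 := by positivity
  have hlin : ∀ t : ℝ, HasDerivAt (fun t : ℝ => 2 * Real.pi * t) (2 * Real.pi) t := fun t => by
    simpa using (hasDerivAt_id t).const_mul (2 * Real.pi)
  have hcos := fun t => (hlin t).cos
  have hsin := fun t => (hlin t).sin
  have hsmooth : ∀ i, ContDiff ℝ ∞ (hopfCurves σ i) := by
    intro i
    rw [contDiff_euclidean]
    intro k
    fin_cases i <;> fin_cases k <;> simp [hopfCurves] <;> fun_prop
  have hderiv : ∀ i t k, deriv (hopfCurves σ i) t k = deriv (fun s => hopfCurves σ i s k) t := by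
    intro i t k
    have hd : HasDerivAt (hopfCurves σ i) (deriv (hopfCurves σ i) t) t :=
      (((hsmooth i).differentiable (by simp)) t).hasDerivAt
    have := (EuclideanSpace.proj (𝕜 := ℝ) k).hasFDerivAt.comp_hasDerivAt t hd
    exact this.deriv.symm
  refine ⟨hsmooth, ?_, ?_, ?_, ?_⟩
  · intro i t
    have e : 2 * Real.pi * (t + 1) = 2 * Real.pi * t + 2 * Real.pi := by ring
    fin_cases i <;> simp [hopfCurves, e]
  · intro i t
    have h := Real.sin_sq_add_cos_sq (2 * Real.pi * t)
    have h' := Real.cos_sq_add_sin_sq (2 * Real.pi * t)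
    fin_cases i <;> simp [hopfCurves, EuclideanSpace.norm_eq, Fin.sum_univ_four, mul_pow, hσ]
  · intro i t h0
    have h := Real.sin_sq_add_cos_sq (2 * Real.pi * t)
    have H : ∀ k, deriv (fun s => hopfCurves σ i s k) t = 0 := by
      intro k
      rw [← hderiv, h0]
      rfl
    fin_cases i
    · have a := H 0
      have b := H 1
      simp only [hopfCurves, Fin.zero_eta, Matrix.cons_val_zero, Matrix.cons_val_one,
        PiLp.toLp_apply] at a b
      rw [(hcos t).deriv] at a
      rw [(hsin t).deriv] at b
      have a' : Real.sin (2 * Real.pi * t) = 0 := by simpa [hpi] using a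
      have b' : Real.cos (2 * Real.pi * t) = 0 := by simpa [hpi] using b
      rw [a', b'] at h
      norm_num at h
    · have a := H 2
      have b := H 3
      simp [hopfCurves] at a b
      rw [(hcos t).deriv] at a
      rw [(hsin t).deriv] at b
      have a' : Real.sin (2 * Real.pi * t) = 0 := by simpa [hpi] using a
      have b' : Real.cos (2 * Real.pi * t) = 0 := by simpa [hpi, hσ0] using b
      rw [a', b'] at h
      norm_num at h
  · intro i j s t hst
    have H : ∀ k, hopfCurves σ i s k = hopfCurves σ j t k := fun k => by rw [hst]
    have hs := Real.sin_sq_add_cos_sq (2 * Real.pi * s)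
    have ht := Real.sin_sq_add_cos_sq (2 * Real.pi * t)
    have H0 := H 0
    have H1 := H 1
    have H2 := H 2
    have H3 := H 3
    fin_cases i <;> fin_cases j <;> simp [hopfCurves] at H0 H1 H2 H3
    · exact ⟨rfl, exists_int_of_cos_sin H0 H1⟩
    · rw [H0, H1] at hs
      norm_num at hs
    · rw [← H0, ← H1] at ht
      norm_num at ht
    · refine ⟨rfl, exists_int_of_cos_sin H2 ?_⟩
      rcases H3 with h | h
      · exact h
      · exact absurd h hσ0

/-- The positive Hopf link `H₊`: linking number `1`. -/
def hopfPos : OrientedLink := ⟨2, by norm_num, hopfCurves 1, isLink_hopfCurves (by norm_num)⟩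

/-- The negative Hopf link `H₋`: linking number `-1`. -/
def hopfNeg : OrientedLink := ⟨2, by norm_num, hopfCurves (-1), isLink_hopfCurves (by norm_num)⟩

/-! ### Cobordisms in `S³ × [0, 1]` -/

/-- The slab `ℝ⁴ × [0, 1]`. -/
def slab : Set (R4 × ℝ) := {x | x.2 ∈ Icc (0 : ℝ) 1}

/-- `ψ` on the open set `V` is a local parametrization of the neat smooth surface `S ⊆ S³ × [0, 1]`:
a smooth embedding of `V` into `S³ × ℝ`, transverse to the two boundary levels, whose part in the
slab is a relatively open part of `S`. -/
structure IsLocalParam (S : Set (R4 × ℝ)) (ψ : ℝ × ℝ → R4 × ℝ) (V : Set (ℝ × ℝ)) : Prop where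
  isOpen : IsOpen V
  smooth : ContDiffOn ℝ ∞ ψ V
  norm_eq_one : ∀ u ∈ V, ‖(ψ u).1‖ = 1
  immersion : ∀ u ∈ V, Function.Injective (fderiv ℝ ψ u)
  embedding : Topology.IsEmbedding (V.domRestrict ψ)
  relOpen : ∃ W : Set (R4 × ℝ), IsOpen W ∧ S ∩ W = ψ '' V ∩ slab
  transverse : ∀ u ∈ V, (ψ u).2 = 0 ∨ (ψ u).2 = 1 → ∃ w, (fderiv ℝ ψ u w).2 ≠ 0

/-- The curves of `L` at level `c` are compatible with the orientation given by `ψ`: at each common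
point, (tangent vector with positive `[0, 1]`-component, velocity of `L`) is a positive frame. -/
def BoundaryOriented (L : OrientedLink) (c : ℝ) (ψ : ℝ × ℝ → R4 × ℝ) (V : Set (ℝ × ℝ)) : Prop :=
  ∀ u ∈ V, ∀ i s, ψ u = (L.γ i s, c) → ∃ w w' : ℝ × ℝ,
    0 < (fderiv ℝ ψ u w).2 ∧ fderiv ℝ ψ u w' = (deriv (L.γ i) s, 0) ∧
    0 < w.1 * w'.2 - w.2 * w'.1

/-- `S` is a cobordism from the oriented link `L` to the oriented link `L'`: a compact, smooth,
neatly embedded, oriented surface in `S³ × [0, 1]` with oriented boundary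
`L' × {1} ∪ -(L × {0})`, each connected component of which has boundary in both ends. The orientation
is given by a family `𝒜` of local parametrizations with orientation preserving transitions. With the
outward normal first, the boundary orientation makes (upward vector, velocity of the link) a positive
frame at both ends. -/
structure IsCobordism (S : Set (R4 × ℝ)) (L L' : OrientedLink) : Prop where
  isCompact : IsCompact S
  subset_slab : S ⊆ slab
  oriented : ∃ 𝒜 : Set ((ℝ × ℝ → R4 × ℝ) × Set (ℝ × ℝ)),
    (∀ c ∈ 𝒜, IsLocalParam S c.1 c.2) ∧
    (∀ x ∈ S, ∃ c ∈ 𝒜, x ∈ c.1 '' c.2) ∧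
    (∀ c ∈ 𝒜, ∀ d ∈ 𝒜, ∀ u ∈ c.2, ∀ v ∈ d.2, c.1 u = d.1 v → c.1 u ∈ S →
      ∃ M : (ℝ × ℝ) →L[ℝ] (ℝ × ℝ), fderiv ℝ c.1 u = (fderiv ℝ d.1 v).comp M ∧ 0 < M.det) ∧
    (∀ c ∈ 𝒜, BoundaryOriented L 0 c.1 c.2 ∧ BoundaryOriented L' 1 c.1 c.2)
  bottom : {x | (x, (0 : ℝ)) ∈ S} = L.carrier
  top : {x | (x, (1 : ℝ)) ∈ S} = L'.carrier
  components : ∀ x ∈ S, (∃ y ∈ connectedComponentIn S x, y.2 = 0) ∧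
    ∃ y ∈ connectedComponentIn S x, y.2 = 1

/-- `χ` is the Euler characteristic of `S`: the alternating number of cells of a finite CW
decomposition of `S`. -/
def HasEulerChar (S : Set (R4 × ℝ)) (χ : ℤ) : Prop :=
  ∃ _ : Topology.CWComplex S, Topology.CWComplex.Finite S ∧
    χ = ∑ᶠ n : ℕ, (-1) ^ n * (Nat.card (Topology.CWComplex.cell S n) : ℤ)

/-! ### Annulus presentations -/

/-- `a`, of period one in the first variable and restricted to `0 ≤ r ≤ 1`, is a smooth embedding of
the annulus `ℝ / ℤ × [0, 1]` into the 3-sphere. (The values for other `r` play no role: they only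
express that `a` is smooth up to the boundary.) -/
structure IsAnnulus (a : ℝ × ℝ → R4) : Prop where
  smooth : ContDiff ℝ ∞ a
  periodic : ∀ s r, a (s + 1, r) = a (s, r)
  norm_eq_one : ∀ s, ∀ r ∈ Icc (0 : ℝ) 1, ‖a (s, r)‖ = 1
  immersion : ∀ s, ∀ r ∈ Icc (0 : ℝ) 1, Function.Injective (fderiv ℝ a (s, r))
  injective : ∀ s s', ∀ r ∈ Icc (0 : ℝ) 1, ∀ r' ∈ Icc (0 : ℝ) 1,
    a (s, r) = a (s', r') → r = r' ∧ ∃ k : ℤ, s' = s + k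

/-- The annulus as a set. -/
def annulusSet (a : ℝ × ℝ → R4) : Set R4 := a '' (univ ×ˢ Icc 0 1)

/-- The interior of the annulus. -/
def annulusInt (a : ℝ × ℝ → R4) : Set R4 := a '' (univ ×ˢ Ioo 0 1)

/-- The boundary of the annulus. -/
def annulusBdry (a : ℝ × ℝ → R4) : Set R4 := a '' (univ ×ˢ {0, 1})

/-- The standard negative Hopf band `(cos (π r / 2) e^{2π i s}, sin (π r / 2) e^{2π i s})` in `ℂ²`.
Its oriented boundary is the negative Hopf link. -/
def stdNegHopfBand (p : ℝ × ℝ) : R4 :=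
  !₂[Real.cos (Real.pi * p.2 / 2) * Real.cos (2 * Real.pi * p.1),
     Real.cos (Real.pi * p.2 / 2) * Real.sin (2 * Real.pi * p.1),
     Real.sin (Real.pi * p.2 / 2) * Real.cos (2 * Real.pi * p.1),
     Real.sin (Real.pi * p.2 / 2) * Real.sin (2 * Real.pi * p.1)]

/-- The embedded annulus `a` is a negative Hopf band: it is isotopic, through embedded annuli, to the
standard one. -/
def IsNegHopfBand (a : ℝ × ℝ → R4) : Prop :=
  ∃ G : ℝ → ℝ × ℝ → R4, ContDiff ℝ ∞ (fun q : ℝ × (ℝ × ℝ) => G q.1 q.2) ∧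
    (∀ t ∈ Icc (0 : ℝ) 1, IsAnnulus (G t)) ∧
    (∀ s, ∀ r ∈ Icc (0 : ℝ) 1, G 0 (s, r) = a (s, r)) ∧
    (∀ s, ∀ r ∈ Icc (0 : ℝ) 1, G 1 (s, r) = stdNegHopfBand (s, r))

/-- The square `I × I`, enlarged by a margin `ε` on every side. -/
def square (ε : ℝ) : Set (ℝ × ℝ) := Icc (-ε) (1 + ε) ×ˢ Icc (-ε) (1 + ε)

/-- The band `b (I × I)` meets the interior of the annulus in ribbon singularities: it does so
transversely, in finitely many disjoint arcs whose preimages in `I × I` are properly embedded with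
end points on the free sides `(0, 1) × {0, 1}`. -/
def MeetsInRibbons (a b : ℝ × ℝ → R4) : Prop :=
  (∃ (m : ℕ) (c : Fin m → ℝ → ℝ × ℝ),
    (∀ i, ContDiff ℝ ∞ (c i)) ∧
    (∀ i, ∀ t ∈ Icc (0 : ℝ) 1, deriv (c i) t ≠ 0) ∧
    (∀ i j, ∀ t ∈ Icc (0 : ℝ) 1, ∀ t' ∈ Icc (0 : ℝ) 1, c i t = c j t' → i = j ∧ t = t') ∧
    (∀ i, ∀ t ∈ Ioo (0 : ℝ) 1, c i t ∈ Ioo (0 : ℝ) 1 ×ˢ Ioo (0 : ℝ) 1) ∧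
    (∀ i, ∀ t ∈ ({0, 1} : Set ℝ),
      c i t ∈ Ioo (0 : ℝ) 1 ×ˢ ({0, 1} : Set ℝ) ∧ (deriv (c i) t).2 ≠ 0) ∧
    {p ∈ square 0 | b p ∈ annulusInt a} = ⋃ i, c i '' Icc 0 1) ∧
  ∀ p ∈ square 0, ∀ q : ℝ × ℝ, q.2 ∈ Ioo (0 : ℝ) 1 → a q = b p →
    Module.finrank ℝ
      ↥(LinearMap.range (fderiv ℝ a q : (ℝ × ℝ) →ₗ[ℝ] R4) ⊔
        LinearMap.range (fderiv ℝ b p : (ℝ × ℝ) →ₗ[ℝ] R4)) = 3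

/-- `b` is a band for the annulus `a`. The smooth embedding `b` of `I × I` is given together with a
smooth embedded extension to a slightly larger square, which runs inside the annulus beyond the
attaching sides `{0, 1} × I`; this is the condition that annulus and band form a smoothly immersed
surface. -/
structure IsBand (a b : ℝ × ℝ → R4) (ε : ℝ) : Prop where
  margin_pos : 0 < ε
  smooth : ContDiff ℝ ∞ b
  norm_eq_one : ∀ p ∈ square ε, ‖b p‖ = 1
  injOn : InjOn b (square ε)
  immersion : ∀ p ∈ square ε, Function.Injective (fderiv ℝ b p)
  /-- `b (I × I) ∩ ∂A = b (∂I × I)`, and likewise for the extension. -/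
  bdry : ∀ p ∈ square ε, b p ∈ annulusBdry a ↔ p.1 = 0 ∨ p.1 = 1
  /-- Beyond the attaching sides the extension lies in the annulus. -/
  collar : ∀ p ∈ square ε, p.1 ≤ 0 ∨ 1 ≤ p.1 → b p ∈ annulusSet a
  ribbon : MeetsInRibbons a b
  /-- The surface is orientable: either both collars preserve orientation (`σ > 0`), or both reverse
  it (`σ < 0`). -/
  orientable : ∃ σ : ℝ, ∀ p ∈ square ε, p.1 ≤ 0 ∨ 1 ≤ p.1 →
    ∀ q : ℝ × ℝ, q.2 ∈ Icc (0 : ℝ) 1 → a q = b p →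
      ∃ M : (ℝ × ℝ) →L[ℝ] (ℝ × ℝ), fderiv ℝ b p = (fderiv ℝ a q).comp M ∧ 0 < σ * M.det

/-- `g` is a smooth convex rounding of `u ↦ |u|`, equal to it outside an interval that is small
with respect to the margin `ε`. -/
def IsRounding (ε : ℝ) (g : ℝ → ℝ) : Prop :=
  ContDiff ℝ ∞ g ∧ ConvexOn ℝ univ g ∧ ∃ η, η < ε ∧ η < 1 / 2 ∧ ∀ u, η ≤ |u| → g u = |u|

/-- `x` for `x ≤ 1/2` and `1 - x` for `x ≥ 1/2`: the line folded at `1/2`. -/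
def fold (x : ℝ) : ℝ := min x (1 - x)

/-- For `g u = |u|` this is the part of `(∂A \ b (∂I × I)) ∪ b (I × ∂I)` in the chart `b`, that is
`{0, 1} × ([-ε, 0] ∪ [1, 1 + ε]) ∪ I × {0, 1}`, which has corners at the four corners of `I × I`. A
rounding `g` rounds these corners, by the graph `x - y = g (x + y)` at the corner `(0, 0)` and
symmetrically at the others. -/
def bandCurve (ε : ℝ) (g : ℝ → ℝ) : Set (ℝ × ℝ) :=
  {p ∈ square ε | fold p.1 - fold p.2 = g (fold p.1 + fold p.2)}

/-- The curve `(∂A \ b (∂I × I)) ∪ b (I × ∂I)` with its four corners rounded. -/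
def surgeredBdry (a b : ℝ × ℝ → R4) (ε : ℝ) (g : ℝ → ℝ) : Set R4 :=
  (annulusBdry a \ b '' square ε) ∪ b '' bandCurve ε g

/-- An annulus presentation `(A, b)` of `K`: an embedded annulus `A`, a band `b`, such that `K` (with
either orientation) is isotopic to `(∂A \ b (∂I × I)) ∪ b (I × ∂I)`, corners being rounded. -/
structure AnnulusPresentation (K : OrientedLink) where
  /-- the annulus `A` -/
  annulus : ℝ × ℝ → R4
  /-- the band `b` -/
  band : ℝ × ℝ → R4
  /-- the margin of the band -/
  margin : ℝ
  isAnnulus : IsAnnulus annulus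
  isBand : IsBand annulus band margin
  isotopic : ∃ g, IsRounding margin g ∧ ∃ K' : OrientedLink,
    K'.carrier = surgeredBdry annulus band margin g ∧ Isotopic K K'

/-- `K` has a negative special annulus presentation: one whose annulus is a negative Hopf band. -/
def HasNegSpecialAnnulusPresentation (K : OrientedLink) : Prop :=
  ∃ P : AnnulusPresentation K, IsNegHopfBand P.annulus

end AnnulusLink

end

noncomputable section

namespace AnnulusLink

/-! ### Convergence of lifts through maps on compact sets -/

/-! Orient the two boundary circles of the negative Hopf band oppositely in the annulus, as its
oriented boundary requires. They form a link isotopic to `hopfNeg`, and reversing both circles at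
once changes nothing: complex conjugation of both coordinates of ℂ² is the end of a path of
rotations (`isotopic_boundaryCurves`). Band surgery on this link yields K, and the trace of the
surgery is a pair of pants, of Euler characteristic -1. Isotopies have annuli as traces, of Euler
characteristic 0, so ν is an isotopy invariant (`eq_of_isotopic`). Hence ν(K) differs from ν(H₋) =
-1 by at most 1, which is the asserted range.

Two points about the band need proof. Since K is connected, the band joins different boundary
circles, as otherwise the untouched circle would be a component of its own (`IsBand.circle_ne`).
Since annulus and band form an orientable surface, the two edges of the band run along these circles
in directions that match the boundary orientation or its reverse (`IsBand.hasDerivAt_lift`). This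
gives the data of `IsBand.exists_bandSurgery`.

The pair of pants is written down explicitly. In band coordinates (x, y) let X and Y be smooth folds
of x and y at 1/2, so that X = 0 is the pair of attaching edges and Y = 0 the pair of free sides.
With a smooth version k of max(u, 0), the level t of the saddle is the curve X = t k(X + Y): at t =
0 it is the old link, at t = 1 the surgered curve with rounded corners. Outside the band the surface
is a product. It has three kinds of charts: walls along the link, corner charts with parameters t
and X + Y, and a central chart in which t = X / (X + Y) is a function on the band. They form an
oriented atlas that induces the given orientation on the bottom link. At the top the sign of the
orientation is constant along the knot, so after reversing everything if necessary it is the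
orientation of K (`isCobordism_or_reverse`). The Euler characteristic comes from a cell
decomposition into two rectangles with sides glued crosswise (`hasEulerChar_pants`); the vertical
lines of these rectangles also join every point of the surface to both ends. -/

theorem tendsto_of_isCompact_of_fiber_unique {α E F : Type*} [TopologicalSpace E]
    [TopologicalSpace F] [T2Space F] {K : Set E} (hK : IsCompact K) {f : E → F}
    (hf : ContinuousOn f K) {l : Filter α} {q : α → E} {x₀ : E} (hq : ∀ᶠ a in l, q a ∈ K)
    (huniq : ∀ x ∈ K, f x = f x₀ → x = x₀)
    (h : Filter.Tendsto (fun a => f (q a)) l (nhds (f x₀))) :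
    Filter.Tendsto q l (nhds x₀) := by
  -- In a compact set it suffices to identify the cluster points. Along an ultrafilter converging to
  -- a cluster point y, the values of f tend both to f y and to f x₀.
  refine hK.tendsto_nhds_of_unique_mapClusterPt hq fun y hy hcl => huniq y hy ?_
  rw [mapClusterPt_iff_ultrafilter] at hcl
  obtain ⟨U, hU, hUy⟩ := hcl
  have h1 : Filter.Tendsto (fun a => f (q a)) U (nhds (f y)) := by
    refine (hf y hy).tendsto.comp (tendsto_nhdsWithin_iff.2 ⟨hUy, ?_⟩)
    exact hU hq
  exact tendsto_nhds_unique h1 (h.mono_left hU)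

/-- A continuous injection of a compact space into a Hausdorff space is a closed embedding, and
embeddings restrict to subsets. Enclosing a chart domain in a compact set on which the map is still
injective thus avoids inverse formulas. -/
theorem isEmbedding_domRestrict {E F : Type*} [TopologicalSpace E] [TopologicalSpace F] [T2Space F]
    {K V : Set E} (hK : IsCompact K) (hVK : V ⊆ K) {f : E → F} (hf : ContinuousOn f K)
    (hinj : InjOn f K) : Topology.IsEmbedding (V.domRestrict f) := by
  have : CompactSpace K := isCompact_iff_compactSpace.1 hK
  have h1 : Topology.IsClosedEmbedding (K.domRestrict f) :=
    (continuousOn_iff_continuous_domRestrict.1 hf).isClosedEmbedding (injOn_iff_injective.1 hinj)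
  exact h1.isEmbedding.comp (Topology.IsEmbedding.inclusion hVK)

/-! ### Finite cell decompositions -/

/-- Finitely many cells with disjoint interiors, whose boundaries are covered by open cells of lower
dimension, give a CW decomposition of their union. -/
theorem hasEulerChar_of_cells {S : Set (R4 × ℝ)} (ι : ℕ → Type) [∀ n, Fintype (ι n)] (N : ℕ)
    (hN : ∀ n, N ≤ n → IsEmpty (ι n)) (f : ∀ n, ι n → (Fin n → ℝ) → R4 × ℝ)
    (hcont : ∀ n i, ContinuousOn (f n i) (Metric.closedBall 0 1))
    (hinj : ∀ n i, InjOn (f n i) (Metric.ball 0 1))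
    (hdisj : ∀ n i m j, (⟨n, i⟩ : Σ n, ι n) ≠ ⟨m, j⟩ → ∀ x ∈ Metric.ball (0 : Fin n → ℝ) 1,
      ∀ y ∈ Metric.ball (0 : Fin m → ℝ) 1, f n i x ≠ f m j y)
    (hbd : ∀ n i, ∀ x ∈ Metric.sphere (0 : Fin n → ℝ) 1,
      ∃ m < n, ∃ j, ∃ y ∈ Metric.ball (0 : Fin m → ℝ) 1, f m j y = f n i x)
    (hS : ∀ x, x ∈ S ↔ ∃ n i, ∃ y ∈ Metric.ball (0 : Fin n → ℝ) 1, f n i y = x) :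
    HasEulerChar S (∑ n ∈ Finset.range N, (-1) ^ n * (Fintype.card (ι n) : ℤ)) := by
  classical
  have hsub : ∀ n, Metric.ball (0 : Fin n → ℝ) 1 ⊆ Metric.closedBall 0 1 :=
    fun n => Metric.ball_subset_closedBall
  let e : ∀ n, ι n → PartialEquiv (Fin n → ℝ) (R4 × ℝ) :=
    fun n i => (hinj n i).toPartialEquiv
  have hecoe : ∀ n i, (e n i : (Fin n → ℝ) → R4 × ℝ) = f n i := fun n i => rfl
  have htarget : ∀ n i, (e n i).target = f n i '' Metric.ball 0 1 := fun n i => rfl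
  have hsrc : ∀ n i, (e n i).source = Metric.ball 0 1 := fun n i => rfl
  -- The fibre through an interior point of a cell is a single point even in the closed ball:
  -- boundary points go to open cells of smaller dimension, which are disjoint from this one.
  have hbd' : ∀ n i, ∀ x ∈ Metric.closedBall (0 : Fin n → ℝ) 1, ∀ y ∈ Metric.ball (0 : Fin n → ℝ) 1,
      f n i x = f n i y → x = y := by
    intro n i x hx y hy hxy
    by_cases hxb : x ∈ Metric.ball (0 : Fin n → ℝ) 1
    · exact hinj n i hxb hy hxy
    · have hxs : x ∈ Metric.sphere (0 : Fin n → ℝ) 1 := by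
        rw [Metric.mem_sphere]
        rw [Metric.mem_closedBall] at hx
        rw [Metric.mem_ball, not_lt] at hxb
        exact le_antisymm hx hxb
      obtain ⟨m, hm, j, z, hz, hzx⟩ := hbd n i x hxs
      refine absurd (hzx.trans hxy) (hdisj m j n i ?_ z hz y hy)
      intro h
      exact hm.ne (congrArg Sigma.fst h)
  -- The inverse of a cell is continuous because the fibres just found are unique in the compact
  -- closed ball.
  have hcs : ∀ n i, ContinuousOn (e n i).symm (e n i).target := by
    intro n i y hy
    obtain ⟨x, hx, rfl⟩ := hy
    have hinv : (e n i).symm (f n i x) = x := (e n i).left_inv hx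
    change Filter.Tendsto _ _ _
    rw [hinv]
    refine tendsto_of_isCompact_of_fiber_unique (isCompact_closedBall (0 : Fin n → ℝ) 1)
      (hcont n i) ?_ (fun z hz h => hbd' n i z hz x hx h) ?_
    · filter_upwards [self_mem_nhdsWithin] with z hz
      exact hsub n ((e n i).map_target hz)
    · have : Filter.Tendsto (fun z : R4 × ℝ => z) (nhdsWithin (f n i x) (e n i).target)
          (nhds (f n i x)) := Filter.tendsto_id.mono_left nhdsWithin_le_nhds
      refine this.congr' ?_
      filter_upwards [self_mem_nhdsWithin] with z hz
      exact ((e n i).right_inv hz).symm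
  have hdj : (univ : Set (Σ n, ι n)).PairwiseDisjoint (fun ni ↦ e ni.1 ni.2 '' Metric.ball 0 1) := by
    rintro ⟨n, i⟩ - ⟨m, j⟩ - hne
    rw [Function.onFun, Set.disjoint_left]
    rintro _ ⟨x, hx, rfl⟩ ⟨y, hy, hxy⟩
    exact hdisj n i m j hne x hx y hy hxy.symm
  have hmt : ∀ n i, MapsTo (e n i) (Metric.sphere 0 1)
      (⋃ (m < n) (j : ι m), e m j '' Metric.closedBall 0 1) := by
    intro n i x hx
    obtain ⟨m, hm, j, y, hy, hyx⟩ := hbd n i x hx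
    simp only [mem_iUnion]
    exact ⟨m, hm, j, y, hsub m hy, hyx⟩
  have hun : ⋃ (n : ℕ) (j : ι n), e n j '' Metric.closedBall 0 1 = S := by
    ext x
    simp only [mem_iUnion]
    rw [hS]
    constructor
    · rintro ⟨n, i, y, hy, rfl⟩
      by_cases hyb : y ∈ Metric.ball (0 : Fin n → ℝ) 1
      · exact ⟨n, i, y, hyb, rfl⟩
      · have hys : y ∈ Metric.sphere (0 : Fin n → ℝ) 1 := by
          rw [Metric.mem_sphere]
          rw [Metric.mem_closedBall] at hy
          rw [Metric.mem_ball, not_lt] at hyb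
          exact le_antisymm hy hyb
        obtain ⟨m, -, j, z, hz, hzx⟩ := hbd n i y hys
        exact ⟨m, j, z, hz, hzx⟩
    · rintro ⟨n, i, y, hy, rfl⟩
      exact ⟨n, i, y, hsub n hy, rfl⟩
  have hev : ∀ᶠ n in Filter.atTop, IsEmpty (ι n) := Filter.eventually_atTop.2 ⟨N, hN⟩
  refine ⟨Topology.CWComplex.mkFinite S ι e hev (fun n => inferInstance) hsrc hcont hcs hdj hmt hun,
    Topology.CWComplex.finite_mkFinite S ι e hev (fun n => inferInstance) hsrc hcont hcs hdj hmt hun,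
    ?_⟩
  have hcell : ∀ n, (-1 : ℤ) ^ n * (Nat.card (ι n) : ℤ) = (-1) ^ n * (Fintype.card (ι n) : ℤ) :=
    fun n => by rw [Nat.card_eq_fintype_card]
  change _ = ∑ᶠ n : ℕ, (-1 : ℤ) ^ n * (Nat.card (ι n) : ℤ)
  simp_rw [hcell]
  rw [finsum_eq_sum_of_support_subset]
  intro n hn
  simp only [Finset.coe_range, mem_Iio]
  by_contra hcon
  have := hN n (not_lt.1 hcon)
  apply hn
  simp

/-- The index type of the cells of a complex of dimension two. -/
abbrev cellIndex (A B C : Type) : ℕ → Type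
  | 0 => A
  | 1 => B
  | 2 => C
  | _ + 3 => Empty

instance cellIndexFintype (A B C : Type) [Fintype A] [Fintype B] [Fintype C] :
    ∀ n, Fintype (cellIndex A B C n)
  | 0 => inferInstanceAs (Fintype A)
  | 1 => inferInstanceAs (Fintype B)
  | 2 => inferInstanceAs (Fintype C)
  | _ + 3 => inferInstanceAs (Fintype Empty)

/-- Cells parametrized by powers of the unit interval, as cells parametrized by cubes centred at
the origin. -/
def cellMap {A B C X : Type} (v : A → X) (e : B → ℝ → X) (f : C → ℝ × ℝ → X) :
    ∀ n, cellIndex A B C n → (Fin n → ℝ) → X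
  | 0 => fun i _ => v i
  | 1 => fun i x => e i ((x 0 + 1) / 2)
  | 2 => fun i x => f i ((x 0 + 1) / 2, (x 1 + 1) / 2)
  | _ + 3 => fun i _ => i.elim

theorem mem_ball_pi_iff {n : ℕ} (x : Fin n → ℝ) :
    x ∈ Metric.ball (0 : Fin n → ℝ) 1 ↔ ∀ i, (x i + 1) / 2 ∈ Ioo (0 : ℝ) 1 := by
  rw [mem_ball_zero_iff, pi_norm_lt_iff one_pos]
  refine forall_congr' fun i => ?_
  rw [Real.norm_eq_abs, abs_lt, mem_Ioo]
  constructor <;> rintro ⟨h1, h2⟩ <;> constructor <;> linarith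

theorem mem_closedBall_pi_iff {n : ℕ} (x : Fin n → ℝ) :
    x ∈ Metric.closedBall (0 : Fin n → ℝ) 1 ↔ ∀ i, (x i + 1) / 2 ∈ Icc (0 : ℝ) 1 := by
  rw [mem_closedBall_zero_iff, pi_norm_le_iff_of_nonneg zero_le_one]
  refine forall_congr' fun i => ?_
  rw [Real.norm_eq_abs, abs_le, mem_Icc]
  constructor <;> rintro ⟨h1, h2⟩ <;> constructor <;> linarith

/-- The Euler characteristic of a surface that is decomposed into vertices `v`, edges `e` and
rectangles `f`. -/
theorem hasEulerChar_of_rectangles {S : Set (R4 × ℝ)} {A B C : Type} [Fintype A] [Fintype B]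
    [Fintype C] (v : A → R4 × ℝ) (e : B → ℝ → R4 × ℝ) (f : C → ℝ × ℝ → R4 × ℝ)
    (he : ∀ i, ContinuousOn (e i) (Icc 0 1)) (hf : ∀ i, ContinuousOn (f i) (Icc 0 1 ×ˢ Icc 0 1))
    (hv : Function.Injective v)
    (hve : ∀ a i, ∀ s ∈ Ioo (0 : ℝ) 1, v a ≠ e i s)
    (hvf : ∀ a i, ∀ p ∈ Ioo (0 : ℝ) 1 ×ˢ Ioo (0 : ℝ) 1, v a ≠ f i p)
    (hee : ∀ i j, ∀ s ∈ Ioo (0 : ℝ) 1, ∀ s' ∈ Ioo (0 : ℝ) 1, e i s = e j s' → i = j ∧ s = s')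
    (hef : ∀ i j, ∀ s ∈ Ioo (0 : ℝ) 1, ∀ p ∈ Ioo (0 : ℝ) 1 ×ˢ Ioo (0 : ℝ) 1, e i s ≠ f j p)
    (hff : ∀ i j, ∀ p ∈ Ioo (0 : ℝ) 1 ×ˢ Ioo (0 : ℝ) 1, ∀ p' ∈ Ioo (0 : ℝ) 1 ×ˢ Ioo (0 : ℝ) 1,
      f i p = f j p' → i = j ∧ p = p')
    (hebd : ∀ i, (∃ a, v a = e i 0) ∧ ∃ a, v a = e i 1)
    (hfbd : ∀ i, ∀ p ∈ Icc (0 : ℝ) 1 ×ˢ Icc (0 : ℝ) 1, p ∉ Ioo (0 : ℝ) 1 ×ˢ Ioo (0 : ℝ) 1 →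
      (∃ a, v a = f i p) ∨ ∃ j, ∃ s ∈ Ioo (0 : ℝ) 1, e j s = f i p)
    (hvS : ∀ a, v a ∈ S) (heS : ∀ i, ∀ s ∈ Ioo (0 : ℝ) 1, e i s ∈ S)
    (hS : S = ⋃ i, f i '' (Icc 0 1 ×ˢ Icc 0 1)) :
    HasEulerChar S (Fintype.card A - Fintype.card B + Fintype.card C) := by
  have key := hasEulerChar_of_cells (S := S) (cellIndex A B C) 3
    (fun n hn => by
      obtain ⟨m, rfl⟩ := Nat.exists_eq_add_of_le' hn
      exact inferInstanceAs (IsEmpty Empty)) (cellMap v e f) ?_ ?_ ?_ ?_ ?_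
  · have h0 : Fintype.card (cellIndex A B C 0) = Fintype.card A := rfl
    have h1 : Fintype.card (cellIndex A B C 1) = Fintype.card B := rfl
    have h2 : Fintype.card (cellIndex A B C 2) = Fintype.card C := rfl
    rw [Finset.sum_range_succ, Finset.sum_range_succ, Finset.sum_range_one, h0, h1, h2] at key
    convert key using 1
    ring
  · rintro (_ | _ | _ | n) i
    · exact continuousOn_const
    · refine (he i).comp (f := fun x : Fin 1 → ℝ => (x 0 + 1) / 2) (by fun_prop) ?_
      intro x hx
      exact (mem_closedBall_pi_iff x).1 hx 0
    · refine (hf i).comp (f := fun x : Fin 2 → ℝ => ((x 0 + 1) / 2, (x 1 + 1) / 2))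
        (by fun_prop) ?_
      intro x hx
      exact ⟨(mem_closedBall_pi_iff x).1 hx 0, (mem_closedBall_pi_iff x).1 hx 1⟩
    · exact i.elim
  · rintro (_ | _ | _ | n) i x hx y hy hxy
    · exact Subsingleton.elim _ _
    · have := (hee i i _ ((mem_ball_pi_iff x).1 hx 0) _ ((mem_ball_pi_iff y).1 hy 0) hxy).2
      ext k
      fin_cases k
      simp at this ⊢
      linarith
    · have := (hff i i _ ⟨(mem_ball_pi_iff x).1 hx 0, (mem_ball_pi_iff x).1 hx 1⟩ _
        ⟨(mem_ball_pi_iff y).1 hy 0, (mem_ball_pi_iff y).1 hy 1⟩ hxy).2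
      rw [Prod.mk.injEq] at this
      ext k
      fin_cases k
      · simp only [Fin.zero_eta]
        linarith [this.1]
      · simp only [Fin.mk_one]
        linarith [this.2]
    · exact i.elim
  · rintro (_ | _ | _ | n) i (_ | _ | _ | m) j hne x hx y hy hxy
    · exact hne (congrArg (Sigma.mk 0) (hv hxy))
    · exact hve i j _ ((mem_ball_pi_iff y).1 hy 0) hxy
    · exact hvf i j _ ⟨(mem_ball_pi_iff y).1 hy 0, (mem_ball_pi_iff y).1 hy 1⟩ hxy
    · exact j.elim
    · exact hve j i _ ((mem_ball_pi_iff x).1 hx 0) hxy.symm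
    · exact hne (congrArg (Sigma.mk 1)
        (hee i j _ ((mem_ball_pi_iff x).1 hx 0) _ ((mem_ball_pi_iff y).1 hy 0) hxy).1)
    · exact hef i j _ ((mem_ball_pi_iff x).1 hx 0) _
        ⟨(mem_ball_pi_iff y).1 hy 0, (mem_ball_pi_iff y).1 hy 1⟩ hxy
    · exact j.elim
    · exact hvf j i _ ⟨(mem_ball_pi_iff x).1 hx 0, (mem_ball_pi_iff x).1 hx 1⟩ hxy.symm
    · exact hef j i _ ((mem_ball_pi_iff y).1 hy 0) _
        ⟨(mem_ball_pi_iff x).1 hx 0, (mem_ball_pi_iff x).1 hx 1⟩ hxy.symm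
    · exact hne (congrArg (Sigma.mk 2)
        (hff i j _ ⟨(mem_ball_pi_iff x).1 hx 0, (mem_ball_pi_iff x).1 hx 1⟩ _
          ⟨(mem_ball_pi_iff y).1 hy 0, (mem_ball_pi_iff y).1 hy 1⟩ hxy).1)
    · exact j.elim
    all_goals exact i.elim
  · rintro (_ | _ | _ | n) i x hx
    -- The unit sphere of the one-point space is empty, so a vertex has no boundary.
    · rw [mem_sphere_zero_iff_norm, Subsingleton.elim x 0, norm_zero] at hx
      exact absurd hx zero_ne_one
    · have hv0 : ∀ a : A, ∀ y, v a = y → ∃ m < 1, ∃ j, ∃ z ∈ Metric.ball (0 : Fin m → ℝ) 1,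
          cellMap v e f m j z = y := fun a y h =>
        ⟨0, one_pos, a, 0, Metric.mem_ball_self one_pos, h⟩
      have hx1 := (mem_closedBall_pi_iff x).1 (Metric.sphere_subset_closedBall hx) 0
      have hx2 : ¬ (x ∈ Metric.ball 0 1) := fun h => by
        rw [Metric.mem_sphere] at hx
        rw [Metric.mem_ball, hx] at h
        exact lt_irrefl _ h
      rw [mem_ball_pi_iff, Fin.forall_fin_one] at hx2
      change ∃ m < 1, ∃ j, ∃ z ∈ Metric.ball (0 : Fin m → ℝ) 1,
        cellMap v e f m j z = e i ((x 0 + 1) / 2)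
      by_cases h0 : (x 0 + 1) / 2 = 0
      · rw [h0]
        obtain ⟨a, ha⟩ := (hebd i).1
        exact hv0 a _ ha
      · by_cases h1 : (x 0 + 1) / 2 = 1
        · rw [h1]
          obtain ⟨a, ha⟩ := (hebd i).2
          exact hv0 a _ ha
        · exact absurd ⟨lt_of_le_of_ne hx1.1 (Ne.symm h0), lt_of_le_of_ne hx1.2 h1⟩ hx2
    · have hx1 := (mem_closedBall_pi_iff x).1 (Metric.sphere_subset_closedBall hx)
      have hx2 : ¬ (x ∈ Metric.ball 0 1) := fun h => by
        rw [Metric.mem_sphere] at hx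
        rw [Metric.mem_ball, hx] at h
        exact lt_irrefl _ h
      rw [mem_ball_pi_iff, Fin.forall_fin_two] at hx2
      rcases hfbd i ((x 0 + 1) / 2, (x 1 + 1) / 2) ⟨hx1 0, hx1 1⟩ hx2 with ⟨a, ha⟩ | ⟨j, s, hs, hjs⟩
      · exact ⟨0, two_pos, a, 0, Metric.mem_ball_self one_pos, ha⟩
      · refine ⟨1, one_lt_two, j, fun _ => 2 * s - 1, ?_, ?_⟩
        · rw [mem_ball_pi_iff]
          intro _
          convert hs using 1
          ring
        · change e j ((2 * s - 1 + 1) / 2) = _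
          rw [show (2 * s - 1 + 1) / 2 = s by ring, hjs]
          rfl
    · exact i.elim
  · intro x
    constructor
    · intro hx
      rw [hS, mem_iUnion] at hx
      obtain ⟨i, p, hp, rfl⟩ := hx
      have hedge : ∀ j, ∀ s ∈ Ioo (0 : ℝ) 1, ∃ n i, ∃ y ∈ Metric.ball (0 : Fin n → ℝ) 1,
          cellMap v e f n i y = e j s := by
        intro j s hs
        refine ⟨1, j, fun _ => 2 * s - 1, ?_, ?_⟩
        · rw [mem_ball_pi_iff]
          intro _
          convert hs using 1
          ring
        · change e j ((2 * s - 1 + 1) / 2) = _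
          rw [show (2 * s - 1 + 1) / 2 = s by ring]
      by_cases hpo : p ∈ Ioo (0 : ℝ) 1 ×ˢ Ioo (0 : ℝ) 1
      · refine ⟨2, i, ![2 * p.1 - 1, 2 * p.2 - 1], ?_, ?_⟩
        · rw [mem_ball_pi_iff, Fin.forall_fin_two]
          simp only [Matrix.cons_val_zero, Matrix.cons_val_one]
          rw [show (2 * p.1 - 1 + 1) / 2 = p.1 by ring, show (2 * p.2 - 1 + 1) / 2 = p.2 by ring]
          exact hpo
        · change f i ((2 * p.1 - 1 + 1) / 2, (2 * p.2 - 1 + 1) / 2) = _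
          rw [show (2 * p.1 - 1 + 1) / 2 = p.1 by ring, show (2 * p.2 - 1 + 1) / 2 = p.2 by ring]
      · rcases hfbd i p hp hpo with ⟨a, ha⟩ | ⟨j, s, hs, hjs⟩
        · exact ⟨0, a, 0, Metric.mem_ball_self one_pos, ha⟩
        · rw [← hjs]
          exact hedge j s hs
    · rintro ⟨_ | _ | _ | n, i, y, hy, rfl⟩
      · exact hvS i
      · exact heS i _ ((mem_ball_pi_iff y).1 hy 0)
      · rw [hS, mem_iUnion]
        exact ⟨i, mem_image_of_mem _ ⟨Ioo_subset_Icc_self ((mem_ball_pi_iff y).1 hy 0),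
          Ioo_subset_Icc_self ((mem_ball_pi_iff y).1 hy 1)⟩⟩
      · exact i.elim

/-! ### Orientation of linear maps of the plane -/

theorem det_prod_real (M : (ℝ × ℝ) →L[ℝ] (ℝ × ℝ)) :
    M.det = (M (1, 0)).1 * (M (0, 1)).2 - (M (0, 1)).1 * (M (1, 0)).2 := by
  rw [ContinuousLinearMap.det, ← LinearMap.det_toMatrix (Module.Basis.finTwoProd ℝ),
    Matrix.det_fin_two]
  simp [LinearMap.toMatrix_apply]

theorem map_prod_eq {F : Type*} [NormedAddCommGroup F] [NormedSpace ℝ F] (M : (ℝ × ℝ) →L[ℝ] F)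
    (w : ℝ × ℝ) : M w = w.1 • M (1, 0) + w.2 • M (0, 1) := by
  rw [← map_smul, ← map_smul, ← map_add]
  simp

/-- The area form is multiplied by the determinant; this carries signs of frames from one chart to
another. -/
theorem det_apply_apply (M : (ℝ × ℝ) →L[ℝ] (ℝ × ℝ)) (w w' : ℝ × ℝ) :
    (M w).1 * (M w').2 - (M w).2 * (M w').1 = M.det * (w.1 * w'.2 - w.2 * w'.1) := by
  rw [det_prod_real, map_prod_eq M w, map_prod_eq M w']
  simp only [Prod.fst_add, Prod.snd_add, Prod.smul_fst, Prod.smul_snd, smul_eq_mul]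
  ring

/-- The charts `c` and `d` induce the same orientation of the common tangent plane at `c u = d v`. -/
def Compatible (c d : ℝ × ℝ → R4 × ℝ) (u v : ℝ × ℝ) : Prop :=
  ∃ M : (ℝ × ℝ) →L[ℝ] (ℝ × ℝ), fderiv ℝ c u = (fderiv ℝ d v).comp M ∧ 0 < M.det

theorem Compatible.refl (c : ℝ × ℝ → R4 × ℝ) (u : ℝ × ℝ) : Compatible c c u u :=
  ⟨ContinuousLinearMap.id ℝ _, by simp, by simp [det_prod_real]⟩

theorem Compatible.symm {c d : ℝ × ℝ → R4 × ℝ} {u v : ℝ × ℝ} (h : Compatible c d u v) :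
    Compatible d c v u := by
  obtain ⟨M, hM, hdet⟩ := h
  let e := M.toContinuousLinearEquivOfDetNeZero hdet.ne'
  have he : ∀ x, M (e.symm x) = x := fun x => e.apply_symm_apply x
  refine ⟨e.symm, ?_, ?_⟩
  · refine ContinuousLinearMap.ext fun x => ?_
    simp [hM, he]
  · have h1 := det_apply_apply M (e.symm (1, 0)) (e.symm (0, 1))
    rw [he, he] at h1
    rw [det_prod_real]
    simp only [ContinuousLinearEquiv.coe_coe]
    have h2 : 0 < M.det * ((e.symm (1, 0)).1 * (e.symm (0, 1)).2
      - (e.symm (1, 0)).2 * (e.symm (0, 1)).1) := by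
      rw [← h1]
      norm_num
    have h3 := pos_of_mul_pos_right h2 hdet.le
    linarith

/-- By the chain rule a coordinate change with positive Jacobian determinant is the required linear
map. All nontrivial chart transitions below are checked in this way. -/
theorem Compatible.of_eventuallyEq {c d : ℝ × ℝ → R4 × ℝ} {φ : ℝ × ℝ → ℝ × ℝ} {u : ℝ × ℝ}
    (h : c =ᶠ[nhds u] d ∘ φ) {M : (ℝ × ℝ) →L[ℝ] (ℝ × ℝ)} (hφ : HasFDerivAt φ M u)
    (hd : DifferentiableAt ℝ d (φ u)) (hM : 0 < M.det) : Compatible c d u (φ u) :=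
  ⟨M, by rw [h.fderiv_eq, fderiv_comp u hd hφ.differentiableAt, hφ.fderiv], hM⟩

/-! ### Lifting curves through immersions -/

/-- With a left inverse ℓ of f', the map ℓ ∘ f has derivative the identity and is locally
invertible. Near y₀ the lift q is this local inverse applied to the differentiable curve ℓ ∘ f ∘ q.
The set s admits one-sided derivatives, needed for curves that start on the boundary of an annulus.
-/
theorem exists_hasDerivWithinAt_lift {E F : Type*} [NormedAddCommGroup E] [NormedSpace ℝ E]
    [FiniteDimensional ℝ E] [NormedAddCommGroup F] [NormedSpace ℝ F] [FiniteDimensional ℝ F]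
    {f : E → F} {f' : E →L[ℝ] F} {q : ℝ → E} {s : Set ℝ} {y₀ : ℝ} {v : F}
    (hf : HasStrictFDerivAt f f' (q y₀)) (hf' : Function.Injective f')
    (hq : ContinuousWithinAt q s y₀) (hs : UniqueDiffWithinAt ℝ s y₀)
    (hfq : HasDerivWithinAt (fun y => f (q y)) v s y₀) :
    ∃ w, HasDerivWithinAt q w s y₀ ∧ f' w = v := by
  have : CompleteSpace E := FiniteDimensional.complete ℝ E
  obtain ⟨g, hg⟩ := LinearMap.exists_leftInverse_of_injective (f' : E →ₗ[ℝ] F)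
    (LinearMap.ker_eq_bot.2 hf')
  let ℓ : F →L[ℝ] E := LinearMap.toContinuousLinearMap g
  have hℓ : ℓ.comp f' = ContinuousLinearMap.id ℝ E := by
    ext x
    exact LinearMap.congr_fun hg x
  have h1 : HasStrictFDerivAt (fun x => ℓ (f x))
      ((ContinuousLinearEquiv.refl ℝ E : E ≃L[ℝ] E) : E →L[ℝ] E) (q y₀) := by
    have := ℓ.hasStrictFDerivAt.comp (q y₀) hf
    rw [hℓ] at this
    exact this
  have h2 := h1.to_localInverse
  have h3 := h1.eventually_left_inverse
  have h4 : HasDerivWithinAt (fun y => ℓ (f (q y))) (ℓ v) s y₀ :=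
    ℓ.hasFDerivAt.comp_hasDerivWithinAt y₀ hfq
  have h5 := h2.hasFDerivAt.comp_hasDerivWithinAt y₀ h4
  have h6 : HasDerivWithinAt q (ℓ v) s y₀ := by
    refine (h5.congr_of_eventuallyEq ?_ ?_)
    · filter_upwards [hq.eventually h3] with y hy
      exact hy.symm
    · exact h3.self_of_nhds.symm
  refine ⟨ℓ v, h6, ?_⟩
  have h7 : HasDerivWithinAt (fun y => f (q y)) (f' (ℓ v)) s y₀ :=
    hf.hasFDerivAt.comp_hasDerivWithinAt y₀ h6
  rw [← h7.derivWithin hs, hfq.derivWithin hs]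

theorem exists_hasDerivAt_lift {E F : Type*} [NormedAddCommGroup E] [NormedSpace ℝ E]
    [FiniteDimensional ℝ E] [NormedAddCommGroup F] [NormedSpace ℝ F] [FiniteDimensional ℝ F]
    {f : E → F} {f' : E →L[ℝ] F} {q : ℝ → E} {y₀ : ℝ} {v : F}
    (hf : HasStrictFDerivAt f f' (q y₀)) (hf' : Function.Injective f')
    (hq : ContinuousAt q y₀) (hfq : HasDerivAt (fun y => f (q y)) v y₀) :
    ∃ w, HasDerivAt q w y₀ ∧ f' w = v := by
  obtain ⟨w, hw, hw'⟩ := exists_hasDerivWithinAt_lift hf hf' hq.continuousWithinAt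
    uniqueDiffWithinAt_univ hfq.hasDerivWithinAt
  exact ⟨w, hasDerivWithinAt_univ.1 hw, hw'⟩

/-! ### Surfaces swept out by arcs that run from bottom to top -/

theorem isCompact_of_sweep {ι : Type*} [Finite ι] {S : Set (R4 × ℝ)} {F : ι → ℝ × ℝ → R4 × ℝ}
    (hF : ∀ i, ContinuousOn (F i) (Icc 0 1 ×ˢ Icc 0 1))
    (hS : S = ⋃ i, F i '' (Icc 0 1 ×ˢ Icc 0 1)) : IsCompact S := by
  rw [hS]
  exact isCompact_iUnion fun i => (isCompact_Icc.prod isCompact_Icc).image_of_continuousOn (hF i)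

/-- The arc `r ↦ F i (r, s)` through a point stays in S and runs from level 0 to level 1. -/
theorem components_of_sweep {ι : Type*} {S : Set (R4 × ℝ)} {F : ι → ℝ × ℝ → R4 × ℝ}
    (hF : ∀ i, ContinuousOn (F i) (Icc 0 1 ×ˢ Icc 0 1))
    (hlevel : ∀ i, ∀ p ∈ Icc (0 : ℝ) 1 ×ˢ Icc (0 : ℝ) 1, (F i p).2 = p.1)
    (hS : S = ⋃ i, F i '' (Icc 0 1 ×ˢ Icc 0 1)) :
    ∀ x ∈ S, (∃ y ∈ connectedComponentIn S x, y.2 = 0) ∧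
      ∃ y ∈ connectedComponentIn S x, y.2 = 1 := by
  intro x hx
  rw [hS, mem_iUnion] at hx
  obtain ⟨i, ⟨t, s⟩, ⟨ht, hs⟩, rfl⟩ := hx
  have hpre : IsPreconnected ((fun r => F i (r, s)) '' Icc (0 : ℝ) 1) :=
    isPreconnected_Icc.image _ ((hF i).comp (by fun_prop) fun r hr => ⟨hr, hs⟩)
  have hsub : (fun r => F i (r, s)) '' Icc (0 : ℝ) 1 ⊆ connectedComponentIn S (F i (t, s)) := by
    refine hpre.subset_connectedComponentIn ⟨t, ht, rfl⟩ ?_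
    rintro _ ⟨r, hr, rfl⟩
    rw [hS, mem_iUnion]
    exact ⟨i, (r, s), ⟨hr, hs⟩, rfl⟩
  have h0 : (0 : ℝ) ∈ Icc (0 : ℝ) 1 := ⟨le_rfl, zero_le_one⟩
  have h1 : (1 : ℝ) ∈ Icc (0 : ℝ) 1 := ⟨zero_le_one, le_rfl⟩
  exact ⟨⟨_, hsub ⟨0, h0, rfl⟩, hlevel i (0, s) ⟨h0, hs⟩⟩,
    ⟨_, hsub ⟨1, h1, rfl⟩, hlevel i (1, s) ⟨h1, hs⟩⟩⟩

/-! ### Charts of the form `(t, s) ↦ (c (t, s), t)` -/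

theorem fderiv_level {c : ℝ × ℝ → R4} {u : ℝ × ℝ} (hc : DifferentiableAt ℝ c u) (w : ℝ × ℝ) :
    fderiv ℝ (fun p : ℝ × ℝ => (c p, p.1)) u w = (fderiv ℝ c u w, w.1) := by
  have h : HasFDerivAt (fun p : ℝ × ℝ => (c p, p.1)) _ u := hc.hasFDerivAt.prodMk hasFDerivAt_fst
  rw [h.fderiv]
  rfl

theorem fderiv_apply_zero_one {F : Type*} [NormedAddCommGroup F] [NormedSpace ℝ F]
    {c : ℝ × ℝ → F} {u : ℝ × ℝ} (hc : DifferentiableAt ℝ c u) :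
    HasDerivAt (fun s => c (u.1, s)) (fderiv ℝ c u (0, 1)) u.2 := by
  have h1 : HasDerivAt (fun s : ℝ => (u.1, s)) ((0 : ℝ), (1 : ℝ)) u.2 :=
    (hasDerivAt_const _ _).prodMk (hasDerivAt_id _)
  exact HasFDerivAt.comp_hasDerivAt u.2 (f := fun s : ℝ => (u.1, s)) hc.hasFDerivAt h1

theorem fderiv_apply_one_zero {F : Type*} [NormedAddCommGroup F] [NormedSpace ℝ F]
    {c : ℝ × ℝ → F} {u : ℝ × ℝ} (hc : DifferentiableAt ℝ c u) :
    HasDerivAt (fun s => c (s, u.2)) (fderiv ℝ c u (1, 0)) u.1 := by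
  have h1 : HasDerivAt (fun s : ℝ => (s, u.2)) ((1 : ℝ), (0 : ℝ)) u.1 :=
    (hasDerivAt_id _).prodMk (hasDerivAt_const _ _)
  exact HasFDerivAt.comp_hasDerivAt u.1 (f := fun s : ℝ => (s, u.2)) hc.hasFDerivAt h1

/-- When the level is itself a coordinate, transversality to the ends is automatic, and a tangent
vector in the kernel is horizontal, so only the derivative in the second variable matters. -/
theorem isLocalParam_level {S : Set (R4 × ℝ)} {c : ℝ × ℝ → R4} {V : Set (ℝ × ℝ)}
    (hc : ContDiff ℝ ∞ c) (hV : IsOpen V) (hnorm : ∀ u ∈ V, ‖c u‖ = 1)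
    (himm : ∀ u ∈ V, fderiv ℝ c u (0, 1) ≠ 0)
    (hemb : Topology.IsEmbedding (V.domRestrict fun p : ℝ × ℝ => (c p, p.1)))
    (hrel : ∃ W : Set (R4 × ℝ), IsOpen W ∧ S ∩ W = (fun p : ℝ × ℝ => (c p, p.1)) '' V ∩ slab) :
    IsLocalParam S (fun p => (c p, p.1)) V := by
  have hd : ∀ u, DifferentiableAt ℝ c u := fun u => hc.differentiable (by simp) u
  refine ⟨hV, (hc.prodMk contDiff_fst).contDiffOn, hnorm, ?_, hemb, hrel, ?_⟩
  · intro u hu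
    rw [injective_iff_map_eq_zero]
    intro w hw
    rw [fderiv_level (hd u), Prod.mk_eq_zero] at hw
    have h1 := hw.1
    rw [map_prod_eq, hw.2, zero_smul, zero_add, smul_eq_zero] at h1
    exact Prod.ext hw.2 (h1.resolve_right (himm u hu))
  · intro u _ _
    refine ⟨(1, 0), ?_⟩
    rw [fderiv_level (hd u)]
    exact one_ne_zero

/-- The frame is (1, 0), which points upwards, followed by (0, l); its determinant is l. -/
theorem boundaryOriented_level {L : OrientedLink} {lvl : ℝ} {c : ℝ × ℝ → R4} {V : Set (ℝ × ℝ)}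
    (hc : ContDiff ℝ ∞ c)
    (h : ∀ u ∈ V, ∀ i s, u.1 = lvl → c u = L.γ i s →
      ∃ l : ℝ, 0 < l ∧ l • fderiv ℝ c u (0, 1) = deriv (L.γ i) s) :
    BoundaryOriented L lvl (fun p => (c p, p.1)) V := by
  have hd : ∀ u, DifferentiableAt ℝ c u := fun u => hc.differentiable (by simp) u
  intro u hu i s hus
  rw [Prod.mk.injEq] at hus
  obtain ⟨l, hl, h1⟩ := h u hu i s hus.2 hus.1
  refine ⟨(1, 0), (0, l), ?_, ?_, ?_⟩
  · rw [fderiv_level (hd u)]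
    exact one_pos
  · rw [fderiv_level (hd u), map_prod_eq, ← h1]
    simp
  · simpa using hl

/-! ### Periodic parametrizations -/

theorem IsLink.add_int {n : ℕ} {γ : Fin n → ℝ → R4} (h : IsLink γ) (i : Fin n) (s : ℝ) (k : ℤ) :
    γ i (s + k) = γ i s := by
  have hp : Function.Periodic (γ i) 1 := h.periodic i
  simpa using hp.int_mul k s

theorem IsLink.deriv_add_int {n : ℕ} {γ : Fin n → ℝ → R4} (h : IsLink γ) (i : Fin n) (s : ℝ)
    (k : ℤ) : deriv (γ i) (s + k) = deriv (γ i) s := by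
  have h1 : (fun s => γ i (s + k)) = γ i := funext fun s => h.add_int i s k
  have h2 := deriv_comp_add_const (γ i) (k : ℝ) s
  rw [h1] at h2
  exact h2.symm

/-- Parameters of the same point differ by a period, so the velocity of a link depends only on the
point. -/
theorem IsLink.deriv_eq {n : ℕ} {γ : Fin n → ℝ → R4} (h : IsLink γ) {i j : Fin n} {s t : ℝ}
    (hst : γ i s = γ j t) : deriv (γ i) s = deriv (γ j) t := by
  obtain ⟨rfl, k, rfl⟩ := h.injective i j s t hst
  exact (h.deriv_add_int i s k).symm

/-! ### The trace of an isotopy -/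

/-- The trace of a family of links, in `S³ × [0, 1]`. -/
def traceMap {n : ℕ} (Γ : ℝ → Fin n → ℝ → R4) (i : Fin n) (p : ℝ × ℝ) : R4 × ℝ :=
  (Γ p.1 i p.2, p.1)

/-- Each component sweeps out an annulus, cut open along the arc s = 0 into one rectangle: two
vertices, three edges and one face, so 2 - 3 + 1 = 0. -/
theorem hasEulerChar_trace {n : ℕ} {Γ : ℝ → Fin n → ℝ → R4}
    (hΓ : ∀ i, ContDiff ℝ ∞ (fun p : ℝ × ℝ => Γ p.1 i p.2)) (hlink : ∀ t, IsLink (Γ t)) :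
    HasEulerChar (⋃ i, traceMap Γ i '' (Icc 0 1 ×ˢ Icc 0 1)) 0 := by
  have hcont : ∀ i, Continuous (traceMap Γ i) := fun i => (hΓ i).continuous.prodMk continuous_fst
  have hinj : ∀ i j t t' s s', traceMap Γ i (t, s) = traceMap Γ j (t', s') →
      t = t' ∧ i = j ∧ ∃ k : ℤ, s' = s + k := by
    intro i j t t' s s' h
    simp only [traceMap, Prod.mk.injEq] at h
    obtain ⟨h, rfl⟩ := h
    exact ⟨rfl, (hlink t).injective i j s s' h⟩
  have hper : ∀ i t, traceMap Γ i (t, 1) = traceMap Γ i (t, 0) := by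
    intro i t
    have := (hlink t).periodic i 0
    rw [zero_add] at this
    simp [traceMap, this]
  have hk : ∀ s s' : ℝ, s ∈ Ioo (0 : ℝ) 1 → s' ∈ Icc (0 : ℝ) 1 → ∀ k : ℤ, s' = s + k → s' = s := by
    intro s s' hs hs' k hk
    have h1 : (k : ℝ) < 1 := by linarith [hs.1, hs'.2]
    have h2 : (-1 : ℝ) < k := by linarith [hs.2, hs'.1]
    have h3 : k < 1 := by exact_mod_cast h1
    have h4 : -1 < k := by exact_mod_cast h2
    have h5 : k = 0 := by omega
    rw [hk, h5]
    simp
  have h01 : ∀ s ∈ Ioo (0 : ℝ) 1, ∀ k : ℤ, s ≠ 0 + k := by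
    intro s hs k h
    have := hk s 0 hs ⟨le_rfl, zero_le_one⟩ (-k) (by push_cast; linarith)
    exact hs.1.ne this
  have hI0 : (0 : ℝ) ∈ Icc (0 : ℝ) 1 := ⟨le_rfl, zero_le_one⟩
  have hI1 : (1 : ℝ) ∈ Icc (0 : ℝ) 1 := ⟨zero_le_one, le_rfl⟩
  have hbool : ∀ b : Bool, (if b then (1 : ℝ) else 0) ∈ Icc (0 : ℝ) 1 := by
    rintro (_ | _) <;> simp
  have hboolinj : ∀ b b' : Bool, (if b then (1 : ℝ) else 0) = (if b' then 1 else 0) → b = b' := by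
    rintro (_ | _) (_ | _) <;> simp
  have hbool2 : ∀ b : Bool, ∀ t ∈ Ioo (0 : ℝ) 1, (if b then (1 : ℝ) else 0) ≠ t := by
    rintro (_ | _) t ht h
    · exact ht.1.ne h
    · exact ht.2.ne h.symm
  -- The Booleans stand for the levels 0 and 1. The edge `none` is the cut s = 0 running from bottom
  -- to top, the edges `some r` are the end circles minus one point.
  have key := hasEulerChar_of_rectangles (S := ⋃ i, traceMap Γ i '' (Icc 0 1 ×ˢ Icc 0 1))
    (A := Fin n × Bool) (B := Fin n × Option Bool) (C := Fin n)
    (fun a => traceMap Γ a.1 (if a.2 then 1 else 0, 0))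
    (fun b s => match b.2 with
      | none => traceMap Γ b.1 (s, 0)
      | some r => traceMap Γ b.1 (if r then 1 else 0, s))
    (fun i => traceMap Γ i) ?_ (fun i => (hcont i).continuousOn) ?_ ?_ ?_ ?_ ?_ ?_ ?_ ?_ ?_ ?_ rfl
  · convert key using 1
    simp
    ring
  · rintro ⟨i, _ | r⟩
    · exact ((hcont i).comp (by fun_prop : Continuous fun s : ℝ => (s, (0 : ℝ)))).continuousOn
    · exact ((hcont i).comp
        (by fun_prop : Continuous fun s : ℝ => ((if r then (1 : ℝ) else 0), s))).continuousOn
  · rintro ⟨i, b⟩ ⟨j, b'⟩ h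
    obtain ⟨h1, h2, -⟩ := hinj _ _ _ _ _ _ h
    exact Prod.ext h2 (hboolinj _ _ h1)
  · rintro ⟨i, b⟩ ⟨j, _ | r⟩ s hs h
    · obtain ⟨h1, -⟩ := hinj _ _ _ _ _ _ h
      exact hbool2 b s hs h1
    · obtain ⟨-, -, k, h1⟩ := hinj _ _ _ _ _ _ h
      exact h01 s hs k h1
  · rintro ⟨i, b⟩ j ⟨t, s⟩ ⟨-, hs⟩ h
    obtain ⟨-, -, k, h1⟩ := hinj _ _ _ _ _ _ h
    exact h01 s hs k h1
  · rintro ⟨i, _ | r⟩ ⟨j, _ | r'⟩ s hs s' hs' h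
    · obtain ⟨h1, h2, -⟩ := hinj _ _ _ _ _ _ h
      exact ⟨Prod.ext h2 rfl, h1⟩
    · obtain ⟨-, -, k, h1⟩ := hinj _ _ _ _ _ _ h
      exact absurd h1 (h01 s' hs' k)
    · obtain ⟨-, -, k, h1⟩ := hinj _ _ _ _ _ _ h.symm
      exact absurd h1 (h01 s hs k)
    · obtain ⟨h1, h2, k, h3⟩ := hinj _ _ _ _ _ _ h
      refine ⟨?_, (hk s s' hs (Ioo_subset_Icc_self hs') k h3).symm⟩
      rw [Prod.mk.injEq]
      exact ⟨h2, congrArg some (hboolinj _ _ h1)⟩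
  · rintro ⟨i, _ | r⟩ j s hs ⟨t, s'⟩ ⟨ht, hs'⟩ h
    · obtain ⟨-, -, k, h1⟩ := hinj _ _ _ _ _ _ h
      exact absurd h1 (h01 s' hs' k)
    · obtain ⟨h1, -⟩ := hinj _ _ _ _ _ _ h
      exact hbool2 r t ht h1
  · rintro i j ⟨t, s⟩ ⟨ht, hs⟩ ⟨t', s'⟩ ⟨ht', hs'⟩ h
    obtain ⟨h1, h2, k, h3⟩ := hinj _ _ _ _ _ _ h
    exact ⟨h2, Prod.ext h1 (hk s s' hs (Ioo_subset_Icc_self hs') k h3).symm⟩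
  · rintro ⟨i, _ | r⟩
    · exact ⟨⟨(i, false), by simp⟩, ⟨(i, true), by simp⟩⟩
    · exact ⟨⟨(i, r), rfl⟩, ⟨(i, r), (hper i _).symm⟩⟩
  · rintro i ⟨t, s⟩ ⟨ht, hs⟩ hn
    simp only at ht hs
    have hedge : ∀ s : ℝ, (∃ a : Fin n × Bool, traceMap Γ a.1 (if a.2 then 1 else 0, 0) =
        traceMap Γ i (t, 0)) ∨ t ∈ Ioo (0 : ℝ) 1 := by
      intro _
      by_cases h0 : t = 0
      · exact Or.inl ⟨(i, false), by simp [h0]⟩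
      · by_cases h1 : t = 1
        · exact Or.inl ⟨(i, true), by simp [h1]⟩
        · exact Or.inr ⟨lt_of_le_of_ne ht.1 (Ne.symm h0), lt_of_le_of_ne ht.2 h1⟩
    by_cases hs0 : traceMap Γ i (t, s) = traceMap Γ i (t, 0)
    · rw [hs0]
      rcases hedge s with h | h
      · exact Or.inl h
      · exact Or.inr ⟨(i, none), t, h, rfl⟩
    · have hs' : s ∈ Ioo (0 : ℝ) 1 := by
        refine ⟨lt_of_le_of_ne hs.1 ?_, lt_of_le_of_ne hs.2 ?_⟩
        · rintro rfl
          exact hs0 rfl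
        · rintro rfl
          exact hs0 (hper i t)
      right
      by_cases h0 : t = 0
      · exact ⟨(i, some false), s, hs', by simp [h0]⟩
      · by_cases h1 : t = 1
        · exact ⟨(i, some true), s, hs', by simp [h1]⟩
        · exact absurd ⟨⟨lt_of_le_of_ne ht.1 (Ne.symm h0), lt_of_le_of_ne ht.2 h1⟩, hs'⟩ hn
  · rintro ⟨i, b⟩
    exact mem_iUnion.2 ⟨i, _, ⟨hbool b, hI0⟩, rfl⟩
  · rintro ⟨i, _ | r⟩ s hs
    · exact mem_iUnion.2 ⟨i, _, ⟨Ioo_subset_Icc_self hs, hI0⟩, rfl⟩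
    · exact mem_iUnion.2 ⟨i, _, ⟨hbool r, Ioo_subset_Icc_self hs⟩, rfl⟩

theorem exists_int_mem_Ioc (s a : ℝ) : ∃ k : ℤ, s + k ∈ Ioc a (a + 1) := by
  obtain ⟨k, hk, -⟩ := existsUnique_add_zsmul_mem_Ioc one_pos s a
  exact ⟨k, by simpa using hk⟩

theorem isCobordism_trace {L L' : OrientedLink} {e : Fin L.n ≃ Fin L'.n}
    {Γ : ℝ → Fin L.n → ℝ → R4}
    (hΓ : ∀ i, ContDiff ℝ ∞ (fun p : ℝ × ℝ => Γ p.1 i p.2)) (hlink : ∀ t, IsLink (Γ t))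
    (h0 : ∀ i s, Γ 0 i s = L.γ i s) (h1 : ∀ i s, Γ 1 i s = L'.γ (e i) s) :
    IsCobordism (⋃ i, traceMap Γ i '' (Icc 0 1 ×ˢ Icc 0 1)) L L' := by
  have hcont : ∀ i, Continuous (traceMap Γ i) := fun i => (hΓ i).continuous.prodMk continuous_fst
  have hd : ∀ i u, DifferentiableAt ℝ (fun p : ℝ × ℝ => Γ p.1 i p.2) u :=
    fun i u => (hΓ i).differentiable (by simp) u
  have hd01 : ∀ i (u : ℝ × ℝ), fderiv ℝ (fun p : ℝ × ℝ => Γ p.1 i p.2) u (0, 1) =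
      deriv (Γ u.1 i) u.2 := fun i u => (fderiv_apply_zero_one (hd i u)).deriv.symm
  have hinj : ∀ i j t t' s s', traceMap Γ i (t, s) = traceMap Γ j (t', s') →
      t = t' ∧ i = j ∧ ∃ k : ℤ, s' = s + k := by
    intro i j t t' s s' h
    simp only [traceMap, Prod.mk.injEq] at h
    obtain ⟨h, rfl⟩ := h
    exact ⟨rfl, (hlink t).injective i j s s' h⟩
  set S : Set (R4 × ℝ) := ⋃ i, traceMap Γ i '' (Icc 0 1 ×ˢ Icc 0 1) with hSdef
  have hmem : ∀ i t s, t ∈ Icc (0 : ℝ) 1 → traceMap Γ i (t, s) ∈ S := by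
    intro i t s ht
    obtain ⟨k, hk⟩ := exists_int_mem_Ioc s 0
    rw [zero_add] at hk
    refine mem_iUnion.2 ⟨i, (t, s + k), ⟨ht, Ioc_subset_Icc_self hk⟩, ?_⟩
    simp [traceMap, (hlink t).add_int]
  -- Half a period keeps the closed strip injective, and levels from -1 to 2 make the chart a
  -- neighbourhood of both ends. The set removed to get relative openness consists of the other
  -- components and the complementary half-period.
  have hchart : ∀ i a, IsLocalParam S (traceMap Γ i) (Ioo (-1) 2 ×ˢ Ioo a (a + 1 / 2)) := by
    intro i a
    refine isLocalParam_level (hΓ i) (isOpen_Ioo.prod isOpen_Ioo)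
      (fun u _ => (hlink _).norm_eq_one _ _) ?_ ?_ ?_
    · intro u _
      rw [hd01]
      exact (hlink _).deriv_ne_zero _ _
    · refine isEmbedding_domRestrict (K := Icc (-1) 2 ×ˢ Icc a (a + 1 / 2))
        (isCompact_Icc.prod isCompact_Icc) (prod_mono Ioo_subset_Icc_self Ioo_subset_Icc_self)
        (hcont i).continuousOn ?_
      rintro ⟨t, s⟩ ⟨-, hs⟩ ⟨t', s'⟩ ⟨-, hs'⟩ h
      obtain ⟨rfl, -, k, rfl⟩ := hinj _ _ _ _ _ _ h
      simp only [mem_Icc] at hs hs'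
      have h1 : (k : ℝ) < 1 := by linarith
      have h2 : (-1 : ℝ) < k := by linarith
      have h3 : k < 1 := by exact_mod_cast h1
      have h4 : -1 < k := by exact_mod_cast h2
      have h5 : k = 0 := by omega
      simp [h5]
    · let Z : Set (R4 × ℝ) := (⋃ (j : Fin L.n) (_ : j ≠ i), traceMap Γ j '' (Icc 0 1 ×ˢ Icc 0 1)) ∪
        traceMap Γ i '' (Icc 0 1 ×ˢ Icc (a + 1 / 2) (a + 1))
      have hZ : IsCompact Z := by
        refine IsCompact.union ?_ ((isCompact_Icc.prod isCompact_Icc).image (hcont i))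
        exact isCompact_iUnion fun j => isCompact_iUnion fun _ =>
          (isCompact_Icc.prod isCompact_Icc).image (hcont j)
      refine ⟨Zᶜ, hZ.isClosed.isOpen_compl, ?_⟩
      ext x
      constructor
      · rintro ⟨hxS, hxZ⟩
        obtain ⟨j, ⟨t, s⟩, ⟨ht, hs⟩, rfl⟩ := mem_iUnion.1 hxS
        have hji : j = i := by
          by_contra hji
          exact hxZ (Or.inl (mem_iUnion₂.2 ⟨j, hji, (t, s), ⟨ht, hs⟩, rfl⟩))
        subst hji
        obtain ⟨k, hk⟩ := exists_int_mem_Ioc s a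
        have hper : traceMap Γ j (t, s) = traceMap Γ j (t, s + k) := by
          simp [traceMap, (hlink t).add_int]
        rw [hper] at hxZ ⊢
        have hlt : s + k < a + 1 / 2 := by
          by_contra hge
          exact hxZ (Or.inr ⟨(t, s + k), ⟨ht, not_lt.1 hge, hk.2⟩, rfl⟩)
        refine ⟨⟨(t, s + k), ⟨?_, hk.1, hlt⟩, rfl⟩, ht⟩
        exact ⟨by linarith [ht.1], by linarith [ht.2]⟩
      · rintro ⟨⟨⟨t, s⟩, ⟨-, hs⟩, rfl⟩, ht⟩
        refine ⟨hmem i t s ht, ?_⟩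
        rintro (hx | hx)
        · obtain ⟨j, hji, ⟨t', s'⟩, -, h⟩ := mem_iUnion₂.1 hx
          exact hji (hinj _ _ _ _ _ _ h).2.1
        · obtain ⟨⟨t', s'⟩, ⟨-, hs'⟩, h⟩ := hx
          obtain ⟨-, -, k, hk⟩ := hinj _ _ _ _ _ _ h
          simp only [mem_Ioo, mem_Icc] at hs hs'
          have h1 : (k : ℝ) < 0 := by linarith
          have h2 : (-1 : ℝ) < k := by linarith
          have h3 : k < 0 := by exact_mod_cast h1
          have h4 : -1 < k := by exact_mod_cast h2
          omega
  have hend : ∀ (lvl : ℝ) (M : OrientedLink) (e : Fin L.n ≃ Fin M.n),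
      lvl ∈ Icc (0 : ℝ) 1 → (∀ i s, Γ lvl i s = M.γ (e i) s) →
      {x | (x, lvl) ∈ S} = M.carrier := by
    intro lvl M e hlvl hM
    ext x
    simp only [mem_ofPred_eq, OrientedLink.carrier, mem_iUnion, mem_range]
    constructor
    · intro hx
      obtain ⟨i, ⟨t, s⟩, -, h⟩ := mem_iUnion.1 hx
      simp only [traceMap, Prod.mk.injEq] at h
      obtain ⟨h, rfl⟩ := h
      exact ⟨e i, s, by rw [← hM, h]⟩
    · rintro ⟨i, s, rfl⟩
      have := hmem (e.symm i) lvl s hlvl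
      simpa [traceMap, hM] using this
  have horient : ∀ (lvl : ℝ) (M : OrientedLink) (e : Fin L.n ≃ Fin M.n),
      (∀ i s, Γ lvl i s = M.γ (e i) s) → ∀ i V, BoundaryOriented M lvl (traceMap Γ i) V := by
    intro lvl M e hM i V
    refine boundaryOriented_level (hΓ i) ?_
    rintro ⟨t, s⟩ - j s' rfl h
    refine ⟨1, one_pos, ?_⟩
    rw [one_smul, hd01]
    have h' : M.γ (e i) s = M.γ j s' := by rw [← hM]; exact h
    rw [← M.isLink.deriv_eq h']
    exact congrArg (fun f => deriv f s) (funext fun s => hM i s)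
  refine ⟨isCompact_of_sweep (fun i => (hcont i).continuousOn) hSdef, ?_,
    ⟨{c | ∃ i a, c = (traceMap Γ i, Ioo (-1) 2 ×ˢ Ioo a (a + 1 / 2))}, ?_, ?_, ?_, ?_⟩,
    hend 0 L (Equiv.refl _) ⟨le_rfl, zero_le_one⟩ h0, hend 1 L' e ⟨zero_le_one, le_rfl⟩ h1,
    components_of_sweep (fun i => (hcont i).continuousOn) (fun _ _ _ => rfl) hSdef⟩
  · intro x hx
    obtain ⟨i, p, hp, rfl⟩ := mem_iUnion.1 hx
    exact hp.1
  · rintro _ ⟨i, a, rfl⟩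
    exact hchart i a
  · intro x hx
    obtain ⟨i, ⟨t, s⟩, ⟨ht, -⟩, rfl⟩ := mem_iUnion.1 hx
    refine ⟨_, ⟨i, s - 1 / 4, rfl⟩, (t, s), ⟨⟨?_, ?_⟩, ?_, ?_⟩, rfl⟩ <;>
      linarith [ht.1, ht.2]
  · rintro _ ⟨i, a, rfl⟩ _ ⟨j, a', rfl⟩ ⟨t, s⟩ - ⟨t', s'⟩ - h -
    obtain ⟨rfl, rfl, k, rfl⟩ := hinj _ _ _ _ _ _ h
    have hφ : HasFDerivAt (fun p : ℝ × ℝ => (p.1, p.2 + (k : ℝ))) (ContinuousLinearMap.id ℝ (ℝ × ℝ))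
        (t, s) := by
      have : HasFDerivAt (fun p : ℝ × ℝ => p + ((0 : ℝ), (k : ℝ)))
          (ContinuousLinearMap.id ℝ (ℝ × ℝ)) (t, s) := (hasFDerivAt_id _).add_const _
      refine this.congr_of_eventuallyEq (Filter.Eventually.of_forall fun p => ?_)
      simp [Prod.ext_iff]
    refine Compatible.of_eventuallyEq (φ := fun p : ℝ × ℝ => (p.1, p.2 + (k : ℝ)))
      (Filter.Eventually.of_forall fun p => ?_) hφ ?_ (by simp [det_prod_real])
    · simp [traceMap, (hlink _).add_int]
    · exact (hd _ _).prodMk differentiableAt_fst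
  · rintro _ ⟨i, a, rfl⟩
    exact ⟨horient 0 L (Equiv.refl _) h0 i _, horient 1 L' e h1 i _⟩

theorem Isotopic.exists_isCobordism {L L' : OrientedLink} (h : Isotopic L L') :
    ∃ S, IsCobordism S L L' ∧ HasEulerChar S 0 := by
  obtain ⟨e, G, hG, hlink, h0, h1⟩ := h
  -- The isotopy is a family of links only for times in [0, 1], whereas charts need levels beyond
  -- the ends. The smooth transition function maps ℝ into [0, 1] and fixes 0 and 1.
  let Γ : ℝ → Fin L.n → ℝ → R4 := fun t => G (Real.smoothTransition t)
  have hΓ : ∀ i, ContDiff ℝ ∞ (fun p : ℝ × ℝ => Γ p.1 i p.2) := fun i =>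
    (hG i).comp ((Real.smoothTransition.contDiff.comp contDiff_fst).prodMk contDiff_snd)
  have hl : ∀ t, IsLink (Γ t) := fun t =>
    hlink _ ⟨Real.smoothTransition.nonneg t, Real.smoothTransition.le_one t⟩
  refine ⟨_, isCobordism_trace hΓ hl (e := e) ?_ ?_, hasEulerChar_trace hΓ hl⟩
  · intro i s
    simp [Γ, h0]
  · intro i s
    simp [Γ, h1]

/-! ### Reversing orientations -/

theorem IsLink.comp_neg {n : ℕ} {γ : Fin n → ℝ → R4} (h : IsLink γ) :
    IsLink fun i t => γ i (-t) := by
  refine ⟨fun i => (h.smooth i).comp contDiff_neg, fun i t => ?_, fun i t => h.norm_eq_one i _,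
    fun i t => ?_, fun i j s t hst => ?_⟩
  · have := h.add_int i (-t) (-1)
    rw [← this]
    push_cast
    congr 1
    ring
  · rw [deriv_comp_neg]
    exact neg_ne_zero.2 (h.deriv_ne_zero i _)
  · obtain ⟨hij, k, hk⟩ := h.injective i j _ _ hst
    refine ⟨hij, -k, ?_⟩
    push_cast
    linarith

/-- The link with the orientations of all components reversed. -/
def OrientedLink.reverse (L : OrientedLink) : OrientedLink :=
  ⟨L.n, L.n_pos, fun i t => L.γ i (-t), L.isLink.comp_neg⟩

theorem OrientedLink.carrier_reverse (L : OrientedLink) : L.reverse.carrier = L.carrier := by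
  unfold OrientedLink.carrier
  refine iUnion_congr fun i => ?_
  exact (Equiv.neg ℝ).surjective.range_comp (L.γ i)

theorem OrientedLink.reverse_reverse (L : OrientedLink) : L.reverse.reverse = L := by
  cases L
  simp [OrientedLink.reverse]

theorem OrientedLink.deriv_reverse (L : OrientedLink) (i : Fin L.n) (s : ℝ) :
    deriv (L.reverse.γ i) s = -deriv (L.γ i) (-s) :=
  deriv_comp_neg _ _

/-- The interchange of the coordinates of the plane. -/
def planeSwap : (ℝ × ℝ) ≃L[ℝ] (ℝ × ℝ) := ContinuousLinearEquiv.prodComm ℝ ℝ ℝ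

theorem planeSwap_apply (u : ℝ × ℝ) : planeSwap u = (u.2, u.1) := rfl

theorem fderiv_comp_planeSwap (ψ : ℝ × ℝ → R4 × ℝ) (u : ℝ × ℝ) :
    fderiv ℝ (ψ ∘ planeSwap) u =
      (fderiv ℝ ψ (planeSwap u)).comp (planeSwap : (ℝ × ℝ) →L[ℝ] (ℝ × ℝ)) :=
  planeSwap.comp_right_fderiv

theorem image_planeSwap_preimage (ψ : ℝ × ℝ → R4 × ℝ) (V : Set (ℝ × ℝ)) :
    (ψ ∘ planeSwap) '' (planeSwap ⁻¹' V) = ψ '' V := by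
  rw [image_comp, image_preimage_eq _ planeSwap.surjective]

theorem IsLocalParam.comp_planeSwap {S : Set (R4 × ℝ)} {ψ : ℝ × ℝ → R4 × ℝ} {V : Set (ℝ × ℝ)}
    (h : IsLocalParam S ψ V) : IsLocalParam S (ψ ∘ planeSwap) (planeSwap ⁻¹' V) := by
  refine ⟨h.isOpen.preimage planeSwap.continuous, ?_, fun u hu => h.norm_eq_one _ hu, ?_, ?_, ?_, ?_⟩
  · exact h.smooth.comp planeSwap.contDiff.contDiffOn fun u hu => hu
  · intro u hu
    rw [fderiv_comp_planeSwap]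
    exact (h.immersion _ hu).comp planeSwap.injective
  · have : (planeSwap ⁻¹' V).domRestrict (ψ ∘ planeSwap) =
        V.domRestrict ψ ∘ (planeSwap.toHomeomorph.subtype fun _ => Iff.rfl :
          (planeSwap ⁻¹' V : Set (ℝ × ℝ)) ≃ₜ V) := rfl
    rw [this]
    exact h.embedding.comp (Homeomorph.isEmbedding _)
  · rw [image_planeSwap_preimage]
    exact h.relOpen
  · intro u hu hu'
    obtain ⟨w, hw⟩ := h.transverse _ hu hu'
    refine ⟨planeSwap w, ?_⟩
    rw [fderiv_comp_planeSwap]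
    exact hw

/-- Interchanging the coordinates changes the sign of a frame, and so does reversing the velocity of
the link. -/
theorem BoundaryOriented.reverse {L : OrientedLink} {c : ℝ} {ψ : ℝ × ℝ → R4 × ℝ}
    {V : Set (ℝ × ℝ)} (h : BoundaryOriented L c ψ V) :
    BoundaryOriented L.reverse c (ψ ∘ planeSwap) (planeSwap ⁻¹' V) := by
  intro u hu i s hus
  obtain ⟨w, w', h1, h2, h3⟩ := h _ hu i (-s) hus
  refine ⟨planeSwap w, planeSwap (-w'), ?_, ?_, ?_⟩
  · rw [fderiv_comp_planeSwap]
    exact h1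
  · have hdr : deriv (L.reverse.γ i) s = -deriv (L.γ i) (-s) := L.deriv_reverse i s
    rw [fderiv_comp_planeSwap, hdr]
    have : fderiv ℝ ψ (planeSwap u) (-w') = (-deriv (L.γ i) (-s), 0) := by
      rw [map_neg, h2]
      simp
    exact this
  · simp only [planeSwap_apply, Prod.fst_neg, Prod.snd_neg]
    linarith

theorem Compatible.comp_planeSwap {c d : ℝ × ℝ → R4 × ℝ} {u v : ℝ × ℝ}
    (h : Compatible c d (planeSwap u) (planeSwap v)) :
    Compatible (c ∘ planeSwap) (d ∘ planeSwap) u v := by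
  obtain ⟨M, hM, hdet⟩ := h
  refine ⟨(planeSwap : (ℝ × ℝ) →L[ℝ] (ℝ × ℝ)).comp
    (M.comp (planeSwap : (ℝ × ℝ) →L[ℝ] (ℝ × ℝ))), ?_, ?_⟩
  · rw [fderiv_comp_planeSwap, fderiv_comp_planeSwap, hM]
    rfl
  · rw [det_prod_real] at hdet ⊢
    simp only [ContinuousLinearMap.comp_apply, ContinuousLinearEquiv.coe_coe, planeSwap_apply]
    linarith

/-- The same surface serves with the opposite orientation, obtained by precomposing all charts with
the interchange of coordinates. -/
theorem IsCobordism.reverse {S : Set (R4 × ℝ)} {L L' : OrientedLink} (h : IsCobordism S L L') :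
    IsCobordism S L.reverse L'.reverse := by
  obtain ⟨𝒜, h1, h2, h3, h4⟩ := h.oriented
  refine ⟨h.isCompact, h.subset_slab,
    ⟨(fun c => (c.1 ∘ planeSwap, planeSwap ⁻¹' c.2)) '' 𝒜, ?_, ?_, ?_, ?_⟩, ?_, ?_, h.components⟩
  · rintro _ ⟨c, hc, rfl⟩
    exact (h1 c hc).comp_planeSwap
  · intro x hx
    obtain ⟨c, hc, hxc⟩ := h2 x hx
    refine ⟨_, ⟨c, hc, rfl⟩, ?_⟩
    simp only [image_planeSwap_preimage]
    exact hxc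
  · rintro _ ⟨c, hc, rfl⟩ _ ⟨d, hd, rfl⟩ u hu v hv huv hS
    exact Compatible.comp_planeSwap (h3 c hc d hd _ hu _ hv huv hS)
  · rintro _ ⟨c, hc, rfl⟩
    exact ⟨(h4 c hc).1.reverse, (h4 c hc).2.reverse⟩
  · rw [L.carrier_reverse, h.bottom]
  · rw [L'.carrier_reverse, h.top]

/-! ### Orienting a cobordism along a knot at the top -/

theorem IsLocalParam.contDiffAt {S : Set (R4 × ℝ)} {ψ : ℝ × ℝ → R4 × ℝ} {V : Set (ℝ × ℝ)}
    (h : IsLocalParam S ψ V) {u : ℝ × ℝ} (hu : u ∈ V) : ContDiffAt ℝ ∞ ψ u :=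
  h.smooth.contDiffAt (h.isOpen.mem_nhds hu)

theorem IsLocalParam.injOn {S : Set (R4 × ℝ)} {ψ : ℝ × ℝ → R4 × ℝ} {V : Set (ℝ × ℝ)}
    (h : IsLocalParam S ψ V) : InjOn ψ V :=
  injOn_iff_injective.2 h.embedding.injective

/-- By relative openness every point of S near the given one lies in the image of the chart, and the
chart is an embedding, so the chosen preimages vary continuously at `s₀`. Their values far from `s₀`
are irrelevant. -/
theorem IsLocalParam.exists_lift {S : Set (R4 × ℝ)} {ψ : ℝ × ℝ → R4 × ℝ} {V : Set (ℝ × ℝ)}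
    (h : IsLocalParam S ψ V) {κ : ℝ → R4 × ℝ} (hκ : Continuous κ) (hS : ∀ s, κ s ∈ S)
    {s₀ : ℝ} {u₀ : ℝ × ℝ} (hu₀ : u₀ ∈ V) (h₀ : ψ u₀ = κ s₀) (hslab : κ s₀ ∈ slab) :
    ∃ q : ℝ → ℝ × ℝ, q s₀ = u₀ ∧ ContinuousAt q s₀ ∧
      ∀ᶠ s in nhds s₀, q s ∈ V ∧ ψ (q s) = κ s := by
  obtain ⟨W, hW, hSW⟩ := h.relOpen
  have hκW : κ s₀ ∈ W := by
    have : κ s₀ ∈ ψ '' V ∩ slab := ⟨⟨u₀, hu₀, h₀⟩, hslab⟩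
    rw [← hSW] at this
    exact this.2
  have hev : ∀ᶠ s in nhds s₀, ∃ u : V, ψ u = κ s := by
    filter_upwards [hκ.continuousAt.eventually (hW.mem_nhds hκW)] with s hs
    have : κ s ∈ ψ '' V ∩ slab := by
      rw [← hSW]
      exact ⟨hS s, hs⟩
    obtain ⟨⟨u, hu, hus⟩, -⟩ := this
    exact ⟨⟨u, hu⟩, hus⟩
  classical
  let q : ℝ → V := fun s => if hs : ∃ u : V, ψ u = κ s then hs.choose else ⟨u₀, hu₀⟩
  have hq : ∀ s, (∃ u : V, ψ u = κ s) → ψ (q s) = κ s := by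
    intro s hs
    simp only [q, dif_pos hs]
    exact hs.choose_spec
  have hq₀ : q s₀ = ⟨u₀, hu₀⟩ := by
    refine Subtype.ext (h.injOn (q s₀).2 hu₀ ?_)
    rw [hq s₀ ⟨⟨u₀, hu₀⟩, h₀⟩, h₀]
  have hqev : ∀ᶠ s in nhds s₀, ψ (q s) = κ s := hev.mono hq
  have hqc : ContinuousAt q s₀ := by
    rw [h.embedding.continuousAt_iff]
    refine hκ.continuousAt.congr ?_
    filter_upwards [hqev] with s hs
    exact hs.symm
  refine ⟨fun s => q s, by simp [hq₀], continuous_subtype_val.continuousAt.comp hqc, ?_⟩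
  filter_upwards [hqev] with s hs
  exact ⟨(q s).2, hs⟩

/-- Were w parallel to w', its image would be a multiple of (v, 0) and could not point upwards. -/
theorem not_pos_of_det_eq_zero {A : (ℝ × ℝ) →L[ℝ] (R4 × ℝ)} {w w' : ℝ × ℝ} {v : R4} (hv : v ≠ 0)
    (hw : 0 < (A w).2) (hw' : A w' = (v, 0)) : w.1 * w'.2 - w.2 * w'.1 ≠ 0 := by
  intro h0
  have hw0 : w' ≠ 0 := by
    rintro rfl
    rw [map_zero] at hw'
    exact hv (congrArg Prod.fst hw').symm
  have hpos : 0 < w'.1 ^ 2 + w'.2 ^ 2 := by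
    by_contra hcon
    have h1 : w'.1 = 0 := by nlinarith [sq_nonneg w'.1, sq_nonneg w'.2]
    have h2 : w'.2 = 0 := by nlinarith [sq_nonneg w'.1, sq_nonneg w'.2]
    exact hw0 (Prod.ext h1 h2)
  -- For parallel vectors, |w'|² w = ⟨w, w'⟩ w'.
  have h1 : (w'.1 ^ 2 + w'.2 ^ 2) • w = (w.1 * w'.1 + w.2 * w'.2) • w' := by
    refine Prod.ext ?_ ?_
    · simp only [Prod.smul_fst, smul_eq_mul]
      linear_combination w'.2 * h0
    · simp only [Prod.smul_snd, smul_eq_mul]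
      linear_combination -w'.1 * h0
  have h2 := congrArg (fun x => (A x).2) h1
  simp only [map_smul, Prod.smul_snd, smul_eq_mul, hw', mul_zero] at h2
  exact (mul_pos hpos hw).ne' h2

/-- The frame (upward tangent vector, `v`) at the point `ψ u` has sign `σ`. -/
def FrameSign (σ : ℝ) (ψ : ℝ × ℝ → R4 × ℝ) (u : ℝ × ℝ) (v : R4) : Prop :=
  ∃ w w' : ℝ × ℝ, 0 < (fderiv ℝ ψ u w).2 ∧ fderiv ℝ ψ u w' = (v, 0) ∧
    0 < σ * (w.1 * w'.2 - w.2 * w'.1)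

theorem FrameSign.of_compatible {σ : ℝ} {c d : ℝ × ℝ → R4 × ℝ} {u u' : ℝ × ℝ} {v : R4}
    (h : FrameSign σ c u v) (hcd : Compatible c d u u') : FrameSign σ d u' v := by
  obtain ⟨M, hM, hdet⟩ := hcd
  obtain ⟨w, w', h1, h2, h3⟩ := h
  refine ⟨M w, M w', ?_, ?_, ?_⟩
  · rw [hM] at h1
    exact h1
  · rw [hM] at h2
    exact h2
  · rw [det_apply_apply]
    have := mul_pos hdet h3
    linarith

/-- The sign is independent of the upward vector: if two upward vectors lay on different sides of
w', a positive combination of them would be parallel to w' and still point upwards. -/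
theorem FrameSign.not_neg {σ : ℝ} {ψ : ℝ × ℝ → R4 × ℝ} {u : ℝ × ℝ} {v : R4} (hv : v ≠ 0)
    (hψ : Function.Injective (fderiv ℝ ψ u)) (h : FrameSign σ ψ u v) : ¬ FrameSign (-σ) ψ u v := by
  rintro ⟨z, z', h1, h2, h3⟩
  obtain ⟨w, w', h4, h5, h6⟩ := h
  obtain rfl : w' = z' := hψ (h5.trans h2.symm)
  have h7 : 0 < (fderiv ℝ ψ u ((σ * (w.1 * w'.2 - w.2 * w'.1)) • z +
      (-σ * (z.1 * w'.2 - z.2 * w'.1)) • w)).2 := by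
    rw [map_add, map_smul, map_smul]
    simp only [Prod.snd_add, Prod.smul_snd, smul_eq_mul]
    exact add_pos (mul_pos h6 h1) (mul_pos h3 h4)
  refine not_pos_of_det_eq_zero hv h7 h5 ?_
  simp only [Prod.fst_add, Prod.snd_add, Prod.smul_fst, Prod.smul_snd, smul_eq_mul]
  ring

/-- A curve in the top boundary lifts differentiably through the chart, so its velocity is in the
image of the derivative. -/
theorem IsLocalParam.exists_tangent {S : Set (R4 × ℝ)} {ψ : ℝ × ℝ → R4 × ℝ} {V : Set (ℝ × ℝ)}
    (h : IsLocalParam S ψ V) {γ : ℝ → R4} (hγ : Differentiable ℝ γ) (hS : ∀ s, (γ s, (1 : ℝ)) ∈ S)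
    {s : ℝ} {u : ℝ × ℝ} (hu : u ∈ V) (hus : ψ u = (γ s, 1)) :
    ∃ w', fderiv ℝ ψ u w' = (deriv γ s, 0) := by
  have hκ : Differentiable ℝ fun s => (γ s, (1 : ℝ)) := hγ.prodMk (differentiable_const _)
  obtain ⟨q, hq₀, hqc, hqev⟩ := h.exists_lift hκ.continuous hS hu hus
    ⟨zero_le_one, le_rfl⟩
  have hd : HasDerivAt (fun s => ψ (q s)) (deriv γ s, (0 : ℝ)) s := by
    refine (((hγ s).hasDerivAt).prodMk (hasDerivAt_const s (1 : ℝ))).congr_of_eventuallyEq ?_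
    filter_upwards [hqev] with r hr
    exact hr.2
  subst hq₀
  obtain ⟨w', -, hw'⟩ := exists_hasDerivAt_lift
    ((h.contDiffAt hu).hasStrictFDerivAt (by simp)) (h.immersion _ hu) hqc hd
  exact ⟨w', hw'⟩

theorem IsLocalParam.frameSign_or {S : Set (R4 × ℝ)} {ψ : ℝ × ℝ → R4 × ℝ} {V : Set (ℝ × ℝ)}
    (h : IsLocalParam S ψ V) {γ : ℝ → R4} (hγ : Differentiable ℝ γ) (hS : ∀ s, (γ s, (1 : ℝ)) ∈ S)
    {s : ℝ} (hγs : deriv γ s ≠ 0) {u : ℝ × ℝ} (hu : u ∈ V) (hus : ψ u = (γ s, 1)) :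
    FrameSign 1 ψ u (deriv γ s) ∨ FrameSign (-1) ψ u (deriv γ s) := by
  obtain ⟨w', hw'⟩ := h.exists_tangent hγ hS hu hus
  obtain ⟨w, hw⟩ : ∃ w, 0 < (fderiv ℝ ψ u w).2 := by
    obtain ⟨w, hw⟩ := h.transverse u hu (Or.inr (by rw [hus]))
    rcases lt_or_gt_of_ne hw with h1 | h1
    · exact ⟨-w, by rw [map_neg, Prod.snd_neg]; linarith⟩
    · exact ⟨w, h1⟩
  rcases lt_or_gt_of_ne (not_pos_of_det_eq_zero hγs hw hw') with h1 | h1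
  · exact Or.inr ⟨w, w', hw, hw', by linarith⟩
  · exact Or.inl ⟨w, w', hw, hw', by linarith⟩

/-- The sign is an open condition. The parameter vector z of the velocity at a nearby point is not
yet known to vary continuously, so frames are compared after applying a fixed left inverse ℓ of the
derivative at the base point: ℓ composed with the nearby derivatives has determinant near 1, and ℓ
of the velocity is continuous. -/
theorem IsLocalParam.eventually_frameSign {S : Set (R4 × ℝ)} {ψ : ℝ × ℝ → R4 × ℝ}
    {V : Set (ℝ × ℝ)} (h : IsLocalParam S ψ V) {γ : ℝ → R4} (hγ : ContDiff ℝ ∞ γ)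
    (hS : ∀ s, (γ s, (1 : ℝ)) ∈ S) {s : ℝ} {u : ℝ × ℝ} (hu : u ∈ V)
    (hus : ψ u = (γ s, 1)) {σ : ℝ} (hσ : FrameSign σ ψ u (deriv γ s)) :
    ∀ᶠ r in nhds s, ∃ u' ∈ V, ψ u' = (γ r, 1) ∧ FrameSign σ ψ u' (deriv γ r) := by
  have hγd : Differentiable ℝ γ := hγ.differentiable (by simp)
  have hγc : Continuous (deriv γ) := hγ.continuous_deriv (by simp)
  obtain ⟨q, hq₀, hqc, hqev⟩ := h.exists_lift
    (hγd.prodMk (differentiable_const (1 : ℝ))).continuous hS hu hus ⟨zero_le_one, le_rfl⟩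
  subst hq₀
  obtain ⟨w, w', h1, h2, h3⟩ := hσ
  obtain ⟨g, hg⟩ := LinearMap.exists_leftInverse_of_injective
    (fderiv ℝ ψ (q s) : (ℝ × ℝ) →ₗ[ℝ] R4 × ℝ) (LinearMap.ker_eq_bot.2 (h.immersion _ hu))
  let ℓ : (R4 × ℝ) →L[ℝ] (ℝ × ℝ) := LinearMap.toContinuousLinearMap g
  have hℓ : ∀ x, ℓ (fderiv ℝ ψ (q s) x) = x := fun x => LinearMap.congr_fun hg x
  have hD : ContinuousAt (fun r => fderiv ℝ ψ (q r)) s :=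
    ContinuousAt.comp (f := q) (g := fderiv ℝ ψ)
      ((h.contDiffAt hu).continuousAt_fderiv (by simp)) hqc
  have hDw : ∀ x, ContinuousAt (fun r => fderiv ℝ ψ (q r) x) s := fun x =>
    hD.clm_apply continuousAt_const
  have hℓD : ∀ x, ContinuousAt (fun r => ℓ (fderiv ℝ ψ (q r) x)) s := fun x =>
    ℓ.continuous.continuousAt.comp (hDw x)
  have hℓγ : ContinuousAt (fun r => ℓ (deriv γ r, 0)) s :=
    ℓ.continuous.continuousAt.comp (hγc.continuousAt.prodMk continuousAt_const)
  have e1 : ∀ᶠ r in nhds s, 0 < (fderiv ℝ ψ (q r) w).2 :=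
    (continuous_snd.continuousAt.comp (hDw w)).eventually (lt_mem_nhds h1)
  have e2 : ∀ᶠ r in nhds s, 0 < (ℓ.comp (fderiv ℝ ψ (q r))).det := by
    have hc : ContinuousAt (fun r => (ℓ.comp (fderiv ℝ ψ (q r))).det) s := by
      simp only [det_prod_real, ContinuousLinearMap.comp_apply]
      exact ((hℓD _).fst.mul (hℓD _).snd).sub ((hℓD _).fst.mul (hℓD _).snd)
    refine hc.eventually (lt_mem_nhds ?_)
    simp [det_prod_real, hℓ]
  have e3 : ∀ᶠ r in nhds s, 0 < σ * ((ℓ (fderiv ℝ ψ (q r) w)).1 * (ℓ (deriv γ r, 0)).2 -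
      (ℓ (fderiv ℝ ψ (q r) w)).2 * (ℓ (deriv γ r, 0)).1) := by
    have hc : ContinuousAt (fun r => σ * ((ℓ (fderiv ℝ ψ (q r) w)).1 * (ℓ (deriv γ r, 0)).2 -
      (ℓ (fderiv ℝ ψ (q r) w)).2 * (ℓ (deriv γ r, 0)).1)) s :=
      continuousAt_const.mul (((hℓD _).fst.mul hℓγ.snd).sub ((hℓD _).snd.mul hℓγ.fst))
    refine hc.eventually (lt_mem_nhds ?_)
    beta_reduce
    rw [← h2, hℓ, hℓ]
    exact h3
  filter_upwards [e1, e2, e3, hqev] with r hr1 hr2 hr3 hr4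
  obtain ⟨z, hz⟩ := h.exists_tangent hγd hS hr4.1 hr4.2
  refine ⟨q r, hr4.1, hr4.2, w, z, hr1, hz, ?_⟩
  rw [← hz] at hr3
  have h5 := det_apply_apply (ℓ.comp (fderiv ℝ ψ (q r))) w z
  simp only [ContinuousLinearMap.comp_apply] at h5
  rw [h5] at hr3
  have h6 : 0 < (ℓ.comp (fderiv ℝ ψ (q r))).det * (σ * (w.1 * z.2 - w.2 * z.1)) := by linarith
  exact pos_of_mul_pos_right h6 hr2.le

/-- A neat compact surface with an oriented atlas, whose top is a knot, is an oriented cobordism to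
that knot, if the orientation of the bottom is chosen suitably. -/
theorem isCobordism_or_reverse {S : Set (R4 × ℝ)} {L K : OrientedLink} (hK : K.IsKnot)
    (hcomp : IsCompact S) (hslab : S ⊆ slab) {𝒜 : Set ((ℝ × ℝ → R4 × ℝ) × Set (ℝ × ℝ))}
    (hparam : ∀ c ∈ 𝒜, IsLocalParam S c.1 c.2) (hcover : ∀ x ∈ S, ∃ c ∈ 𝒜, x ∈ c.1 '' c.2)
    (hcompat : ∀ c ∈ 𝒜, ∀ d ∈ 𝒜, ∀ u ∈ c.2, ∀ v ∈ d.2, c.1 u = d.1 v → Compatible c.1 d.1 u v)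
    (hL : ∀ c ∈ 𝒜, BoundaryOriented L 0 c.1 c.2)
    (hbot : {x | (x, (0 : ℝ)) ∈ S} = L.carrier) (htop : {x | (x, (1 : ℝ)) ∈ S} = K.carrier)
    (hcc : ∀ x ∈ S, (∃ y ∈ connectedComponentIn S x, y.2 = 0) ∧
      ∃ y ∈ connectedComponentIn S x, y.2 = 1) :
    IsCobordism S L K ∨ IsCobordism S L.reverse K := by
  let i₀ : Fin K.n := ⟨0, K.n_pos⟩
  have hi : ∀ i : Fin K.n, i = i₀ := by
    intro i
    have : K.n = 1 := hK
    exact Fin.ext (by have := i.2; simp only [i₀]; omega)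
  have hγ := K.isLink.smooth i₀
  have hγd : Differentiable ℝ (K.γ i₀) := hγ.differentiable (by simp)
  have hγ0 := K.isLink.deriv_ne_zero i₀
  have hS : ∀ s, (K.γ i₀ s, (1 : ℝ)) ∈ S := by
    intro s
    have : K.γ i₀ s ∈ {x | (x, (1 : ℝ)) ∈ S} := by
      rw [htop]
      exact mem_iUnion.2 ⟨i₀, s, rfl⟩
    exact this
  let P : ℝ → ℝ → Prop := fun σ s => ∃ c ∈ 𝒜, ∃ u ∈ c.2, c.1 u = (K.γ i₀ s, 1) ∧
    FrameSign σ c.1 u (deriv (K.γ i₀) s)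
  have hopen : ∀ σ, IsOpen {s | P σ s} := by
    intro σ
    rw [isOpen_iff_mem_nhds]
    rintro s ⟨c, hc, u, hu, hus, hσ⟩
    filter_upwards [(hparam c hc).eventually_frameSign hγ hS hu hus hσ] with r hr
    obtain ⟨u', hu', h1, h2⟩ := hr
    exact ⟨c, hc, u', hu', h1, h2⟩
  have hor : ∀ s, P 1 s ∨ P (-1) s := by
    intro s
    obtain ⟨c, hc, u, hu, hus⟩ := hcover _ (hS s)
    rcases (hparam c hc).frameSign_or hγd hS (hγ0 s) hu hus with h | h
    · exact Or.inl ⟨c, hc, u, hu, hus, h⟩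
    · exact Or.inr ⟨c, hc, u, hu, hus, h⟩
  have hall : ∀ σ s, P σ s → ∀ c ∈ 𝒜, ∀ u ∈ c.2, c.1 u = (K.γ i₀ s, 1) →
      FrameSign σ c.1 u (deriv (K.γ i₀) s) := by
    rintro σ s ⟨c, hc, u, hu, hus, hσ⟩ d hd v hv hvs
    exact hσ.of_compatible (hcompat c hc d hd u hu v hv (hus.trans hvs.symm))
  have hdisj : ∀ s, P 1 s → ¬ P (-1) s := by
    rintro s h1 ⟨c, hc, u, hu, hus, hσ⟩
    exact (hall 1 s h1 c hc u hu hus).not_neg (hγ0 s) ((hparam c hc).immersion u hu) hσ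
  -- The sets of parameters with sign 1 and with sign -1 are open, disjoint and cover the line, so
  -- one of them is everything. Here it matters that the top has a single component.
  have hconst : (∀ s, P 1 s) ∨ ∀ s, P (-1) s := by
    by_contra! hcon
    obtain ⟨⟨s, hs⟩, ⟨s', hs'⟩⟩ := hcon
    obtain ⟨r, -, hr1, hr2⟩ := isPreconnected_univ (α := ℝ) {s | P 1 s} {s | P (-1) s}
      (hopen _) (hopen _) (fun r _ => hor r)
      ⟨s', mem_univ _, (hor s').resolve_right hs'⟩ ⟨s, mem_univ _, (hor s).resolve_left hs⟩
    exact hdisj r hr1 hr2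
  rcases hconst with h | h
  · left
    refine ⟨hcomp, hslab, ⟨𝒜, hparam, hcover, fun c hc d hd u hu v hv huv _ =>
      hcompat c hc d hd u hu v hv huv, fun c hc => ⟨hL c hc, ?_⟩⟩, hbot, htop, hcc⟩
    intro u hu i s hus
    obtain rfl := hi i
    obtain ⟨w, w', h1, h2, h3⟩ := hall 1 s (h s) c hc u hu hus
    exact ⟨w, w', h1, h2, by linarith⟩
  · right
    -- With sign -1 throughout, the orientation of S fits the reversed knot; reversing the cobordism
    -- then restores K and reverses L.
    have key : IsCobordism S L K.reverse := by
      refine ⟨hcomp, hslab, ⟨𝒜, hparam, hcover, fun c hc d hd u hu v hv huv _ =>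
        hcompat c hc d hd u hu v hv huv, fun c hc => ⟨hL c hc, ?_⟩⟩, hbot,
        htop.trans K.carrier_reverse.symm, hcc⟩
      intro u hu i s hus
      obtain ⟨w, w', h1, h2, h3⟩ := hall (-1) (-s) (h (-s)) c hc u hu
        (by rw [← hi i]; exact hus)
      refine ⟨w, -w', h1, ?_, ?_⟩
      · have hdr : deriv (K.reverse.γ i) s = -deriv (K.γ i₀) (-s) := by
          rw [← hi i]
          exact K.deriv_reverse i s
        rw [map_neg, h2, hdr]
        simp
      · simp only [Prod.fst_neg, Prod.snd_neg]
        linarith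
    have := key.reverse
    rwa [K.reverse_reverse] at this

/-! ### A smooth fold of the line -/

theorem smoothTransition_one_sub (z : ℝ) :
    Real.smoothTransition (1 - z) = 1 - Real.smoothTransition z := by
  have h := Real.smoothTransition.pos_denom z
  unfold Real.smoothTransition
  rw [sub_sub_cancel, eq_sub_iff_add_eq, add_comm (expNegInvGlue (1 - z)) (expNegInvGlue z),
    ← add_div, add_comm (expNegInvGlue (1 - z)) (expNegInvGlue z), div_self h.ne']

theorem expNegInvGlue_lt {x y : ℝ} (hy : 0 < y) (hxy : x < y) :
    expNegInvGlue x < expNegInvGlue y := by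
  rcases le_or_gt x 0 with hx | hx
  · rw [expNegInvGlue.zero_of_nonpos hx]
    exact expNegInvGlue.pos_of_pos hy
  · unfold expNegInvGlue
    rw [if_neg (not_le.2 hx), if_neg (not_le.2 hy), Real.exp_lt_exp, neg_lt_neg_iff]
    exact inv_strictAnti₀ hx hxy

theorem smoothTransition_lt_half {z : ℝ} (hz : z < 1 / 2) : Real.smoothTransition z < 1 / 2 := by
  unfold Real.smoothTransition
  rw [div_lt_div_iff₀ (Real.smoothTransition.pos_denom z) two_pos]
  have := expNegInvGlue_lt (x := z) (y := 1 - z) (by linarith) (by linarith)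
  linarith

/-- A smooth version of the fold of the line at `1/2`, equal to `x` for `x ≤ c`. -/
def smoothFold (c x : ℝ) : ℝ := x + (1 - 2 * x) * Real.smoothTransition ((x - c) / (1 - 2 * c))

theorem contDiff_smoothFold (c : ℝ) : ContDiff ℝ ∞ (smoothFold c) := by
  have h : ContDiff ℝ ∞ fun x : ℝ => Real.smoothTransition ((x - c) / (1 - 2 * c)) :=
    Real.smoothTransition.contDiff.comp ((contDiff_id.sub contDiff_const).div_const _)
  exact contDiff_id.add ((contDiff_const.sub (contDiff_const.mul contDiff_id)).mul h)

theorem smoothFold_of_le {c x : ℝ} (hc : c < 1 / 2) (hx : x ≤ c) : smoothFold c x = x := by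
  unfold smoothFold
  rw [Real.smoothTransition.zero_of_nonpos, mul_zero, add_zero]
  exact div_nonpos_of_nonpos_of_nonneg (by linarith) (by linarith)

theorem smoothFold_one_sub {c : ℝ} (hc : c < 1 / 2) (x : ℝ) :
    smoothFold c (1 - x) = smoothFold c x := by
  unfold smoothFold
  have h : (1 - x - c) / (1 - 2 * c) = 1 - (x - c) / (1 - 2 * c) := by
    have : 1 - 2 * c ≠ 0 := by linarith
    rw [eq_sub_iff_add_eq, ← add_div, div_eq_one_iff_eq this]
    ring
  rw [h, smoothTransition_one_sub]
  ring

theorem smoothFold_half (c : ℝ) : smoothFold c (1 / 2) = 1 / 2 := by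
  unfold smoothFold
  norm_num

theorem strictMonoOn_smoothFold {c : ℝ} (hc : c < 1 / 2) :
    StrictMonoOn (smoothFold c) (Iic (1 / 2)) := by
  intro x hx y hy hxy
  simp only [mem_Iic] at hx hy
  have h0 : 0 < 1 - 2 * c := by linarith
  have h1 : Real.smoothTransition ((x - c) / (1 - 2 * c)) < 1 / 2 := by
    apply smoothTransition_lt_half
    rw [div_lt_iff₀ h0]
    linarith
  have h2 : Real.smoothTransition ((x - c) / (1 - 2 * c)) ≤
      Real.smoothTransition ((y - c) / (1 - 2 * c)) :=
    Real.smoothTransition.monotone (by gcongr)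
  unfold smoothFold
  set s := Real.smoothTransition ((x - c) / (1 - 2 * c))
  set r := Real.smoothTransition ((y - c) / (1 - 2 * c))
  -- The increment from x to y is twice the sum of the two listed products, (1/2 - y)(r - s) and (y
  -- - x)(1/2 - s).
  nlinarith [mul_nonneg (by linarith : (0 : ℝ) ≤ 1 / 2 - y) (by linarith : 0 ≤ r - s),
    mul_pos (by linarith : (0 : ℝ) < y - x) (by linarith : 0 < 1 / 2 - s)]

theorem smoothFold_le_half {c : ℝ} (hc : c < 1 / 2) (x : ℝ) : smoothFold c x ≤ 1 / 2 := by
  have h : ∀ x ≤ (1 / 2 : ℝ), smoothFold c x ≤ 1 / 2 := by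
    intro x hx
    have := (strictMonoOn_smoothFold hc).monotoneOn (mem_Iic.2 hx) (mem_Iic.2 le_rfl) hx
    rwa [smoothFold_half] at this
  rcases le_total x (1 / 2) with hx | hx
  · exact h x hx
  · rw [← smoothFold_one_sub hc]
    exact h _ (by linarith)

theorem exists_smoothFold_inverse {c : ℝ} (hc : c < 1 / 2) :
    ∃ ζ : ℝ → ℝ, Continuous ζ ∧ (∀ x ≤ 1 / 2, ζ (smoothFold c x) = x) ∧
      ∀ v ≤ 1 / 2, smoothFold c (ζ v) = v ∧ ζ v ≤ 1 / 2 := by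
  -- Continuing the fold by the identity beyond its maximum 1/2 gives an increasing bijection of the
  -- line, whose inverse is automatically continuous.
  let h : ℝ → ℝ := fun x => if x ≤ 1 / 2 then smoothFold c x else x
  have hle : ∀ x ≤ (1 / 2 : ℝ), h x = smoothFold c x := fun x hx => if_pos hx
  have hgt : ∀ x, (1 / 2 : ℝ) < x → h x = x := fun x hx => if_neg (not_le.2 hx)
  have hmono : StrictMono h := by
    intro x y hxy
    rcases le_or_gt y (1 / 2) with hy | hy
    · rw [hle x (hxy.le.trans hy), hle y hy]
      exact strictMonoOn_smoothFold hc (mem_Iic.2 (hxy.le.trans hy)) (mem_Iic.2 hy) hxy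
    · rw [hgt y hy]
      rcases le_or_gt x (1 / 2) with hx | hx
      · rw [hle x hx]
        exact (smoothFold_le_half hc x).trans_lt hy
      · rwa [hgt x hx]
  have hcont : Continuous h := by
    refine Continuous.if_le (contDiff_smoothFold c).continuous continuous_id continuous_id
      continuous_const ?_
    rintro x rfl
    exact smoothFold_half c
  have hsurj : Function.Surjective h := by
    intro v
    rcases le_or_gt v (1 / 2) with hv | hv
    · have hmin : h (min v c) ≤ v := by
        rw [hle _ ((min_le_right _ _).trans hc.le), smoothFold_of_le hc (min_le_right _ _)]
        exact min_le_left _ _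
      have hhalf : h (1 / 2) = 1 / 2 := by rw [hle _ le_rfl, smoothFold_half]
      obtain ⟨x, -, hx⟩ := intermediate_value_Icc ((min_le_left v c).trans hv) hcont.continuousOn
        ⟨hmin, by rw [hhalf]; exact hv⟩
      exact ⟨x, hx⟩
    · exact ⟨v, hgt v hv⟩
  let e := hmono.orderIsoOfSurjective h hsurj
  refine ⟨e.symm, e.symm.continuous, fun x hx => ?_, fun v hv => ?_⟩
  · rw [← hle x hx]
    exact e.symm_apply_apply x
  · have h1 : h (e.symm v) = v := e.apply_symm_apply v
    have h2 : e.symm v ≤ 1 / 2 := by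
      by_contra hcon
      rw [hgt _ (not_le.1 hcon)] at h1
      exact hcon (h1.trans_le hv)
    rw [hle _ h2] at h1
    exact ⟨h1, h2⟩

/-! ### Corner profiles -/

/-- The profile of a rounded corner: `k u` is a smooth version of `max u 0`, equal to it for
`η ≤ |u|`. -/
structure IsProfile (η : ℝ) (k : ℝ → ℝ) : Prop where
  pos : 0 < η
  smooth : ContDiff ℝ ∞ k
  mono : Monotone k
  mono_sub : Monotone fun u => u - k u
  eq_zero : ∀ u ≤ -η, k u = 0
  eq_self : ∀ u, η ≤ u → k u = u

theorem IsProfile.nonneg {η : ℝ} {k : ℝ → ℝ} (h : IsProfile η k) (u : ℝ) : 0 ≤ k u := by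
  have := h.mono (min_le_left u (-η))
  rwa [h.eq_zero _ (min_le_right u (-η))] at this

theorem IsProfile.sub_nonpos {η : ℝ} {k : ℝ → ℝ} (h : IsProfile η k) (u : ℝ) : u - k u ≤ 0 := by
  have h1 := h.mono_sub (le_max_left u η)
  simp only [h.eq_self _ (le_max_right u η), sub_self] at h1
  exact h1

theorem IsProfile.le_of_le {η : ℝ} {k : ℝ → ℝ} (h : IsProfile η k) {u : ℝ} (hu : u ≤ η) :
    k u ≤ η := by
  have := h.mono hu
  rwa [h.eq_self η le_rfl] at this

/-- A convex function whose slopes are eventually -1 on the left and 1 on the right has all slopes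
in between. -/
theorem IsRounding.slope_le {ε : ℝ} {g : ℝ → ℝ} (h : IsRounding ε g) {u v : ℝ} (huv : u ≤ v) :
    g v - g u ≤ v - u ∧ g u - g v ≤ v - u := by
  obtain ⟨-, hconv, η, -, -, habs⟩ := h
  rcases huv.eq_or_lt with rfl | huv
  · simp
  have huv' : 0 < v - u := sub_pos.2 huv
  constructor
  · let z := |v| + |η| + 1
    have hvz : v < z := by
      have := le_abs_self v
      have := abs_nonneg η
      simp only [z]
      linarith
    have hz : ∀ w, z ≤ w → g w = w := by
      intro w hw
      have h1 := abs_nonneg v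
      have h2 := abs_nonneg η
      have h3 := le_abs_self η
      have h4 : 0 ≤ w := by simp only [z] at hw; linarith
      rw [habs w, abs_of_nonneg h4]
      rw [abs_of_nonneg h4]
      simp only [z] at hw
      linarith
    have h1 := hconv.slope_mono_adjacent (mem_univ u) (mem_univ z) huv hvz
    have h2 := hconv.slope_mono_adjacent (mem_univ v) (mem_univ (z + 1)) hvz (lt_add_one z)
    rw [hz z le_rfl, hz (z + 1) (by linarith)] at h2
    rw [hz z le_rfl] at h1
    have h3 := h1.trans h2
    rw [div_le_iff₀ huv'] at h3
    have : z + 1 - z = 1 := by ring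
    rw [this] at h3
    linarith
  · let z := -(|u| + |η| + 1)
    have hzu : z < u := by
      have := neg_abs_le u
      have := abs_nonneg η
      simp only [z]
      linarith
    have hz : ∀ w, w ≤ z → g w = -w := by
      intro w hw
      have h1 := abs_nonneg u
      have h2 := abs_nonneg η
      have h3 := le_abs_self η
      have h4 : w ≤ 0 := by simp only [z] at hw; linarith
      rw [habs w, abs_of_nonpos h4]
      rw [abs_of_nonpos h4]
      simp only [z] at hw
      linarith
    have h1 := hconv.slope_mono_adjacent (mem_univ z) (mem_univ v) hzu huv
    have h2 := hconv.slope_mono_adjacent (mem_univ (z - 1)) (mem_univ u) (sub_one_lt z) hzu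
    rw [hz z le_rfl, hz (z - 1) (by linarith)] at h2
    rw [hz z le_rfl] at h1
    have h3 := h2.trans h1
    rw [le_div_iff₀ huv'] at h3
    have : z - (z - 1) = 1 := by ring
    rw [this] at h3
    linarith

/-- The profile is (u + g u) / 2, the rounding of (u + |u|) / 2. Both monotonicity conditions say
that g has slopes between -1 and 1. -/
theorem IsRounding.exists_profile {ε : ℝ} {g : ℝ → ℝ} (h : IsRounding ε g) :
    ∃ η k, η < ε ∧ η < 1 / 2 ∧ IsProfile η k ∧ ∀ u, g u = 2 * k u - u := by
  have hslope := fun u v (huv : u ≤ v) => h.slope_le huv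
  obtain ⟨hg, hconv, η, hη, hη', habs⟩ := h
  refine ⟨η, fun u => (u + g u) / 2, hη, hη', ⟨?_, ?_, ?_, ?_, ?_, ?_⟩, fun u => by ring⟩
  -- For η ≤ 0 the rounding would be |u| itself, which is not differentiable at 0.
  · by_contra hcon
    have h1 : g = fun u => |u| := funext fun u => habs u ((not_lt.1 hcon).trans (abs_nonneg u))
    have h2 : DifferentiableAt ℝ g 0 := hg.differentiable (by simp) 0
    rw [h1] at h2
    exact not_differentiableAt_abs_zero h2
  · exact (contDiff_id.add hg).div_const _
  · intro u v huv
    have := hslope u v huv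
    simp only
    linarith
  · intro u v huv
    have := hslope u v huv
    simp only
    linarith
  · intro u hu
    rcases le_or_gt 0 u with h0 | h0
    · rw [habs u (by rw [abs_of_nonneg h0]; linarith), abs_of_nonneg h0]
      by_contra hne
      have h1 : g = fun u => |u| := funext fun w => habs w (by linarith [abs_nonneg w])
      have h2 : DifferentiableAt ℝ g 0 := hg.differentiable (by simp) 0
      rw [h1] at h2
      exact not_differentiableAt_abs_zero h2
    · rw [habs u (by rw [abs_of_neg h0]; linarith), abs_of_neg h0]
      ring
  · intro u hu
    rcases le_or_gt 0 u with h0 | h0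
    · rw [habs u (by rw [abs_of_nonneg h0]; linarith), abs_of_nonneg h0]
      ring
    · exfalso
      have h1 : g = fun u => |u| := funext fun w => habs w (by linarith [abs_nonneg w])
      have h2 : DifferentiableAt ℝ g 0 := hg.differentiable (by simp) 0
      rw [h1] at h2
      exact not_differentiableAt_abs_zero h2

/-! ### The rounded curve in terms of the smooth fold -/

theorem smoothFold_fold {c : ℝ} (hc : c < 1 / 2) (x : ℝ) :
    smoothFold c (fold x) = smoothFold c x := by
  rcases le_total x (1 - x) with h | h
  · rw [fold, min_eq_left h]
  · rw [fold, min_eq_right h, smoothFold_one_sub hc]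

theorem fold_le_half (x : ℝ) : fold x ≤ 1 / 2 := by
  rcases le_total x (1 / 2) with h | h
  · exact (min_le_left _ _).trans h
  · exact (min_le_right _ _).trans (by linarith)

theorem fold_le_iff {c : ℝ} (hc : c < 1 / 2) {b : ℝ} (hb : b ≤ c) (x : ℝ) :
    smoothFold c x ≤ b ↔ fold x ≤ b := by
  have h := (strictMonoOn_smoothFold hc).le_iff_le (mem_Iic.2 (fold_le_half x))
    (mem_Iic.2 (hb.trans hc.le))
  rw [smoothFold_fold hc, smoothFold_of_le hc hb] at h
  exact h

theorem smoothFold_eq_fold {c : ℝ} (hc : c < 1 / 2) {x : ℝ} (hx : smoothFold c x ≤ c) :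
    smoothFold c x = fold x := by
  rw [← smoothFold_fold hc, smoothFold_of_le hc ((fold_le_iff hc le_rfl x).1 hx)]

theorem fold_eq_iff {c : ℝ} (hc : c < 1 / 2) {b : ℝ} (hb : b ≤ c) (x : ℝ) :
    smoothFold c x = b ↔ fold x = b := by
  constructor
  · rintro rfl
    exact (smoothFold_eq_fold hc hb).symm
  · rintro rfl
    exact smoothFold_eq_fold hc ((fold_le_iff hc le_rfl x).2 hb)

/-- The two folds coincide wherever either is at most c. On a solution of X = k(X + Y) there are two
cases: if X + Y ≥ η, then Y = 0 and the equation says only X ≥ η, the same condition for both folds;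
if X + Y < η, then X ≤ η and Y ≤ 0, so both coordinates lie where the folds agree. Hence the
nonsmooth fold in the definition of the rounded curve can be replaced by a smooth one. -/
theorem profile_fold_iff {η c : ℝ} {k : ℝ → ℝ} (hk : IsProfile η k) (hηc : η ≤ c) (hc : c < 1 / 2)
    (x y : ℝ) : fold x = k (fold x + fold y) ↔
      smoothFold c x = k (smoothFold c x + smoothFold c y) := by
  constructor
  · intro h
    rcases le_or_gt η (fold x + fold y) with h1 | h1
    · rw [hk.eq_self _ h1] at h
      have hy : fold y = 0 := by linarith
      rw [(fold_eq_iff hc (hk.pos.le.trans hηc) y).2 hy, add_zero]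
      rw [hy, add_zero] at h1
      rw [hk.eq_self]
      by_contra hcon
      have := (fold_le_iff hc le_rfl x).1 ((not_le.1 hcon).le.trans hηc)
      rw [(fold_eq_iff hc this x).2 rfl] at hcon
      exact hcon h1
    · have hx : fold x ≤ η := by
        rw [h]
        exact hk.le_of_le h1.le
      have hy : fold y ≤ 0 := by
        have h2 := hk.sub_nonpos (fold x + fold y)
        rw [← h] at h2
        linarith
      rw [(fold_eq_iff hc (hx.trans hηc) x).2 rfl,
        (fold_eq_iff hc (hy.trans (hk.pos.le.trans hηc)) y).2 rfl]
      exact h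
  · intro h
    rcases le_or_gt η (smoothFold c x + smoothFold c y) with h1 | h1
    · rw [hk.eq_self _ h1] at h
      have hy : smoothFold c y = 0 := by linarith
      rw [(fold_eq_iff hc (hk.pos.le.trans hηc) y).1 hy, add_zero]
      rw [hy, add_zero] at h1
      rw [hk.eq_self]
      by_contra hcon
      have := (fold_le_iff hc le_rfl x).2 ((not_le.1 hcon).le.trans hηc)
      rw [smoothFold_eq_fold hc this] at h1
      exact hcon h1
    · have hx : smoothFold c x ≤ η := by
        rw [h]
        exact hk.le_of_le h1.le
      have hy : smoothFold c y ≤ 0 := by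
        have h2 := hk.sub_nonpos (smoothFold c x + smoothFold c y)
        rw [← h] at h2
        linarith
      rw [smoothFold_eq_fold hc (hx.trans hηc),
        smoothFold_eq_fold hc (hy.trans (hk.pos.le.trans hηc))] at h
      exact h

/-! ### Band surgery data -/

/-- The signs `1` and `-1` of the two edges of a band. -/
def edgeSign : Fin 2 → ℝ := ![1, -1]

theorem edgeSign_mul_self (i : Fin 2) : edgeSign i * edgeSign i = 1 := by
  fin_cases i <;> simp [edgeSign]

theorem edgeSign_ne_zero (i : Fin 2) : edgeSign i ≠ 0 := fun h => by
  have := edgeSign_mul_self i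
  rw [h] at this
  norm_num at this

/-- The identity for `a = 1`, the reflection of the line at `1/2` for `a = -1`. -/
def reflect (a x : ℝ) : ℝ := 1 / 2 + a * (x - 1 / 2)

theorem edgeSign_eq (i : Fin 2) : edgeSign i = 1 ∨ edgeSign i = -1 := by
  fin_cases i <;> simp [edgeSign]

theorem reflect_eq (i : Fin 2) (x : ℝ) :
    reflect (edgeSign i) x = x ∨ reflect (edgeSign i) x = 1 - x := by
  rcases edgeSign_eq i with h | h <;> rw [h, reflect]
  · left; ring
  · right; ring

theorem reflect_reflect (i : Fin 2) (x : ℝ) :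
    reflect (edgeSign i) (reflect (edgeSign i) x) = x := by
  have := edgeSign_mul_self i
  unfold reflect
  linear_combination (x - 1 / 2) * this

theorem smoothFold_reflect {c : ℝ} (hc : c < 1 / 2) (i : Fin 2) (x : ℝ) :
    smoothFold c (reflect (edgeSign i) x) = smoothFold c x := by
  rcases reflect_eq i x with h | h <;> rw [h]
  exact smoothFold_one_sub hc x

theorem exists_reflect (x : ℝ) : ∃ i : Fin 2, ∃ x' ≤ 1 / 2, x = reflect (edgeSign i) x' := by
  rcases le_total x (1 / 2) with h | h
  · exact ⟨0, x, h, by simp [edgeSign, reflect]⟩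
  · exact ⟨1, 1 - x, by linarith, by simp [edgeSign, reflect]; ring⟩

theorem reflect_mem_Icc {ε : ℝ} (i : Fin 2) {x : ℝ} (hx : x ∈ Icc (-ε) (1 + ε)) :
    reflect (edgeSign i) x ∈ Icc (-ε) (1 + ε) := by
  rcases reflect_eq i x with h | h <;> rw [h]
  · exact hx
  · exact ⟨by linarith [hx.2], by linarith [hx.1]⟩

theorem reflect_mem_Ioo {ε : ℝ} (i : Fin 2) {x : ℝ} (hx : x ∈ Ioo (-ε) (1 + ε)) :
    reflect (edgeSign i) x ∈ Ioo (-ε) (1 + ε) := by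
  rcases reflect_eq i x with h | h <;> rw [h]
  · exact hx
  · exact ⟨by linarith [hx.2], by linarith [hx.1]⟩

/-- The attaching edges of the band are `{edge i} × [0, 1]`. -/
def edge (i : Fin 2) : ℝ := reflect (edgeSign i) 0

theorem edge_eq (i : Fin 2) : edge i = 0 ∨ edge i = 1 := by
  rcases reflect_eq i 0 with h | h
  · exact Or.inl h
  · exact Or.inr (by rw [edge, h]; norm_num)

theorem edge_zero : edge 0 = 0 := by simp [edge, reflect, edgeSign]

theorem edge_one : edge 1 = 1 := by norm_num [edge, reflect, edgeSign]

theorem exists_edge {x : ℝ} (hx : x = 0 ∨ x = 1) : ∃ i, x = edge i := by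
  rcases hx with rfl | rfl
  · exact ⟨0, edge_zero.symm⟩
  · exact ⟨1, edge_one.symm⟩

theorem smoothFold_edge {c : ℝ} (hc0 : 0 ≤ c) (hc : c < 1 / 2) (i : Fin 2) :
    smoothFold c (edge i) = 0 := by
  rw [edge, smoothFold_reflect hc, smoothFold_of_le hc hc0]

theorem smoothFold_eq_zero {c : ℝ} (hc0 : 0 ≤ c) (hc : c < 1 / 2) {x : ℝ}
    (hx : smoothFold c x = 0) : ∃ i, x = edge i := by
  rw [fold_eq_iff hc hc0] at hx
  apply exists_edge
  rcases min_choice x (1 - x) with h | h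
  · left
    rwa [fold, h] at hx
  · right
    rw [fold, h] at hx
    linarith

/-- A band `b` joining the two components of a link `γ`, together with the data of a rounding of its
corners. Along the edge `edge i` of the band the component `γ i` is parametrized by `e i`, upwards
for `i = 0` and downwards for `i = 1`. -/
structure BandSurgery where
  /-- the link -/
  γ : Fin 2 → ℝ → R4
  /-- the band -/
  b : ℝ × ℝ → R4
  /-- the margin of the band -/
  ε : ℝ
  /-- the size of the rounding -/
  η : ℝ
  /-- the profile of the rounding -/
  k : ℝ → ℝ
  /-- the parameters of the link along the edges of the band -/
  e : Fin 2 → ℝ → ℝ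
  isLink : IsLink γ
  smooth : ContDiff ℝ ∞ b
  norm_eq_one : ∀ p ∈ square ε, ‖b p‖ = 1
  injOn : InjOn b (square ε)
  immersion : ∀ p ∈ square ε, Function.Injective (fderiv ℝ b p)
  profile : IsProfile η k
  lt_margin : η < ε
  lt_half : η < 1 / 2
  edge_apply : ∀ i, ∀ y ∈ Icc (-ε) (1 + ε), b (edge i, y) = γ i (e i y)
  continuousOn_e : ∀ i, ContinuousOn (e i) (Icc (-ε) (1 + ε))
  deriv_e : ∀ i, ∀ y ∈ Ioo (-ε) (1 + ε), ∃ d, HasDerivAt (e i) d y ∧ 0 < edgeSign i * d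
  bdry : ∀ p ∈ square ε, ∀ i s, b p = γ i s → p.1 = 0 ∨ p.1 = 1

namespace BandSurgery

variable (D : BandSurgery)

/-- The interval `(-∞, c]` on which the smooth fold is the identity. -/
def c : ℝ := (D.η + 1 / 2) / 2

theorem η_pos : 0 < D.η := D.profile.pos

/-- As η < c < 1/2, the corners are rounded in the range in which the fold is the identity. -/
theorem η_lt_c : D.η < D.c := by
  have := D.lt_half
  unfold c
  linarith

theorem c_lt : D.c < 1 / 2 := by
  have := D.lt_half
  unfold c
  linarith

theorem c_pos : 0 < D.c := D.η_pos.trans D.η_lt_c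

theorem ε_pos : 0 < D.ε := D.η_pos.trans D.lt_margin

/-- The smooth fold. -/
def X (x : ℝ) : ℝ := smoothFold D.c x

theorem X_of_le {x : ℝ} (hx : x ≤ D.c) : D.X x = x := smoothFold_of_le D.c_lt hx

theorem X_reflect (i : Fin 2) (x : ℝ) : D.X (reflect (edgeSign i) x) = D.X x :=
  smoothFold_reflect D.c_lt i x

theorem X_edge (i : Fin 2) : D.X (edge i) = 0 := smoothFold_edge D.c_pos.le D.c_lt i

theorem contDiff_X : ContDiff ℝ ∞ D.X := contDiff_smoothFold D.c

theorem X_le_half (x : ℝ) : D.X x ≤ 1 / 2 := smoothFold_le_half D.c_lt x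

theorem X_half : D.X (1 / 2) = 1 / 2 := smoothFold_half D.c

theorem X_lt_iff {x b : ℝ} (hx : x ≤ 1 / 2) (hb : b ≤ D.c) : D.X x < b ↔ x < b := by
  have h := (strictMonoOn_smoothFold D.c_lt).lt_iff_lt (mem_Iic.2 hx)
    (mem_Iic.2 (hb.trans D.c_lt.le))
  rwa [smoothFold_of_le D.c_lt hb] at h

theorem X_le_iff {x b : ℝ} (hx : x ≤ 1 / 2) (hb : b ≤ D.c) : D.X x ≤ b ↔ x ≤ b := by
  have h := (strictMonoOn_smoothFold D.c_lt).le_iff_le (mem_Iic.2 hx)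
    (mem_Iic.2 (hb.trans D.c_lt.le))
  rwa [smoothFold_of_le D.c_lt hb] at h

theorem neg_le_X {x : ℝ} (hx : x ∈ Icc (-D.ε) (1 + D.ε)) : -D.ε ≤ D.X x := by
  by_contra hcon
  have h0 : -D.ε ≤ D.c := by linarith [D.ε_pos, D.c_pos]
  have h1 : fold x ≤ D.X x := by
    rw [X, smoothFold_eq_fold D.c_lt ((not_le.1 hcon).le.trans h0)]
  rcases min_choice x (1 - x) with h | h <;> rw [fold, h] at h1 <;> linarith [hx.1, hx.2]

/-- The coordinate of the edge `i`, increasing in `y`. -/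
def f (i : Fin 2) (y : ℝ) : ℝ := edgeSign i * D.e i y

theorem e_eq (i : Fin 2) (y : ℝ) : D.e i y = edgeSign i * D.f i y := by
  rw [f, ← mul_assoc, edgeSign_mul_self, one_mul]

theorem continuousOn_f (i : Fin 2) : ContinuousOn (D.f i) (Icc (-D.ε) (1 + D.ε)) :=
  continuousOn_const.mul (D.continuousOn_e i)

theorem strictMonoOn_f (i : Fin 2) : StrictMonoOn (D.f i) (Icc (-D.ε) (1 + D.ε)) := by
  refine strictMonoOn_of_deriv_pos (convex_Icc _ _) (D.continuousOn_f i) ?_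
  intro y hy
  rw [interior_Icc] at hy
  obtain ⟨d, hd, hpos⟩ := D.deriv_e i y hy
  have : HasDerivAt (D.f i) (edgeSign i * d) y := hd.const_mul _
  rwa [this.deriv]

theorem left_mem : -D.ε ∈ Icc (-D.ε) (1 + D.ε) := ⟨le_rfl, by linarith [D.ε_pos]⟩

theorem right_mem : 1 + D.ε ∈ Icc (-D.ε) (1 + D.ε) := ⟨by linarith [D.ε_pos], le_rfl⟩

theorem edge_mem (i : Fin 2) {y : ℝ} (hy : y ∈ Icc (-D.ε) (1 + D.ε)) :
    ((edge i, y) : ℝ × ℝ) ∈ square D.ε := by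
  refine ⟨?_, hy⟩
  have := D.ε_pos
  rcases edge_eq i with h | h <;> simp only [h] <;> constructor <;> linarith

theorem γ_sub_edgeSign (i : Fin 2) (s : ℝ) : D.γ i (s - edgeSign i) = D.γ i s := by
  rcases edgeSign_eq i with h | h <;> rw [h]
  · have := D.isLink.add_int i s (-1)
    rw [← this]
    push_cast
    rfl
  · have := D.isLink.periodic i s
    rw [← this]
    congr 1
    ring

/-- If the edge of the band covered a full turn of the component, two of its points would coincide,
against the injectivity of the band. Hence a nontrivial arc of the component remains outside the
band. -/
theorem f_right_lt (i : Fin 2) : D.f i (1 + D.ε) < D.f i (-D.ε) + 1 := by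
  by_contra hcon
  have h1 := D.strictMonoOn_f i D.left_mem D.right_mem (by linarith [D.ε_pos])
  obtain ⟨y, hy, hfy⟩ := intermediate_value_Icc (by linarith [D.ε_pos]) (D.continuousOn_f i)
    ⟨by linarith, not_lt.1 hcon⟩
  have h2 : D.b (edge i, y) = D.b (edge i, -D.ε) := by
    rw [D.edge_apply i y hy, D.edge_apply i _ D.left_mem, ← D.γ_sub_edgeSign i (D.e i y), D.e_eq,
      D.e_eq, hfy, mul_add, mul_one, add_sub_cancel_right]
  have h3 := D.injOn (D.edge_mem i hy) (D.edge_mem i D.left_mem) h2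
  have h4 : y = -D.ε := congrArg Prod.snd h3
  rw [h4] at hfy
  linarith

theorem exists_int_of_eq {i : Fin 2} {s : ℝ} {p : ℝ × ℝ} (hp : p ∈ square D.ε)
    (h : D.b p = D.γ i s) : p.1 = edge i ∧ ∃ m : ℤ, edgeSign i * s = D.f i p.2 + m := by
  obtain ⟨j, hj⟩ := exists_edge (D.bdry p hp i s h)
  have h1 : D.b p = D.γ j (D.e j p.2) := by
    rw [← D.edge_apply j p.2 hp.2, ← hj]
  obtain ⟨rfl, k, hk⟩ := D.isLink.injective j i _ _ (h1.symm.trans h)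
  refine ⟨hj, ?_⟩
  rcases edgeSign_eq j with hs | hs
  · exact ⟨k, by rw [f, hk, hs]; ring⟩
  · exact ⟨-k, by rw [f, hk, hs]; push_cast; ring⟩

/-- Points of the component `i` away from the arc `[-z, 1 + z]` of the edge `i` lie in the band only
near the ends of the edge. -/
theorem edge_of_eq {i : Fin 2} {s z : ℝ} {p : ℝ × ℝ} (hz : -z ∈ Icc (-D.ε) (1 + D.ε))
    (hs1 : D.f i (1 + z) - 1 ≤ edgeSign i * s) (hs2 : edgeSign i * s ≤ D.f i (-z))
    (hp : p ∈ square D.ε) (h : D.b p = D.γ i s) :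
    p.1 = edge i ∧ ((p.2 ≤ -z ∧ edgeSign i * s = D.f i p.2) ∨
      (1 + z ≤ p.2 ∧ edgeSign i * s = D.f i p.2 - 1)) := by
  obtain ⟨h1, m, hm⟩ := D.exists_int_of_eq hp h
  refine ⟨h1, ?_⟩
  have hz' : 1 + z ∈ Icc (-D.ε) (1 + D.ε) := ⟨by linarith [hz.2], by linarith [hz.1]⟩
  have hmono := (D.strictMonoOn_f i).monotoneOn
  have a1 := hmono D.left_mem hp.2 hp.2.1
  have a2 := hmono hp.2 D.right_mem hp.2.2
  have a3 := hmono hz D.right_mem hz.2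
  have a4 := hmono D.left_mem hz' hz'.1
  have a5 := D.f_right_lt i
  have b1 : (m : ℝ) < 1 := by linarith
  have b2 : (-2 : ℝ) < m := by linarith
  have b3 : m < 1 := by exact_mod_cast b1
  have b4 : -2 < m := by exact_mod_cast b2
  obtain rfl | rfl : m = 0 ∨ m = -1 := by omega
  · left
    push_cast at hm
    rw [add_zero] at hm
    exact ⟨((D.strictMonoOn_f i).le_iff_le hp.2 hz).1 (by linarith), hm⟩
  · right
    push_cast at hm
    exact ⟨((D.strictMonoOn_f i).le_iff_le hz' hp.2).1 (by linarith), by linarith⟩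

/-- The parameter of the part of the component `i` outside the band. -/
def w (i : Fin 2) (τ : ℝ) : ℝ :=
  edgeSign i * ((1 - τ) * D.f i (-D.ε) + τ * (D.f i (1 + D.ε) - 1))

theorem edgeSign_mul_w (i : Fin 2) (τ : ℝ) :
    edgeSign i * D.w i τ = (1 - τ) * D.f i (-D.ε) + τ * (D.f i (1 + D.ε) - 1) := by
  rw [w, ← mul_assoc, edgeSign_mul_self, one_mul]

theorem w_bounds (i : Fin 2) {τ : ℝ} (hτ : τ ∈ Icc (0 : ℝ) 1) :
    D.f i (1 + D.ε) - 1 ≤ edgeSign i * D.w i τ ∧ edgeSign i * D.w i τ ≤ D.f i (-D.ε) := by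
  rw [edgeSign_mul_w]
  have := D.f_right_lt i
  constructor <;> nlinarith [hτ.1, hτ.2]

theorem w_inj (i : Fin 2) {τ τ' : ℝ} (h : edgeSign i * D.w i τ = edgeSign i * D.w i τ') :
    τ = τ' := by
  rw [edgeSign_mul_w, edgeSign_mul_w] at h
  have := D.f_right_lt i
  have h1 : (τ - τ') * (D.f i (-D.ε) + 1 - D.f i (1 + D.ε)) = 0 := by linarith
  rcases mul_eq_zero.1 h1 with h | h <;> linarith

/-- The outer arc is traversed from the end y = -ε of the edge backwards to the end y = 1 + ε; the
latter is reached one period earlier, whence the -1 in `w`. -/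
theorem γ_w_zero (i : Fin 2) : D.γ i (D.w i 0) = D.b (edge i, -D.ε) := by
  rw [D.edge_apply i _ D.left_mem, D.e_eq, w]
  congr 1
  ring

theorem γ_w_one (i : Fin 2) : D.γ i (D.w i 1) = D.b (edge i, 1 + D.ε) := by
  rw [D.edge_apply i _ D.right_mem, ← D.γ_sub_edgeSign i (D.e i _), D.e_eq, w]
  congr 1
  ring

theorem w_of_eq {i : Fin 2} {τ : ℝ} (hτ : τ ∈ Icc (0 : ℝ) 1) {p : ℝ × ℝ} (hp : p ∈ square D.ε)
    (h : D.b p = D.γ i (D.w i τ)) : p.1 = edge i ∧ ((p.2 = -D.ε ∧ τ = 0) ∨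
      (p.2 = 1 + D.ε ∧ τ = 1)) := by
  obtain ⟨h1, h2⟩ := D.edge_of_eq D.left_mem (D.w_bounds i hτ).1 (D.w_bounds i hτ).2 hp h
  refine ⟨h1, ?_⟩
  rcases h2 with ⟨h2, h3⟩ | ⟨h2, h3⟩
  · have h4 : p.2 = -D.ε := le_antisymm h2 hp.2.1
    refine Or.inl ⟨h4, D.w_inj i (h3.trans ?_)⟩
    rw [edgeSign_mul_w, h4]
    ring
  · have h4 : p.2 = 1 + D.ε := le_antisymm hp.2.2 h2
    refine Or.inr ⟨h4, D.w_inj i (h3.trans ?_)⟩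
    rw [edgeSign_mul_w, h4]
    ring

theorem w_eq {i j : Fin 2} {τ τ' : ℝ} (hτ : τ ∈ Icc (0 : ℝ) 1) (hτ' : τ' ∈ Icc (0 : ℝ) 1)
    (h : D.γ i (D.w i τ) = D.γ j (D.w j τ')) : i = j ∧ τ = τ' := by
  obtain ⟨rfl, m, hm⟩ := D.isLink.injective i j _ _ h
  refine ⟨rfl, D.w_inj i ?_⟩
  have h1 := D.w_bounds i hτ
  have h2 := D.w_bounds i hτ'
  have h3 := D.strictMonoOn_f i D.left_mem D.right_mem (by linarith [D.ε_pos])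
  have h4 : |(m : ℝ)| < 1 := by
    have : |edgeSign i * m| < 1 := by
      rw [abs_lt]
      have : edgeSign i * m = edgeSign i * D.w i τ' - edgeSign i * D.w i τ := by rw [hm]; ring
      rw [this]
      constructor <;> linarith
    rcases edgeSign_eq i with hs | hs <;> rw [hs] at this
    · simpa using this
    · simpa using this
  have h5 : |m| < 1 := by exact_mod_cast h4
  rw [Int.abs_lt_one_iff] at h5
  rw [hm, h5]
  simp

/-- Modulo periods the coordinate lies in the interval of length one that ends at the upper end of
the edge. This interval consists of the outer arc followed by the edge. -/
theorem exists_param (i : Fin 2) (s : ℝ) :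
    (∃ y ∈ Icc (-D.ε) (1 + D.ε), D.γ i s = D.b (edge i, y)) ∨
      ∃ τ ∈ Ioo (0 : ℝ) 1, D.γ i s = D.γ i (D.w i τ) := by
  obtain ⟨m, hm⟩ := exists_int_mem_Ioc (edgeSign i * s) (D.f i (1 + D.ε) - 1)
  rw [sub_add_cancel] at hm
  obtain ⟨n, hn⟩ : ∃ n : ℤ, edgeSign i * m = n := by
    rcases edgeSign_eq i with h | h
    · exact ⟨m, by simp [h]⟩
    · exact ⟨-m, by simp [h]⟩
  have hγ : D.γ i s = D.γ i (edgeSign i * (edgeSign i * s + m)) := by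
    rw [mul_add, ← mul_assoc, edgeSign_mul_self, one_mul, hn, D.isLink.add_int]
  have hlt := D.f_right_lt i
  rcases le_or_gt (D.f i (-D.ε)) (edgeSign i * s + m) with h | h
  · left
    obtain ⟨y, hy, hfy⟩ := intermediate_value_Icc (by linarith [D.ε_pos]) (D.continuousOn_f i)
      ⟨h, hm.2⟩
    exact ⟨y, hy, by rw [hγ, D.edge_apply i y hy, D.e_eq, hfy]⟩
  · right
    have hpos : 0 < D.f i (-D.ε) + 1 - D.f i (1 + D.ε) := by linarith
    refine ⟨(D.f i (-D.ε) - (edgeSign i * s + m)) / (D.f i (-D.ε) + 1 - D.f i (1 + D.ε)),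
      ⟨div_pos (by linarith) hpos, (div_lt_one hpos).2 (by linarith [hm.1])⟩, ?_⟩
    rw [hγ, w]
    congr 2
    field_simp
    ring

/-! ### The saddle surface -/

/-- The equation `X = t k(X + Y)` of the saddle surface, in the chart given by the band. -/
def Eqn (p : ℝ × ℝ) (t : ℝ) : Prop := D.X p.1 = t * D.k (D.X p.1 + D.X p.2)

/-- The saddle surface: a pair of pants, with the link at the bottom and the result of the band
surgery at the top. -/
def saddle : Set (R4 × ℝ) :=
  {q | q.2 ∈ Icc (0 : ℝ) 1 ∧ ((∃ p ∈ square D.ε, D.Eqn p q.2 ∧ D.b p = q.1) ∨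
    ∃ i, ∃ τ ∈ Icc (0 : ℝ) 1, D.γ i (D.w i τ) = q.1)}

theorem Eqn.nonneg {D : BandSurgery} {p : ℝ × ℝ} {t : ℝ} (h : D.Eqn p t) (ht : 0 ≤ t) :
    0 ≤ D.X p.1 := by
  rw [h]
  exact mul_nonneg ht (D.profile.nonneg _)

/-- The equation gives X ≤ k(U) for U = X + Y. If U were above -η, monotonicity of u - k(u) would
give Y ≥ U - k(U) ≥ -η. So U ≤ -η and k(U) = 0: beyond the corners the saddle is vertical. -/
theorem Eqn.eq_zero {D : BandSurgery} {p : ℝ × ℝ} {t : ℝ} (h : D.Eqn p t)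
    (ht : t ∈ Icc (0 : ℝ) 1) (hY : D.X p.2 < -D.η) : D.X p.1 = 0 := by
  unfold Eqn at h
  set U := D.X p.1 + D.X p.2 with hU
  have h1 : D.X p.1 ≤ D.k U := by
    rw [h]
    exact mul_le_of_le_one_left (D.profile.nonneg _) ht.2
  rcases le_or_gt U (-D.η) with h2 | h2
  · rw [h, D.profile.eq_zero U h2, mul_zero]
  · have h3 := D.profile.mono_sub h2.le
    simp only [D.profile.eq_zero _ le_rfl] at h3
    linarith

theorem eqn_zero_iff (p : ℝ × ℝ) : D.Eqn p 0 ↔ ∃ i, p.1 = edge i := by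
  rw [Eqn, zero_mul]
  constructor
  · exact smoothFold_eq_zero D.c_pos.le D.c_lt
  · rintro ⟨i, hi⟩
    rw [hi, D.X_edge]

theorem eqn_edge_of_lt {i : Fin 2} {y : ℝ} (hy : D.X y ≤ -D.η) (t : ℝ) : D.Eqn (edge i, y) t := by
  rw [Eqn, D.X_edge, zero_add, D.profile.eq_zero _ hy, mul_zero]

theorem X_left : D.X (-D.ε) = -D.ε := D.X_of_le (by linarith [D.ε_pos, D.c_pos])

theorem X_one_add {z : ℝ} (hz : -z ≤ D.c) : D.X (1 + z) = -z := by
  have : D.X (1 + z) = D.X (-z) := by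
    rw [X, X, ← smoothFold_one_sub D.c_lt (-z), sub_neg_eq_add]
  rw [this, D.X_of_le hz]

theorem X_right : D.X (1 + D.ε) = -D.ε := D.X_one_add (by linarith [D.ε_pos, D.c_pos])

theorem saddle_bottom : {x | (x, (0 : ℝ)) ∈ D.saddle} = ⋃ i, range (D.γ i) := by
  ext x
  simp only [saddle, mem_ofPred_eq, mem_iUnion, mem_range, D.eqn_zero_iff]
  constructor
  · rintro ⟨-, ⟨p, hp, ⟨i, hi⟩, rfl⟩ | ⟨i, τ, -, rfl⟩⟩
    · refine ⟨i, D.e i p.2, ?_⟩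
      rw [← D.edge_apply i p.2 hp.2, ← hi]
    · exact ⟨i, _, rfl⟩
  · rintro ⟨i, s, rfl⟩
    refine ⟨⟨le_rfl, zero_le_one⟩, ?_⟩
    rcases D.exists_param i s with ⟨y, hy, h⟩ | ⟨τ, hτ, h⟩
    · exact Or.inl ⟨(edge i, y), D.edge_mem i hy, ⟨i, rfl⟩, h.symm⟩
    · exact Or.inr ⟨i, τ, Ioo_subset_Icc_self hτ, h.symm⟩

theorem saddle_top : {x | (x, (1 : ℝ)) ∈ D.saddle} =
    ((⋃ i, range (D.γ i)) \ D.b '' square D.ε) ∪ D.b '' {p ∈ square D.ε | D.Eqn p 1} := by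
  ext x
  simp only [saddle, mem_ofPred_eq, mem_union, mem_sdiff, mem_image, mem_iUnion, mem_range]
  constructor
  · rintro ⟨-, ⟨p, hp, h, rfl⟩ | ⟨i, τ, hτ, rfl⟩⟩
    · exact Or.inr ⟨p, ⟨hp, h⟩, rfl⟩
    -- The end points of an outer arc also lie in the band; there they satisfy the equation because
    -- X = 0 and Y = -ε.
    · by_cases hb : ∃ p ∈ square D.ε, D.b p = D.γ i (D.w i τ)
      · obtain ⟨p, hp, h⟩ := hb
        refine Or.inr ⟨p, ⟨hp, ?_⟩, h⟩
        obtain ⟨h1, h2⟩ := D.w_of_eq hτ hp h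
        have : p = (edge i, p.2) := Prod.ext h1 rfl
        rw [this]
        refine D.eqn_edge_of_lt ?_ 1
        rcases h2 with ⟨h2, -⟩ | ⟨h2, -⟩
        · rw [h2, D.X_left]
          linarith [D.lt_margin]
        · rw [h2, D.X_right]
          linarith [D.lt_margin]
      · refine Or.inl ⟨⟨i, _, rfl⟩, ?_⟩
        rintro ⟨p, hp, h⟩
        exact hb ⟨p, hp, h⟩
  · rintro (⟨⟨i, s, rfl⟩, h⟩ | ⟨p, ⟨hp, h⟩, rfl⟩)
    · refine ⟨⟨zero_le_one, le_rfl⟩, Or.inr ?_⟩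
      rcases D.exists_param i s with ⟨y, hy, h'⟩ | ⟨τ, hτ, h'⟩
      · exact absurd ⟨_, D.edge_mem i hy, h'.symm⟩ h
      · exact ⟨i, τ, Ioo_subset_Icc_self hτ, h'.symm⟩
    · exact ⟨⟨zero_le_one, le_rfl⟩, Or.inl ⟨p, hp, h, rfl⟩⟩

end BandSurgery

namespace BandSurgery

variable (D : BandSurgery)

/-! ### Charts of the saddle surface -/

/-- A number between the size of the rounding and the margin. -/
def z : ℝ := (D.η + D.ε) / 2

/-- Beyond z > η the saddle is vertical already, and since z < ε the wall charts, which start at z,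
overlap the corner charts, which end at ε. -/
theorem η_lt_z : D.η < D.z := by
  have := D.lt_margin
  unfold z
  linarith

theorem z_lt : D.z < D.ε := by
  have := D.lt_margin
  unfold z
  linarith

theorem neg_z_mem : -D.z ∈ Icc (-D.ε) (1 + D.ε) :=
  ⟨by linarith [D.z_lt], by linarith [D.η_lt_z, D.η_pos, D.ε_pos]⟩

theorem one_add_z_mem : 1 + D.z ∈ Icc (-D.ε) (1 + D.ε) :=
  ⟨by linarith [D.η_lt_z, D.η_pos, D.ε_pos], by linarith [D.z_lt]⟩

/-- The chart along the component `i`. -/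
def wallMap (i : Fin 2) (u : ℝ × ℝ) : R4 × ℝ := (D.γ i u.2, u.1)

/-- The interval of parameters of the component `i` used for the chart `wallMap`. -/
def wallArc (i : Fin 2) : Set ℝ :=
  {s | edgeSign i * s ∈ Ioo (D.f i (1 + D.z) - 1) (D.f i (-D.z))}

/-- The domain of `wallMap`. -/
def wallDom (i : Fin 2) : Set (ℝ × ℝ) := Ioo (-1) 2 ×ˢ D.wallArc i

/-- The value of `X + Y` in the corner chart. -/
def cornerU (i j : Fin 2) (u : ℝ × ℝ) : ℝ := edgeSign i * edgeSign j * u.2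

/-- The folded first coordinate in the corner chart. -/
def cornerX (i j : Fin 2) (u : ℝ × ℝ) : ℝ := u.1 * D.k (cornerU i j u)

/-- The folded second coordinate in the corner chart. -/
def cornerY (i j : Fin 2) (u : ℝ × ℝ) : ℝ := cornerU i j u - u.1 * D.k (cornerU i j u)

/-- The point of the band given by the corner chart. -/
def cornerPt (i j : Fin 2) (u : ℝ × ℝ) : ℝ × ℝ :=
  (reflect (edgeSign i) (D.cornerX i j u), reflect (edgeSign j) (D.cornerY i j u))

/-- The chart near a corner of the band. -/
def cornerMap (i j : Fin 2) (u : ℝ × ℝ) : R4 × ℝ := (D.b (D.cornerPt i j u), u.1)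

/-- The domain of `cornerMap`. -/
def cornerDom (i j : Fin 2) : Set (ℝ × ℝ) :=
  {u | u.1 ∈ Ioo (-1 : ℝ) 2 ∧ D.cornerX i j u ∈ Ioo (-D.ε) D.c ∧ D.cornerY i j u ∈ Ioo (-D.ε) D.c}

/-- The height over the central part of the band. -/
def height (p : ℝ × ℝ) : ℝ := D.X p.1 / (D.X p.1 + D.X p.2)

/-- The chart over the central part of the band. -/
def centerMap (p : ℝ × ℝ) : R4 × ℝ := (D.b p, D.height p)

/-- The domain of `centerMap`. -/
def centerDom : Set (ℝ × ℝ) :=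
  {p | p ∈ Ioo (-D.ε) (1 + D.ε) ×ˢ Ioo (-D.ε) (1 + D.ε) ∧ D.η < D.X p.1 + D.X p.2}

theorem open_square_subset :
    Ioo (-D.ε) (1 + D.ε) ×ˢ Ioo (-D.ε) (1 + D.ε) ⊆ square D.ε :=
  prod_mono Ioo_subset_Icc_self Ioo_subset_Icc_self

theorem isCompact_square (ε : ℝ) : IsCompact (square ε) := isCompact_Icc.prod isCompact_Icc

theorem c_lt_one_add : D.c < 1 + D.ε := by linarith [D.c_lt, D.ε_pos]

theorem lt_half_of_cornerX {i j : Fin 2} {u : ℝ × ℝ} (h : D.cornerX i j u ∈ Ioo (-D.ε) D.c) :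
    D.cornerX i j u < 1 / 2 := h.2.trans D.c_lt

theorem reflect_eq_reflect {i j : Fin 2} {x y : ℝ} (hx : x < 1 / 2) (hy : y < 1 / 2)
    (h : reflect (edgeSign i) x = reflect (edgeSign j) y) : i = j ∧ x = y := by
  fin_cases i <;> fin_cases j <;> simp [reflect, edgeSign] at h ⊢ <;> linarith

theorem cornerX_add_cornerY (i j : Fin 2) (u : ℝ × ℝ) :
    D.cornerX i j u + D.cornerY i j u = cornerU i j u := by
  unfold cornerX cornerY
  ring

theorem cornerU_inj {i j : Fin 2} {u v : ℝ × ℝ} (h : cornerU i j u = cornerU i j v) :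
    u.2 = v.2 := by
  unfold cornerU at h
  exact mul_left_cancel₀ (mul_ne_zero (edgeSign_ne_zero i) (edgeSign_ne_zero j)) h

theorem contDiff_cornerU (i j : Fin 2) : ContDiff ℝ ∞ (cornerU i j) :=
  contDiff_const.mul contDiff_snd

theorem contDiff_cornerX (i j : Fin 2) : ContDiff ℝ ∞ (D.cornerX i j) :=
  contDiff_fst.mul (D.profile.smooth.comp (contDiff_cornerU i j))

theorem contDiff_cornerY (i j : Fin 2) : ContDiff ℝ ∞ (D.cornerY i j) :=
  (contDiff_cornerU i j).sub (D.contDiff_cornerX i j)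

theorem contDiff_reflect (a : ℝ) : ContDiff ℝ ∞ (reflect a) :=
  contDiff_const.add (contDiff_const.mul (contDiff_id.sub contDiff_const))

theorem contDiff_cornerPt (i j : Fin 2) : ContDiff ℝ ∞ (D.cornerPt i j) :=
  ((contDiff_reflect _).comp (D.contDiff_cornerX i j)).prodMk
    ((contDiff_reflect _).comp (D.contDiff_cornerY i j))

theorem differentiable_cornerPt (i j : Fin 2) : Differentiable ℝ (D.cornerPt i j) :=
  (D.contDiff_cornerPt i j).differentiable (by simp)

theorem differentiable_b : Differentiable ℝ D.b := D.smooth.differentiable (by simp)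

theorem fderiv_b_cornerPt (i j : Fin 2) (u w : ℝ × ℝ) :
    fderiv ℝ (fun u => D.b (D.cornerPt i j u)) u w =
      fderiv ℝ D.b (D.cornerPt i j u) (fderiv ℝ (D.cornerPt i j) u w) := by
  have := fderiv_comp u (D.differentiable_b (D.cornerPt i j u)) (D.differentiable_cornerPt i j u)
  exact congrArg (fun A => A w) this

theorem hasDerivAt_reflect (a x : ℝ) : HasDerivAt (reflect a) a x := by
  have h : HasDerivAt (reflect a) (a * 1) x :=
    (((hasDerivAt_id x).sub_const (1 / 2)).const_mul a).const_add (1 / 2)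
  rwa [mul_one] at h

theorem fderiv_cornerPt_zero_one (i j : Fin 2) (u : ℝ × ℝ) :
    fderiv ℝ (D.cornerPt i j) u (0, 1) = (edgeSign j * (u.1 * deriv D.k (cornerU i j u)),
      edgeSign i * (1 - u.1 * deriv D.k (cornerU i j u))) := by
  have h1 := fderiv_apply_zero_one (D.differentiable_cornerPt i j u)
  have hk : HasDerivAt D.k (deriv D.k (cornerU i j u)) (cornerU i j u) :=
    (D.profile.smooth.differentiable (by simp) _).hasDerivAt
  have hU : HasDerivAt (fun s => cornerU i j (u.1, s)) (edgeSign i * edgeSign j) u.2 := by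
    simpa [cornerU] using (hasDerivAt_id u.2).const_mul (edgeSign i * edgeSign j)
  have hX : HasDerivAt (fun s => D.cornerX i j (u.1, s)) _ u.2 :=
    (HasDerivAt.comp u.2 (h := fun s => cornerU i j (u.1, s)) hk hU).const_mul u.1
  have h2 : HasDerivAt (fun s => D.cornerPt i j (u.1, s)) _ u.2 :=
    (HasDerivAt.comp u.2 (h := fun s => D.cornerX i j (u.1, s))
      (hasDerivAt_reflect (edgeSign i) _) hX).prodMk
    (HasDerivAt.comp u.2 (h := fun s => D.cornerY i j (u.1, s))
      (hasDerivAt_reflect (edgeSign j) _) (hU.sub hX))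
  rw [h1.unique h2]
  have hi := edgeSign_mul_self i
  have hj := edgeSign_mul_self j
  refine Prod.ext ?_ ?_
  · simp only
    linear_combination u.1 * deriv D.k (cornerU i j u) * edgeSign j * hi
  · simp only
    linear_combination edgeSign i * (1 - u.1 * deriv D.k (cornerU i j u)) * hj

theorem fderiv_cornerPt_one_zero (i j : Fin 2) (u : ℝ × ℝ) :
    fderiv ℝ (D.cornerPt i j) u (1, 0) = (edgeSign i * D.k (cornerU i j u),
      -(edgeSign j * D.k (cornerU i j u))) := by
  have h1 := fderiv_apply_one_zero (D.differentiable_cornerPt i j u)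
  have hX : HasDerivAt (fun s => D.cornerX i j (s, u.2)) (D.k (cornerU i j u)) u.1 := by
    have := (hasDerivAt_id u.1).mul_const (D.k (cornerU i j u))
    rw [one_mul] at this
    exact this
  have h2 : HasDerivAt (fun s => D.cornerPt i j (s, u.2)) _ u.1 :=
    (HasDerivAt.comp u.1 (h := fun s => D.cornerX i j (s, u.2))
      (hasDerivAt_reflect (edgeSign i) _) hX).prodMk
    (HasDerivAt.comp u.1 (h := fun s => D.cornerY i j (s, u.2))
      (hasDerivAt_reflect (edgeSign j) _) ((hasDerivAt_const u.1 (cornerU i j u)).sub hX))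
  rw [h1.unique h2]
  simp

/-- The map (t, U) ↦ (t k(U), U - t k(U)) has Jacobian determinant k(U). The signs of the two
reflections cancel against the sign in `cornerU`, so the four corner charts are oriented alike. -/
theorem det_fderiv_cornerPt (i j : Fin 2) (u : ℝ × ℝ) :
    (fderiv ℝ (D.cornerPt i j) u).det = D.k (cornerU i j u) := by
  rw [det_prod_real, fderiv_cornerPt_zero_one, fderiv_cornerPt_one_zero]
  have hi := edgeSign_mul_self i
  have hj := edgeSign_mul_self j
  simp only
  linear_combination D.k (cornerU i j u) * (1 - u.1 * deriv D.k (cornerU i j u)) * hi +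
    D.k (cornerU i j u) * (u.1 * deriv D.k (cornerU i j u)) * hj

theorem cornerPt_mem {i j : Fin 2} {u : ℝ × ℝ} (hX : D.cornerX i j u ∈ Icc (-D.ε) D.c)
    (hY : D.cornerY i j u ∈ Icc (-D.ε) D.c) : D.cornerPt i j u ∈ square D.ε :=
  ⟨reflect_mem_Icc i ⟨hX.1, hX.2.trans D.c_lt_one_add.le⟩,
    reflect_mem_Icc j ⟨hY.1, hY.2.trans D.c_lt_one_add.le⟩⟩

theorem cornerPt_mem_of_dom {i j : Fin 2} {u : ℝ × ℝ} (hu : u ∈ D.cornerDom i j) :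
    D.cornerPt i j u ∈ square D.ε :=
  D.cornerPt_mem (Ioo_subset_Icc_self hu.2.1) (Ioo_subset_Icc_self hu.2.2)

theorem X_cornerPt_fst {i j : Fin 2} {u : ℝ × ℝ} (hX : D.cornerX i j u ≤ D.c) :
    D.X (D.cornerPt i j u).1 = D.cornerX i j u := by
  rw [cornerPt, D.X_reflect, D.X_of_le hX]

theorem X_cornerPt_snd {i j : Fin 2} {u : ℝ × ℝ} (hY : D.cornerY i j u ≤ D.c) :
    D.X (D.cornerPt i j u).2 = D.cornerY i j u := by
  rw [cornerPt, D.X_reflect, D.X_of_le hY]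

theorem eqn_cornerPt {i j : Fin 2} {u : ℝ × ℝ} (hu : u ∈ D.cornerDom i j) :
    D.Eqn (D.cornerPt i j u) u.1 := by
  rw [Eqn, D.X_cornerPt_fst hu.2.1.2.le, D.X_cornerPt_snd hu.2.2.2.le, cornerX_add_cornerY]
  rfl

theorem cornerMap_inj {i j i' j' : Fin 2} {u u' : ℝ × ℝ}
    (hX : D.cornerX i j u ∈ Icc (-D.ε) D.c) (hY : D.cornerY i j u ∈ Icc (-D.ε) D.c)
    (hX' : D.cornerX i' j' u' ∈ Icc (-D.ε) D.c) (hY' : D.cornerY i' j' u' ∈ Icc (-D.ε) D.c)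
    (h : D.cornerMap i j u = D.cornerMap i' j' u') : i = i' ∧ j = j' ∧ u = u' := by
  simp only [cornerMap, Prod.mk.injEq] at h
  have h1 := D.injOn (D.cornerPt_mem hX hY) (D.cornerPt_mem hX' hY') h.1
  simp only [cornerPt, Prod.mk.injEq] at h1
  obtain ⟨rfl, h2⟩ := reflect_eq_reflect (hX.2.trans_lt D.c_lt) (hX'.2.trans_lt D.c_lt) h1.1
  obtain ⟨rfl, h3⟩ := reflect_eq_reflect (hY.2.trans_lt D.c_lt) (hY'.2.trans_lt D.c_lt) h1.2
  refine ⟨rfl, rfl, Prod.ext h.2 (cornerU_inj (i := i) (j := j) ?_)⟩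
  rw [← D.cornerX_add_cornerY, h2, h3, D.cornerX_add_cornerY]

/-! ### The charts are local parametrizations -/

theorem isCompact_walls : IsCompact (⋃ i, (fun τ => D.γ i (D.w i τ)) '' Icc 0 1) := by
  refine isCompact_iUnion fun i => isCompact_Icc.image ?_
  refine (D.isLink.smooth i).continuous.comp ?_
  unfold w
  fun_prop

/-- Injectivity of the band isolates the part of the saddle over an open set O of its square: remove
the compact image of the rest of the square and the outer arcs. -/
theorem exists_relOpen_of_band {ψ : ℝ × ℝ → R4 × ℝ} {V O : Set (ℝ × ℝ)} (hO : IsOpen O)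
    (hOsq : O ⊆ Ioo (-D.ε) (1 + D.ε) ×ˢ Ioo (-D.ε) (1 + D.ε))
    (h1 : ∀ u ∈ V, ∃ p ∈ O, D.b p = (ψ u).1 ∧ ((ψ u).2 ∈ Icc (0 : ℝ) 1 → D.Eqn p (ψ u).2))
    (h2 : ∀ p ∈ O, ∀ t ∈ Icc (0 : ℝ) 1, D.Eqn p t → ∃ u ∈ V, ψ u = (D.b p, t)) :
    ∃ W : Set (R4 × ℝ), IsOpen W ∧ D.saddle ∩ W = ψ '' V ∩ slab := by
  let Z : Set R4 := D.b '' (square D.ε \ O) ∪ ⋃ i, (fun τ => D.γ i (D.w i τ)) '' Icc 0 1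
  have hZ : IsCompact Z := by
    refine IsCompact.union (IsCompact.image ?_ D.smooth.continuous) D.isCompact_walls
    exact (isCompact_square D.ε).diff hO
  refine ⟨Prod.fst ⁻¹' Zᶜ, hZ.isClosed.isOpen_compl.preimage continuous_fst, ?_⟩
  ext ⟨x, t⟩
  constructor
  · rintro ⟨⟨ht, ⟨p, hp, hpt, rfl⟩ | ⟨i, τ, hτ, rfl⟩⟩, hxZ⟩
    · have hpO : p ∈ O := by
        by_contra hpO
        exact hxZ (Or.inl ⟨p, ⟨hp, hpO⟩, rfl⟩)
      obtain ⟨u, hu, hut⟩ := h2 p hpO t ht hpt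
      exact ⟨⟨u, hu, hut⟩, ht⟩
    · exact (hxZ (Or.inr (mem_iUnion.2 ⟨i, τ, hτ, rfl⟩))).elim
  · rintro ⟨⟨u, hu, hut⟩, ht⟩
    obtain ⟨p, hpO, hp1, hp2⟩ := h1 u hu
    rw [hut] at hp1 hp2
    have hpsq := D.open_square_subset (hOsq hpO)
    refine ⟨⟨ht, Or.inl ⟨p, hpsq, hp2 ht, hp1⟩⟩, ?_⟩
    rintro (⟨p', hp', h⟩ | h)
    · exact hp'.2 (D.injOn hp'.1 hpsq (h.trans hp1.symm) ▸ hpO)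
    · obtain ⟨i, τ, hτ, h⟩ := mem_iUnion.1 h
      have h3 := (D.w_of_eq hτ hpsq (hp1.trans h.symm)).2
      have h4 := (hOsq hpO).2
      rcases h3 with ⟨h3, -⟩ | ⟨h3, -⟩ <;> rw [h3] at h4
      · exact lt_irrefl _ h4.1
      · exact lt_irrefl _ h4.2

theorem isOpen_cornerDom (i j : Fin 2) : IsOpen (D.cornerDom i j) :=
  (isOpen_Ioo.preimage continuous_fst).inter
    ((isOpen_Ioo.preimage (D.contDiff_cornerX i j).continuous).inter
      (isOpen_Ioo.preimage (D.contDiff_cornerY i j).continuous))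

theorem isLocalParam_cornerMap (i j : Fin 2) :
    IsLocalParam D.saddle (D.cornerMap i j) (D.cornerDom i j) := by
  refine isLocalParam_level (D.smooth.comp (D.contDiff_cornerPt i j)) (D.isOpen_cornerDom i j)
    (fun u hu => D.norm_eq_one _ (D.cornerPt_mem_of_dom hu)) ?_ ?_ ?_
  -- Up to sign, the derivative of the corner point in the direction of U is (t k', 1 - t k'), whose
  -- entries have sum 1 and cannot both vanish.
  · intro u hu h0
    rw [fderiv_b_cornerPt] at h0
    have h1 := (injective_iff_map_eq_zero _).1 (D.immersion _ (D.cornerPt_mem_of_dom hu)) _ h0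
    rw [fderiv_cornerPt_zero_one, Prod.mk_eq_zero] at h1
    have h2 := (mul_eq_zero.1 h1.1).resolve_left (edgeSign_ne_zero j)
    have h3 := (mul_eq_zero.1 h1.2).resolve_left (edgeSign_ne_zero i)
    rw [h2] at h3
    norm_num at h3
  · let K : Set (ℝ × ℝ) := {u | u.1 ∈ Icc (-1 : ℝ) 2 ∧ D.cornerX i j u ∈ Icc (-D.ε) D.c ∧
      D.cornerY i j u ∈ Icc (-D.ε) D.c}
    have hK : IsCompact K := by
      refine (isCompact_Icc (a := (-1 : ℝ)) (b := 2)).prod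
        (isCompact_Icc (a := -(2 * D.ε + 2 * D.c)) (b := 2 * D.ε + 2 * D.c)) |>.of_isClosed_subset ?_ ?_
      · exact (isClosed_Icc.preimage continuous_fst).inter
          ((isClosed_Icc.preimage (D.contDiff_cornerX i j).continuous).inter
          (isClosed_Icc.preimage (D.contDiff_cornerY i j).continuous))
      · rintro u ⟨h1, h2, h3⟩
        refine ⟨h1, ?_⟩
        have h4 := D.cornerX_add_cornerY i j u
        have h5 : |u.2| = |cornerU i j u| := by
          rcases edgeSign_eq i with hi | hi <;> rcases edgeSign_eq j with hj | hj <;>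
            simp [cornerU, hi, hj]
        rw [mem_Icc, ← abs_le, h5, abs_le, ← h4]
        have := D.ε_pos
        have := D.c_pos
        constructor <;> linarith [h2.1, h2.2, h3.1, h3.2]
    refine isEmbedding_domRestrict hK ?_ ?_ ?_
    · rintro u ⟨h1, h2, h3⟩
      exact ⟨Ioo_subset_Icc_self h1, Ioo_subset_Icc_self h2, Ioo_subset_Icc_self h3⟩
    · exact ((D.smooth.comp (D.contDiff_cornerPt i j)).continuous.prodMk continuous_fst).continuousOn
    · rintro u ⟨-, h2, h3⟩ u' ⟨-, h2', h3'⟩ h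
      exact (D.cornerMap_inj h2 h3 h2' h3' h).2.2
  · let A : Set ℝ := reflect (edgeSign i) ⁻¹' Ioo (-D.ε) D.c
    let B : Set ℝ := reflect (edgeSign j) ⁻¹' Ioo (-D.ε) D.c
    refine D.exists_relOpen_of_band (O := A ×ˢ B) ?_ ?_ ?_ ?_
    · exact (isOpen_Ioo.preimage (contDiff_reflect _).continuous).prod
        (isOpen_Ioo.preimage (contDiff_reflect _).continuous)
    · rintro ⟨x, y⟩ ⟨hx, hy⟩
      have hx' := reflect_mem_Ioo (ε := D.ε) i ⟨hx.1, hx.2.trans D.c_lt_one_add⟩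
      have hy' := reflect_mem_Ioo (ε := D.ε) j ⟨hy.1, hy.2.trans D.c_lt_one_add⟩
      rw [reflect_reflect] at hx' hy'
      exact ⟨hx', hy'⟩
    · intro u hu
      refine ⟨D.cornerPt i j u, ⟨?_, ?_⟩, rfl, fun _ => D.eqn_cornerPt hu⟩
      · simp only [A, mem_preimage, cornerPt, reflect_reflect]
        exact hu.2.1
      · simp only [B, mem_preimage, cornerPt, reflect_reflect]
        exact hu.2.2
    · rintro ⟨x, y⟩ ⟨hx, hy⟩ t ht hpt
      simp only [A, B, mem_preimage] at hx hy
      have hXx : D.X x = reflect (edgeSign i) x := by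
        rw [← D.X_reflect i, D.X_of_le hx.2.le]
      have hXy : D.X y = reflect (edgeSign j) y := by
        rw [← D.X_reflect j, D.X_of_le hy.2.le]
      rw [Eqn, hXx, hXy] at hpt
      -- The parameter is recovered from the sum of the folded coordinates; the factor of signs is
      -- its own inverse.
      let u : ℝ × ℝ := (t, edgeSign i * edgeSign j *
        (reflect (edgeSign i) x + reflect (edgeSign j) y))
      have hU : cornerU i j u = reflect (edgeSign i) x + reflect (edgeSign j) y := by
        simp only [cornerU, u]
        have hi := edgeSign_mul_self i
        have hj := edgeSign_mul_self j
        linear_combination (edgeSign j * edgeSign j) *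
          (reflect (edgeSign i) x + reflect (edgeSign j) y) * hi +
          (reflect (edgeSign i) x + reflect (edgeSign j) y) * hj
      have hX : D.cornerX i j u = reflect (edgeSign i) x := by
        rw [cornerX, hU]
        exact hpt.symm
      have hY : D.cornerY i j u = reflect (edgeSign j) y := by
        have := D.cornerX_add_cornerY i j u
        linarith
      have hpt' : D.cornerPt i j u = (x, y) := by
        rw [cornerPt, hX, hY, reflect_reflect, reflect_reflect]
      refine ⟨u, ⟨⟨by simp only [u]; linarith [ht.1], by simp only [u]; linarith [ht.2]⟩, ?_, ?_⟩, ?_⟩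
      · rw [hX]; exact hx
      · rw [hY]; exact hy
      · exact Prod.ext (congrArg D.b hpt') rfl

theorem wallArc_inj {i : Fin 2} {s s' : ℝ}
    (hs : edgeSign i * s ∈ Icc (D.f i (1 + D.z) - 1) (D.f i (-D.z)))
    (hs' : edgeSign i * s' ∈ Icc (D.f i (1 + D.z) - 1) (D.f i (-D.z)))
    (h : D.γ i s = D.γ i s') : s = s' := by
  obtain ⟨-, m, rfl⟩ := D.isLink.injective i i _ _ h
  have h1 := D.strictMonoOn_f i D.neg_z_mem D.one_add_z_mem (by linarith [D.η_lt_z, D.η_pos])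
  have h4 : |(m : ℝ)| < 1 := by
    have h5 : |edgeSign i * m| < 1 := by
      rw [abs_lt]
      rw [mul_add] at hs'
      constructor <;> linarith [hs.1, hs.2, hs'.1, hs'.2]
    rcases edgeSign_eq i with hs | hs <;> rw [hs] at h5 <;> simpa using h5
  have h5 : |m| < 1 := by exact_mod_cast h4
  rw [Int.abs_lt_one_iff] at h5
  simp [h5]

/-- Wall points meet the band only in the two end strips beyond z. The upper strip is reached with a
shift by one period, the origin of the term `edgeSign i`. -/
theorem not_mem_of_wallArc {i : Fin 2} {s : ℝ} (hs : s ∈ D.wallArc i) {p : ℝ × ℝ}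
    (hp : p ∈ square D.ε) (h : D.b p = D.γ i s) :
    p.1 = edge i ∧ ((p.2 < -D.z ∧ s = D.e i p.2) ∨ (1 + D.z < p.2 ∧ s = D.e i p.2 - edgeSign i)) := by
  obtain ⟨h1, h2⟩ := D.edge_of_eq D.neg_z_mem hs.1.le hs.2.le hp h
  have hi := edgeSign_mul_self i
  refine ⟨h1, ?_⟩
  rcases h2 with ⟨h2, h3⟩ | ⟨h2, h3⟩
  · refine Or.inl ⟨lt_of_le_of_ne h2 fun h4 => ?_, ?_⟩
    · rw [h4] at h3
      exact hs.2.ne h3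
    · rw [f] at h3
      exact mul_left_cancel₀ (edgeSign_ne_zero i) h3
  · refine Or.inr ⟨lt_of_le_of_ne h2 fun h4 => ?_, ?_⟩
    · rw [← h4] at h3
      exact hs.1.ne h3.symm
    · rw [f] at h3
      refine mul_left_cancel₀ (edgeSign_ne_zero i) (h3.trans ?_)
      rw [mul_sub, hi]

theorem mem_wallArc_of_lt {i : Fin 2} {y : ℝ} (hy : y ∈ Icc (-D.ε) (1 + D.ε)) (hyz : y < -D.z) :
    D.e i y ∈ D.wallArc i := by
  have hm := D.strictMonoOn_f i
  have h1 := hm hy D.neg_z_mem hyz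
  have h2 := hm.monotoneOn D.left_mem hy hy.1
  have h3 := hm.monotoneOn D.one_add_z_mem D.right_mem D.one_add_z_mem.2
  have h4 := D.f_right_lt i
  exact ⟨by rw [← f]; linarith, h1⟩

theorem mem_wallArc_of_gt {i : Fin 2} {y : ℝ} (hy : y ∈ Icc (-D.ε) (1 + D.ε)) (hyz : 1 + D.z < y) :
    D.e i y - edgeSign i ∈ D.wallArc i := by
  have hm := D.strictMonoOn_f i
  have h1 := hm D.one_add_z_mem hy hyz
  have h2 := hm.monotoneOn hy D.right_mem hy.2
  have h3 := hm.monotoneOn D.left_mem D.neg_z_mem D.neg_z_mem.1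
  have h4 := D.f_right_lt i
  have h5 : edgeSign i * (D.e i y - edgeSign i) = D.f i y - 1 := by
    rw [mul_sub, edgeSign_mul_self, f]
  exact ⟨by rw [h5]; linarith, by rw [h5]; linarith⟩

theorem w_mem_wallArc (i : Fin 2) {τ : ℝ} (hτ : τ ∈ Icc (0 : ℝ) 1) : D.w i τ ∈ D.wallArc i := by
  have hm := D.strictMonoOn_f i
  have h1 := D.w_bounds i hτ
  have h2 := hm D.left_mem D.neg_z_mem (by linarith [D.z_lt])
  have h3 := hm D.one_add_z_mem D.right_mem (by linarith [D.z_lt])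
  exact ⟨by linarith, by linarith⟩

theorem X_lt_of_not_mem {y : ℝ} (hy : y < -D.z ∨ 1 + D.z < y) : D.X y < -D.η := by
  have h1 := D.η_lt_z
  have h2 := D.η_pos
  have h3 := D.c_pos
  rcases hy with hy | hy
  · rw [D.X_of_le (by linarith)]
    linarith
  · rw [show y = 1 + -(1 - y) by ring, D.X_one_add (by linarith)]
    linarith

/-- Away from the corners the saddle is a product of the link with [0, 1]. To isolate the wall,
remove the part of the band with y between -z and 1 + z and the other component. -/
theorem isLocalParam_wallMap (i : Fin 2) :
    IsLocalParam D.saddle (D.wallMap i) (D.wallDom i) := by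
  have hγ : ContDiff ℝ ∞ fun u : ℝ × ℝ => D.γ i u.2 := (D.isLink.smooth i).comp contDiff_snd
  refine isLocalParam_level hγ ?_ (fun u _ => D.isLink.norm_eq_one i _) ?_ ?_ ?_
  · exact isOpen_Ioo.prod (isOpen_Ioo.preimage (continuous_const.mul continuous_id))
  · intro u _
    have h1 := fderiv_apply_zero_one (hγ.differentiable (by simp) u)
    have h2 : fderiv ℝ (fun u : ℝ × ℝ => D.γ i u.2) u (0, 1) = deriv (D.γ i) u.2 := h1.deriv.symm
    rw [h2]
    exact D.isLink.deriv_ne_zero i _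
  · let K : Set (ℝ × ℝ) := Icc (-1) 2 ×ˢ
      ((fun r => edgeSign i * r) '' Icc (D.f i (1 + D.z) - 1) (D.f i (-D.z)))
    have hK : ∀ s ∈ (fun r => edgeSign i * r) '' Icc (D.f i (1 + D.z) - 1) (D.f i (-D.z)),
        edgeSign i * s ∈ Icc (D.f i (1 + D.z) - 1) (D.f i (-D.z)) := by
      rintro _ ⟨r, hr, rfl⟩
      simp only
      rwa [← mul_assoc, edgeSign_mul_self, one_mul]
    refine isEmbedding_domRestrict (K := K) (isCompact_Icc.prod (isCompact_Icc.image (by fun_prop)))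
      ?_ (hγ.continuous.prodMk continuous_fst).continuousOn ?_
    · rintro ⟨t, s⟩ ⟨ht, hs⟩
      refine ⟨Ioo_subset_Icc_self ht, edgeSign i * s, Ioo_subset_Icc_self hs, ?_⟩
      simp only
      rw [← mul_assoc, edgeSign_mul_self, one_mul]
    · rintro ⟨t, s⟩ ⟨-, hs⟩ ⟨t', s'⟩ ⟨-, hs'⟩ h
      simp only [Prod.mk.injEq] at h
      exact Prod.ext h.2 (D.wallArc_inj (hK s hs) (hK s' hs') h.1)
  · let Z : Set R4 := D.b '' (square D.ε ∩ {p | p.2 ∈ Icc (-D.z) (1 + D.z)}) ∪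
      ⋃ (j : Fin 2) (_ : j ≠ i), range (D.γ j)
    have hZ : IsCompact Z := by
      refine IsCompact.union (IsCompact.image ?_ D.smooth.continuous) ?_
      · exact (isCompact_square D.ε).inter_right (isClosed_Icc.preimage continuous_snd)
      · refine isCompact_iUnion fun j => isCompact_iUnion fun _ => ?_
        exact Function.Periodic.compact_of_continuous (D.isLink.periodic j) one_ne_zero
          (D.isLink.smooth j).continuous
    refine ⟨Prod.fst ⁻¹' Zᶜ, hZ.isClosed.isOpen_compl.preimage continuous_fst, ?_⟩
    ext ⟨x, t⟩
    have htI : t ∈ Icc (0 : ℝ) 1 → t ∈ Ioo (-1 : ℝ) 2 := fun ht =>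
      ⟨by linarith [ht.1], by linarith [ht.2]⟩
    constructor
    · rintro ⟨⟨ht, ⟨p, hp, hpt, rfl⟩ | ⟨j, τ, hτ, rfl⟩⟩, hxZ⟩
      · have hpz : p.2 < -D.z ∨ 1 + D.z < p.2 := by
          by_contra! hcon
          exact hxZ (Or.inl ⟨p, ⟨hp, hcon⟩, rfl⟩)
        have hX := hpt.eq_zero ht (D.X_lt_of_not_mem hpz)
        obtain ⟨j, hj⟩ := smoothFold_eq_zero D.c_pos.le D.c_lt hX
        have hbp : D.b p = D.γ j (D.e j p.2) := by
          rw [← D.edge_apply j p.2 hp.2, ← hj]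
        have hji : j = i := by
          by_contra hji
          exact hxZ (Or.inr (mem_iUnion₂.2 ⟨j, hji, _, hbp.symm⟩))
        subst hji
        refine ⟨?_, ht⟩
        rcases hpz with hpz | hpz
        · exact ⟨(t, D.e j p.2), ⟨htI ht, D.mem_wallArc_of_lt hp.2 hpz⟩, Prod.ext hbp.symm rfl⟩
        · refine ⟨(t, D.e j p.2 - edgeSign j), ⟨htI ht, D.mem_wallArc_of_gt hp.2 hpz⟩, ?_⟩
          exact Prod.ext ((D.γ_sub_edgeSign j _).trans hbp.symm) rfl
      · have hji : j = i := by
          by_contra hji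
          exact hxZ (Or.inr (mem_iUnion₂.2 ⟨j, hji, _, rfl⟩))
        subst hji
        exact ⟨⟨(t, D.w j τ), ⟨htI ht, D.w_mem_wallArc j hτ⟩, rfl⟩, ht⟩
    · rintro ⟨⟨⟨t', s⟩, ⟨ht', hs⟩, h⟩, ht⟩
      rw [Prod.mk.injEq] at h
      obtain ⟨rfl, rfl⟩ := h
      refine ⟨⟨ht, ?_⟩, ?_⟩
      · rcases D.exists_param i s with ⟨y, hy, h⟩ | ⟨τ, hτ, h⟩
        · refine Or.inl ⟨(edge i, y), D.edge_mem i hy, ?_, h.symm⟩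
          refine D.eqn_edge_of_lt (D.X_lt_of_not_mem ?_).le _
          rcases (D.not_mem_of_wallArc hs (D.edge_mem i hy) h.symm).2 with h | h
          · exact Or.inl h.1
          · exact Or.inr h.1
        · exact Or.inr ⟨i, τ, Ioo_subset_Icc_self hτ, h.symm⟩
      · rintro (⟨p, ⟨hp, hpz⟩, h⟩ | h)
        · rcases (D.not_mem_of_wallArc hs hp h).2 with h | h
          · exact not_lt.2 hpz.1 h.1
          · exact not_lt.2 hpz.2 h.1
        · obtain ⟨j, hji, s', h⟩ := mem_iUnion₂.1 h
          exact hji (D.isLink.injective j i _ _ h).1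

theorem isOpen_centerDom : IsOpen D.centerDom := by
  refine (isOpen_Ioo.prod isOpen_Ioo).inter ?_
  exact isOpen_lt continuous_const ((D.contDiff_X.continuous.comp continuous_fst).add
    (D.contDiff_X.continuous.comp continuous_snd))

theorem contDiffOn_height : ContDiffOn ℝ ∞ D.height D.centerDom := by
  have h1 : ContDiff ℝ ∞ fun p : ℝ × ℝ => D.X p.1 := D.contDiff_X.comp contDiff_fst
  have h2 : ContDiff ℝ ∞ fun p : ℝ × ℝ => D.X p.2 := D.contDiff_X.comp contDiff_snd
  refine h1.contDiffOn.div (h1.add h2).contDiffOn fun p hp => ?_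
  exact (D.η_pos.trans hp.2).ne'

theorem differentiableAt_height {p : ℝ × ℝ} (hp : p ∈ D.centerDom) :
    DifferentiableAt ℝ D.height p :=
  (D.contDiffOn_height.contDiffAt (D.isOpen_centerDom.mem_nhds hp)).differentiableAt (by simp)

theorem fderiv_centerMap {p : ℝ × ℝ} (hp : p ∈ D.centerDom) (w : ℝ × ℝ) :
    fderiv ℝ D.centerMap p w = (fderiv ℝ D.b p w, fderiv ℝ D.height p w) := by
  have h : HasFDerivAt D.centerMap _ p :=
    (D.differentiable_b p).hasFDerivAt.prodMk (D.differentiableAt_height hp).hasFDerivAt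
  rw [h.fderiv]
  rfl

theorem hasDerivAt_X_edge (i : Fin 2) : HasDerivAt D.X (edgeSign i) (edge i) := by
  refine (hasDerivAt_reflect (edgeSign i) (edge i)).congr_of_eventuallyEq ?_
  have h : ∀ᶠ x in nhds (edge i), reflect (edgeSign i) x < D.c := by
    refine (contDiff_reflect (edgeSign i)).continuous.continuousAt.eventually (gt_mem_nhds ?_)
    rw [edge, reflect_reflect]
    exact D.c_pos
  filter_upwards [h] with x hx
  rw [← D.X_reflect i, D.X_of_le hx.le]

theorem fderiv_height_of_fst {i : Fin 2} {p : ℝ × ℝ} (hp : p ∈ D.centerDom) (hpi : p.1 = edge i) :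
    fderiv ℝ D.height p (1, 0) = edgeSign i / D.X p.2 ∧ fderiv ℝ D.height p (0, 1) = 0 := by
  have hX : D.X p.1 = 0 := by rw [hpi, D.X_edge]
  have hY : 0 < D.X p.2 := by
    have := hp.2
    rw [hX, zero_add] at this
    exact D.η_pos.trans this
  constructor
  · have h1 := fderiv_apply_one_zero (D.differentiableAt_height hp)
    have h3 : HasDerivAt D.X (edgeSign i) p.1 := hpi ▸ D.hasDerivAt_X_edge i
    have h2 : HasDerivAt (fun s => D.height (s, p.2)) _ p.1 :=
      h3.div (h3.add_const (D.X p.2)) (by rw [hX, zero_add]; exact hY.ne')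
    rw [h1.unique h2, hX]
    field_simp
    ring
  · have h1 := fderiv_apply_zero_one (D.differentiableAt_height hp)
    have h2 : (fun s => D.height (p.1, s)) = fun _ => 0 := by
      funext s
      simp [height, hX]
    rw [h2] at h1
    exact h1.unique (hasDerivAt_const _ _)

theorem fderiv_height_of_snd {j : Fin 2} {p : ℝ × ℝ} (hp : p ∈ D.centerDom) (hpj : p.2 = edge j) :
    fderiv ℝ D.height p (0, 1) ≠ 0 := by
  have hY : D.X p.2 = 0 := by rw [hpj, D.X_edge]
  have hX : 0 < D.X p.1 := by
    have := hp.2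
    rw [hY, add_zero] at this
    exact D.η_pos.trans this
  have h1 := fderiv_apply_zero_one (D.differentiableAt_height hp)
  have h3 : HasDerivAt D.X (edgeSign j) p.2 := hpj ▸ D.hasDerivAt_X_edge j
  have h2 : HasDerivAt (fun s => D.height (p.1, s)) _ p.2 :=
    (hasDerivAt_const p.2 (D.X p.1)).div (h3.const_add (D.X p.1))
      (by rw [hY, add_zero]; exact hX.ne')
  rw [h1.unique h2, hY, add_zero, zero_mul, zero_sub]
  exact div_ne_zero (neg_ne_zero.2 (mul_ne_zero hX.ne' (edgeSign_ne_zero j)))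
    (pow_ne_zero 2 hX.ne')

/-- For X + Y > η the profile is the identity, so the equation is linear in t and can be solved. -/
theorem eqn_center_iff {p : ℝ × ℝ} (hp : p ∈ D.centerDom) (t : ℝ) :
    D.Eqn p t ↔ t = D.height p := by
  have h0 := D.η_pos.trans hp.2
  rw [Eqn, D.profile.eq_self _ hp.2.le, height, eq_div_iff h0.ne', eq_comm]

/-- A graph over the band is immersed and embedded because the band is, even where the fold is
critical. Only transversality at the ends needs derivatives of the height: level 0 means X = 0 and
level 1 means Y = 0, and at such points the height varies across the edge. -/
theorem isLocalParam_centerMap : IsLocalParam D.saddle D.centerMap D.centerDom := by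
  have hsq : ∀ p ∈ D.centerDom, p ∈ square D.ε := fun p hp => D.open_square_subset hp.1
  refine ⟨D.isOpen_centerDom, D.smooth.contDiffOn.prodMk D.contDiffOn_height,
    fun p hp => D.norm_eq_one p (hsq p hp), ?_, ?_, ?_, ?_⟩
  · intro p hp
    rw [injective_iff_map_eq_zero]
    intro w hw
    rw [D.fderiv_centerMap hp, Prod.mk_eq_zero] at hw
    exact (injective_iff_map_eq_zero _).1 (D.immersion p (hsq p hp)) w hw.1
  · have h1 : Topology.IsEmbedding (D.centerDom.domRestrict D.b) :=
      isEmbedding_domRestrict (isCompact_square D.ε) hsq D.smooth.continuous.continuousOn D.injOn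
    have h2 : Continuous (D.centerDom.domRestrict D.centerMap) :=
      continuousOn_iff_continuous_domRestrict.1
        (D.smooth.continuous.continuousOn.prodMk D.contDiffOn_height.continuousOn)
    exact Topology.IsEmbedding.of_comp h2 continuous_fst h1
  · refine D.exists_relOpen_of_band D.isOpen_centerDom (fun p hp => hp.1)
      (fun p hp => ⟨p, hp, rfl, fun _ => (D.eqn_center_iff hp _).2 rfl⟩) ?_
    intro p hp t _ hpt
    exact ⟨p, hp, Prod.ext rfl ((D.eqn_center_iff hp t).1 hpt).symm⟩
  · intro p hp hlvl
    have h0 := D.η_pos.trans hp.2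
    have hlvl' : D.height p = 0 ∨ D.height p = 1 := hlvl
    rcases hlvl' with h | h
    · rw [height, div_eq_zero_iff] at h
      obtain ⟨i, hi⟩ := smoothFold_eq_zero D.c_pos.le D.c_lt (h.resolve_right h0.ne')
      refine ⟨(1, 0), ?_⟩
      rw [D.fderiv_centerMap hp, (D.fderiv_height_of_fst hp hi).1]
      refine div_ne_zero (edgeSign_ne_zero i) ?_
      rw [hi, D.X_edge, zero_add] at h0
      exact h0.ne'
    · rw [height, div_eq_one_iff_eq h0.ne', left_eq_add] at h
      obtain ⟨j, hj⟩ := smoothFold_eq_zero D.c_pos.le D.c_lt h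
      refine ⟨(0, 1), ?_⟩
      rw [D.fderiv_centerMap hp]
      exact D.fderiv_height_of_snd hp hj

end BandSurgery

namespace BandSurgery

variable (D : BandSurgery)

/-! ### The oriented atlas of the saddle surface -/

/-- The charts of the saddle surface. -/
def charts : Set ((ℝ × ℝ → R4 × ℝ) × Set (ℝ × ℝ)) :=
  {c | (∃ i, c = (D.wallMap i, D.wallDom i)) ∨ (∃ i j, c = (D.cornerMap i j, D.cornerDom i j)) ∨
    c = (D.centerMap, D.centerDom)}

theorem isLocalParam_of_mem_charts : ∀ c ∈ D.charts, IsLocalParam D.saddle c.1 c.2 := by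
  rintro _ (⟨i, rfl⟩ | ⟨i, j, rfl⟩ | rfl)
  · exact D.isLocalParam_wallMap i
  · exact D.isLocalParam_cornerMap i j
  · exact D.isLocalParam_centerMap

/-- Points of the outer arcs, and of the band beyond z, lie on walls; the remaining ones lie over
the centre if X + Y > η and near a corner otherwise. -/
theorem exists_chart : ∀ x ∈ D.saddle, ∃ c ∈ D.charts, x ∈ c.1 '' c.2 := by
  rintro ⟨x, t⟩ ⟨ht, ⟨p, hp, hpt, rfl⟩ | ⟨i, τ, hτ, rfl⟩⟩
  · simp only at ht hpt
    have ht' : t ∈ Ioo (-1 : ℝ) 2 := ⟨by linarith [ht.1], by linarith [ht.2]⟩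
    have hX0 := hpt.nonneg ht.1
    by_cases hY : p.2 < -D.z ∨ 1 + D.z < p.2
    · have hX := hpt.eq_zero ht (D.X_lt_of_not_mem hY)
      obtain ⟨i, hi⟩ := smoothFold_eq_zero D.c_pos.le D.c_lt hX
      have hbp : D.b p = D.γ i (D.e i p.2) := by
        rw [← D.edge_apply i p.2 hp.2, ← hi]
      refine ⟨_, Or.inl ⟨i, rfl⟩, ?_⟩
      rcases hY with hY | hY
      · exact ⟨(t, D.e i p.2), ⟨ht', D.mem_wallArc_of_lt hp.2 hY⟩, Prod.ext hbp.symm rfl⟩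
      · refine ⟨(t, D.e i p.2 - edgeSign i), ⟨ht', D.mem_wallArc_of_gt hp.2 hY⟩, ?_⟩
        exact Prod.ext ((D.γ_sub_edgeSign i _).trans hbp.symm) rfl
    · push Not at hY
      have hzε := D.z_lt
      have hp2 : p.2 ∈ Ioo (-D.ε) (1 + D.ε) := ⟨by linarith [hY.1], by linarith [hY.2]⟩
      obtain ⟨i, x, hx, hpx⟩ := exists_reflect p.1
      obtain ⟨j, y, hy, hpy⟩ := exists_reflect p.2
      have hXx : D.X p.1 = D.X x := by rw [hpx, D.X_reflect]
      have hXy : D.X p.2 = D.X y := by rw [hpy, D.X_reflect]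
      rcases lt_or_ge D.η (D.X p.1 + D.X p.2) with hU | hU
      · have hx0 : 0 ≤ x := by
          rw [hXx] at hX0
          by_contra hcon
          have h1 := (D.X_lt_iff hx D.c_pos.le).2 (not_le.1 hcon)
          linarith
        have hp1 : p.1 ∈ Ioo (-D.ε) (1 + D.ε) := by
          rw [hpx]
          exact reflect_mem_Ioo i ⟨by linarith [D.ε_pos], by linarith [D.ε_pos]⟩
        have hpc : p ∈ D.centerDom := ⟨⟨hp1, hp2⟩, hU⟩
        exact ⟨_, Or.inr (Or.inr rfl), p, hpc,
          Prod.ext rfl ((D.eqn_center_iff hpc t).1 hpt).symm⟩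
      -- Here X = t k(U) ≤ η, and Y ≤ U ≤ η since X ≥ 0; both folded coordinates are thus below c,
      -- where the fold is the identity.
      · have hXη : D.X p.1 ≤ D.η := by
          rw [hpt]
          exact (mul_le_of_le_one_left (D.profile.nonneg _) ht.2).trans (D.profile.le_of_le hU)
        have hxη : x ≤ D.η := by
          rw [hXx, D.X_le_iff hx D.η_lt_c.le] at hXη
          exact hXη
        have hXx' : D.X x = x := D.X_of_le (hxη.trans D.η_lt_c.le)
        have hyη : y ≤ D.η := by
          have h1 : D.X p.2 ≤ D.η := by linarith
          rw [hXy, D.X_le_iff hy D.η_lt_c.le] at h1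
          exact h1
        have hXy' : D.X y = y := D.X_of_le (hyη.trans D.η_lt_c.le)
        rw [hXx, hXx'] at hX0
        have hym : y ∈ Ioo (-D.ε) (1 + D.ε) := by
          have := reflect_mem_Ioo j hp2
          rwa [hpy, reflect_reflect] at this
        rw [Eqn, hXx, hXx', hXy, hXy'] at hpt
        let u : ℝ × ℝ := (t, edgeSign i * edgeSign j * (x + y))
        have hi := edgeSign_mul_self i
        have hj := edgeSign_mul_self j
        have hU' : cornerU i j u = x + y := by
          simp only [cornerU, u]
          linear_combination (edgeSign j * edgeSign j) * (x + y) * hi + (x + y) * hj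
        have hcX : D.cornerX i j u = x := by
          rw [cornerX, hU']
          exact hpt.symm
        have hcY : D.cornerY i j u = y := by
          have := D.cornerX_add_cornerY i j u
          linarith
        refine ⟨_, Or.inr (Or.inl ⟨i, j, rfl⟩), u, ⟨ht', ?_, ?_⟩, ?_⟩
        · rw [hcX]
          exact ⟨by linarith [D.ε_pos], hxη.trans_lt D.η_lt_c⟩
        · rw [hcY]
          exact ⟨hym.1, hyη.trans_lt D.η_lt_c⟩
        · refine Prod.ext (congrArg D.b ?_) rfl
          rw [cornerPt, hcX, hcY, ← hpx, ← hpy]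
  · exact ⟨_, Or.inl ⟨i, rfl⟩, (t, D.w i τ),
      ⟨⟨by linarith [ht.1], by linarith [ht.2]⟩, D.w_mem_wallArc i hτ⟩, rfl⟩

theorem hasFDerivAt_prod_snd {h : ℝ → ℝ} {h' : ℝ} {u : ℝ × ℝ} (hh : HasDerivAt h h' u.2) :
    HasFDerivAt (fun v : ℝ × ℝ => (v.1, h v.2)) ((ContinuousLinearMap.fst ℝ ℝ ℝ).prod
      (h' • ContinuousLinearMap.snd ℝ ℝ ℝ)) u :=
  hasFDerivAt_fst.prodMk (hh.comp_hasFDerivAt u hasFDerivAt_snd)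

theorem hasDerivAt_e_reflect {i j : Fin 2} {v : ℝ}
    (hv : reflect (edgeSign j) (edgeSign i * edgeSign j * v) ∈ Ioo (-D.ε) (1 + D.ε)) :
    ∃ d, HasDerivAt (fun v => D.e i (reflect (edgeSign j) (edgeSign i * edgeSign j * v))) d v ∧
      0 < d := by
  obtain ⟨d, hd, hpos⟩ := D.deriv_e i _ hv
  refine ⟨edgeSign i * d, ?_, hpos⟩
  have h1 : HasDerivAt (fun v => edgeSign i * edgeSign j * v) (edgeSign i * edgeSign j) v := by
    simpa using (hasDerivAt_id v).const_mul (edgeSign i * edgeSign j)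
  have h2 := HasDerivAt.comp v (h := fun v => edgeSign i * edgeSign j * v)
    (hasDerivAt_reflect (edgeSign j) _) h1
  have h3 := HasDerivAt.comp v
    (h := fun v => reflect (edgeSign j) (edgeSign i * edgeSign j * v)) hd h2
  have h4 : d * (edgeSign j * (edgeSign i * edgeSign j)) = edgeSign i * d := by
    linear_combination edgeSign i * d * edgeSign_mul_self j
  rw [h4] at h3
  exact h3

theorem compatible_wall_wall {i j : Fin 2} {u v : ℝ × ℝ} (hu : u ∈ D.wallDom i)
    (hv : v ∈ D.wallDom j) (h : D.wallMap i u = D.wallMap j v) :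
    Compatible (D.wallMap i) (D.wallMap j) u v := by
  simp only [wallMap, Prod.mk.injEq] at h
  obtain ⟨rfl, -⟩ := D.isLink.injective i j _ _ h.1
  have h1 : u.2 = v.2 :=
    D.wallArc_inj (Ioo_subset_Icc_self hu.2) (Ioo_subset_Icc_self hv.2) h.1
  obtain rfl : u = v := Prod.ext h.2 h1
  exact Compatible.refl _ _

theorem compatible_corner_corner {i j i' j' : Fin 2} {u v : ℝ × ℝ} (hu : u ∈ D.cornerDom i j)
    (hv : v ∈ D.cornerDom i' j') (h : D.cornerMap i j u = D.cornerMap i' j' v) :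
    Compatible (D.cornerMap i j) (D.cornerMap i' j') u v := by
  obtain ⟨rfl, rfl, rfl⟩ := D.cornerMap_inj (Ioo_subset_Icc_self hu.2.1)
    (Ioo_subset_Icc_self hu.2.2) (Ioo_subset_Icc_self hv.2.1) (Ioo_subset_Icc_self hv.2.2) h
  exact Compatible.refl _ _

theorem compatible_center_center {u v : ℝ × ℝ} (hu : u ∈ D.centerDom) (hv : v ∈ D.centerDom)
    (h : D.centerMap u = D.centerMap v) : Compatible D.centerMap D.centerMap u v := by
  simp only [centerMap, Prod.mk.injEq] at h
  obtain rfl := D.injOn (D.open_square_subset hu.1) (D.open_square_subset hv.1) h.1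
  exact Compatible.refl _ _

/-- The transition map is `cornerPt`, with determinant k(U) = U > 0 on the overlap. -/
theorem compatible_corner_center {i j : Fin 2} {u v : ℝ × ℝ} (hu : u ∈ D.cornerDom i j)
    (hv : v ∈ D.centerDom) (h : D.cornerMap i j u = D.centerMap v) :
    Compatible (D.cornerMap i j) D.centerMap u v := by
  simp only [cornerMap, centerMap, Prod.mk.injEq] at h
  have h1 : D.cornerPt i j u = v :=
    D.injOn (D.cornerPt_mem_of_dom hu) (D.open_square_subset hv.1) h.1
  subst h1
  have hUeq : ∀ u ∈ D.cornerDom i j, D.X (D.cornerPt i j u).1 + D.X (D.cornerPt i j u).2 =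
      cornerU i j u := fun u hu => by
    rw [D.X_cornerPt_fst hu.2.1.2.le, D.X_cornerPt_snd hu.2.2.2.le, cornerX_add_cornerY]
  have hU : D.η < cornerU i j u := by
    rw [← hUeq u hu]
    exact hv.2
  refine Compatible.of_eventuallyEq ?_ (D.differentiable_cornerPt i j u).hasFDerivAt ?_ ?_
  · filter_upwards [(D.isOpen_cornerDom i j).mem_nhds hu,
      (contDiff_cornerU i j).continuous.continuousAt.eventually (lt_mem_nhds hU)] with u' hu' hU'
    refine Prod.ext rfl ?_
    have h0 := D.η_pos.trans hU'
    simp only [Function.comp, cornerMap, centerMap, height]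
    rw [hUeq u' hu', D.X_cornerPt_fst hu'.2.1.2.le, cornerX, D.profile.eq_self _ hU'.le,
      mul_div_cancel_right₀ _ h0.ne']
  · exact (D.differentiable_b _).prodMk (D.differentiableAt_height hv)
  · rw [det_fderiv_cornerPt, D.profile.eq_self _ hU.le]
    exact D.η_pos.trans hU

/-- Inside the band a wall point has X = 0 and Y < -η, whereas the centre requires X + Y > η. -/
theorem not_wall_center {i : Fin 2} {u v : ℝ × ℝ} (hu : u ∈ D.wallDom i) (hv : v ∈ D.centerDom) :
    D.wallMap i u ≠ D.centerMap v := by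
  intro h
  simp only [wallMap, centerMap, Prod.mk.injEq] at h
  obtain ⟨h1, h2⟩ := D.not_mem_of_wallArc hu.2 (D.open_square_subset hv.1) h.1.symm
  have h3 := D.X_lt_of_not_mem (y := v.2) (h2.imp And.left And.left)
  have h4 := hv.2
  rw [h1, D.X_edge, zero_add] at h4
  linarith [D.η_pos]

/-- On the overlap U < -η, so k vanishes and the corner chart follows the edge of the band. The
transition map fixes t and changes the other parameter by `e` and a reflection, with positive
derivative by the direction convention for `e`. -/
theorem compatible_corner_wall {i i' j : Fin 2} {u v : ℝ × ℝ} (hu : u ∈ D.cornerDom i' j)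
    (hv : v ∈ D.wallDom i) (h : D.cornerMap i' j u = D.wallMap i v) :
    Compatible (D.cornerMap i' j) (D.wallMap i) u v := by
  simp only [cornerMap, wallMap, Prod.mk.injEq] at h
  obtain ⟨h1, h2⟩ := D.not_mem_of_wallArc hv.2 (D.cornerPt_mem_of_dom hu) h.1
  obtain ⟨rfl, hX⟩ := reflect_eq_reflect (D.lt_half_of_cornerX hu.2.1) one_half_pos h1
  have hY : D.cornerY i' j u < -D.η := by
    have := D.X_lt_of_not_mem (y := (D.cornerPt i' j u).2) (h2.imp And.left And.left)
    rwa [D.X_cornerPt_snd hu.2.2.2.le] at this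
  have hU : cornerU i' j u < -D.η := by
    rw [← D.cornerX_add_cornerY, hX, zero_add]
    exact hY
  have hpt : ∀ u', cornerU i' j u' < -D.η →
      D.cornerPt i' j u' = (edge i', reflect (edgeSign j) (cornerU i' j u')) := by
    intro u' hu'
    simp [cornerPt, cornerX, cornerY, D.profile.eq_zero _ hu'.le, edge]
  have hmem : reflect (edgeSign j) (cornerU i' j u) ∈ Ioo (-D.ε) (1 + D.ε) := by
    apply reflect_mem_Ioo
    rw [← D.cornerX_add_cornerY, hX, zero_add]
    exact ⟨hu.2.2.1, hu.2.2.2.trans D.c_lt_one_add⟩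
  obtain ⟨d, hd, hpos⟩ := D.hasDerivAt_e_reflect (i := i') (j := j) (v := u.2) hmem
  -- The two parametrizations agree up to a period: δ is zero at the lower end of the edge and one
  -- period at the upper end.
  obtain ⟨δ, hδ, hγδ⟩ : ∃ δ : ℝ, v.2 = D.e i' (D.cornerPt i' j u).2 + δ ∧
      ∀ s, D.γ i' (s + δ) = D.γ i' s := by
    rcases h2 with ⟨-, h2⟩ | ⟨-, h2⟩
    · exact ⟨0, by rw [h2, add_zero], fun s => by rw [add_zero]⟩
    · exact ⟨-edgeSign i', by rw [h2, sub_eq_add_neg], fun s => by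
        rw [← sub_eq_add_neg, D.γ_sub_edgeSign]⟩
  have hφ := hasFDerivAt_prod_snd (hd.add_const δ)
  have hv' : v = (u.1, D.e i' (reflect (edgeSign j) (edgeSign i' * edgeSign j * u.2)) + δ) := by
    refine Prod.ext h.2.symm ?_
    rw [hδ, hpt u hU]
    rfl
  rw [hv']
  have hwall : Differentiable ℝ (D.wallMap i') :=
    (((D.isLink.smooth i').differentiable (by simp)).comp differentiable_snd).prodMk
      differentiable_fst
  refine Compatible.of_eventuallyEq (φ := fun v : ℝ × ℝ =>
    (v.1, D.e i' (reflect (edgeSign j) (edgeSign i' * edgeSign j * v.2)) + δ)) ?_ hφ (hwall _) ?_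
  · have hcont : Continuous fun u' => reflect (edgeSign j) (cornerU i' j u') :=
      (contDiff_reflect _).continuous.comp (contDiff_cornerU i' j).continuous
    filter_upwards [(contDiff_cornerU i' j).continuous.continuousAt.eventually (gt_mem_nhds hU),
      hcont.continuousAt.eventually (isOpen_Ioo.mem_nhds hmem)] with u' hu' hm'
    refine Prod.ext ?_ rfl
    simp only [Function.comp, cornerMap, wallMap]
    rw [hpt u' hu', D.edge_apply i' _ (Ioo_subset_Icc_self hm'), hγδ]
    rfl
  · rw [det_prod_real]
    simpa using hpos

theorem compatible_of_mem_charts : ∀ c ∈ D.charts, ∀ d ∈ D.charts, ∀ u ∈ c.2, ∀ v ∈ d.2,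
    c.1 u = d.1 v → Compatible c.1 d.1 u v := by
  rintro _ (⟨i, rfl⟩ | ⟨i, j, rfl⟩ | rfl) _ (⟨i', rfl⟩ | ⟨i', j', rfl⟩ | rfl) u hu v hv h
  · exact D.compatible_wall_wall hu hv h
  · exact (D.compatible_corner_wall hv hu h.symm).symm
  · exact absurd h (D.not_wall_center hu hv)
  · exact D.compatible_corner_wall hu hv h
  · exact D.compatible_corner_corner hu hv h
  · exact D.compatible_corner_center hu hv h
  · exact absurd h.symm (D.not_wall_center hv hu)
  · exact (D.compatible_corner_center hv hu h.symm).symm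
  · exact D.compatible_center_center hu hv h

/-- The link at the bottom of the saddle surface. -/
def bottomLink : OrientedLink := ⟨2, two_pos, D.γ, D.isLink⟩

theorem hasDerivAt_γ_e {i : Fin 2} {y d : ℝ} (hd : HasDerivAt (D.e i) d y) {s : ℝ}
    (h : D.γ i (D.e i y) = D.γ i s) :
    HasDerivAt (fun y => D.γ i (D.e i y)) (d • deriv (D.γ i) s) y := by
  rw [← D.isLink.deriv_eq h]
  exact HasDerivAt.scomp y
    ((D.isLink.smooth i).differentiable (by simp) (D.e i y)).hasDerivAt hd

theorem boundaryOriented_bottom :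
    ∀ c ∈ D.charts, BoundaryOriented D.bottomLink 0 c.1 c.2 := by
  rintro _ (⟨i, rfl⟩ | ⟨i, j, rfl⟩ | rfl)
  · have hγ : ContDiff ℝ ∞ fun u : ℝ × ℝ => D.γ i u.2 := (D.isLink.smooth i).comp contDiff_snd
    refine boundaryOriented_level hγ ?_
    intro u _ i' s _ h
    have h1 := fderiv_apply_zero_one (hγ.differentiable (by simp) u)
    have h2 : fderiv ℝ (fun u : ℝ × ℝ => D.γ i u.2) u (0, 1) = deriv (D.γ i) u.2 := h1.deriv.symm
    exact ⟨1, one_pos, by rw [h2, one_smul]; exact D.isLink.deriv_eq h⟩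
  · refine boundaryOriented_level (D.smooth.comp (D.contDiff_cornerPt i j)) ?_
    intro u hu i' s hu0 h
    have h' : D.b (D.cornerPt i j u) = D.γ i' s := h
    obtain ⟨h1, -⟩ := D.exists_int_of_eq (D.cornerPt_mem_of_dom hu) h'
    obtain ⟨rfl, hX⟩ := reflect_eq_reflect (D.lt_half_of_cornerX hu.2.1) one_half_pos h1
    have hpt : ∀ s, D.cornerPt i j (u.1, s) =
        (edge i, reflect (edgeSign j) (edgeSign i * edgeSign j * s)) := by
      intro s
      simp [cornerPt, cornerX, cornerY, hu0, edge, cornerU]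
    have hmem : ∀ s, D.cornerY i j (u.1, s) ∈ Ioo (-D.ε) D.c →
        reflect (edgeSign j) (edgeSign i * edgeSign j * s) ∈ Ioo (-D.ε) (1 + D.ε) := by
      intro s hs
      have h2 : D.cornerY i j (u.1, s) = edgeSign i * edgeSign j * s := by
        simp [cornerY, hu0, cornerU]
      rw [h2] at hs
      exact reflect_mem_Ioo j ⟨hs.1, hs.2.trans D.c_lt_one_add⟩
    obtain ⟨d, hd, hpos⟩ := D.hasDerivAt_e_reflect (hmem u.2 hu.2.2)
    have hbγ : ∀ s, D.cornerY i j (u.1, s) ∈ Ioo (-D.ε) D.c → D.b (D.cornerPt i j (u.1, s)) =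
        D.γ i (D.e i (reflect (edgeSign j) (edgeSign i * edgeSign j * s))) := by
      intro s hs
      rw [hpt, D.edge_apply i _ (Ioo_subset_Icc_self (hmem s hs))]
    have hγs : D.γ i (D.e i (reflect (edgeSign j) (edgeSign i * edgeSign j * u.2))) = D.γ i s :=
      (hbγ u.2 hu.2.2).symm.trans h'
    have h3 : HasDerivAt (fun s => D.b (D.cornerPt i j (u.1, s))) (d • deriv (D.γ i) s) u.2 := by
      have h4 := HasDerivAt.scomp u.2
        (h := fun v => D.e i (reflect (edgeSign j) (edgeSign i * edgeSign j * v)))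
        ((D.isLink.smooth i).differentiable (by simp) _).hasDerivAt hd
      rw [D.isLink.deriv_eq hγs] at h4
      refine h4.congr_of_eventuallyEq ?_
      have hc : Continuous fun s => D.cornerY i j (u.1, s) :=
        (D.contDiff_cornerY i j).continuous.comp (by fun_prop)
      filter_upwards [hc.continuousAt.eventually (isOpen_Ioo.mem_nhds hu.2.2)] with s hs
      exact hbγ s hs
    have h5 := fderiv_apply_zero_one
      ((D.differentiable_b.comp (D.differentiable_cornerPt i j)) u)
    refine ⟨d⁻¹, inv_pos.2 hpos, ?_⟩
    have h6 : fderiv ℝ (D.b ∘ D.cornerPt i j) u (0, 1) = d • deriv (D.γ i) s := h5.unique h3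
    change d⁻¹ • fderiv ℝ (D.b ∘ D.cornerPt i j) u (0, 1) = deriv (D.γ i) s
    rw [h6, smul_smul, inv_mul_cancel₀ hpos.ne', one_smul]
  · intro p hp (i : Fin 2) s h
    simp only [centerMap, Prod.mk.injEq] at h
    have h' : D.b p = D.γ i s := h.1
    have hpsq := D.open_square_subset hp.1
    obtain ⟨h1, -⟩ := D.exists_int_of_eq hpsq h'
    obtain ⟨h2, h3⟩ := D.fderiv_height_of_fst hp h1
    have hY : 0 < D.X p.2 := by
      have := hp.2
      rw [h1, D.X_edge, zero_add] at this
      exact D.η_pos.trans this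
    have hi := edgeSign_mul_self i
    obtain ⟨d, hd, hpos⟩ := D.deriv_e i p.2 hp.1.2
    have hd0 : d ≠ 0 := by
      rintro rfl
      simp at hpos
    have hγs : D.γ i (D.e i p.2) = D.γ i s := by
      rw [← D.edge_apply i p.2 hpsq.2, ← h1, ← h']
    have h4 : HasDerivAt (fun y => D.b (p.1, y)) (d • deriv (D.γ i) s) p.2 := by
      refine (D.hasDerivAt_γ_e hd hγs).congr_of_eventuallyEq ?_
      filter_upwards [isOpen_Ioo.mem_nhds hp.1.2] with y hy
      rw [h1, D.edge_apply i y (Ioo_subset_Icc_self hy)]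
    have h5 := (fderiv_apply_zero_one (D.differentiable_b p)).unique h4
    refine ⟨(edgeSign i, 0), (0, d⁻¹), ?_, ?_, ?_⟩
    · rw [D.fderiv_centerMap hp, map_prod_eq (fderiv ℝ D.height p), h2]
      simp only [zero_mul, add_zero, smul_eq_mul]
      rw [← mul_div_assoc, hi]
      exact one_div_pos.2 hY
    · rw [D.fderiv_centerMap hp, map_prod_eq (fderiv ℝ D.height p), map_prod_eq (fderiv ℝ D.b p),
        h3, h5]
      simp only [zero_smul, zero_add, smul_zero, smul_smul, inv_mul_cancel₀ hd0, one_smul]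
      rfl
    · simp only [zero_mul, sub_zero]
      rcases edgeSign_eq i with h | h <;> rw [h] at hpos ⊢
      · rw [one_mul] at hpos ⊢
        exact inv_pos.2 hpos
      · have : d < 0 := by linarith
        have := inv_lt_zero.2 this
        linarith

end BandSurgery

/-! ### Euler characteristic of the saddle surface -/

/-- The Euler characteristic of a pair of pants obtained from two rectangles, whose vertical sides
are glued crosswise: at levels below `1/2` the two sides of each rectangle are identified, at levels
above `1/2` each side is identified with that of the other rectangle. -/
theorem hasEulerChar_pants {F : Fin 2 → ℝ × ℝ → R4 × ℝ}
    (hF : ∀ i, ContinuousOn (F i) (Icc 0 1 ×ˢ Icc 0 1))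
    (hint : ∀ i i', ∀ t ∈ Icc (0 : ℝ) 1, ∀ t' ∈ Icc (0 : ℝ) 1, ∀ l ∈ Ioo (0 : ℝ) 1,
      ∀ l' ∈ Icc (0 : ℝ) 1, F i (t, l) = F i' (t', l') → t = t' ∧ i = i' ∧ l = l')
    (hside : ∀ i i' j j', ∀ t ∈ Icc (0 : ℝ) 1, ∀ t' ∈ Icc (0 : ℝ) 1,
      F i (t, edge j) = F i' (t', edge j') →
        t = t' ∧ (i = i' ∨ 1 / 2 ≤ t) ∧ (j = j' ∨ t ≤ 1 / 2))
    (hglue : ∀ i i' j j', ∀ t ∈ Icc (0 : ℝ) 1, (i = i' ∨ 1 / 2 ≤ t) → (j = j' ∨ t ≤ 1 / 2) →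
      F i (t, edge j) = F i' (t, edge j')) :
    HasEulerChar (⋃ i, F i '' (Icc 0 1 ×ˢ Icc 0 1)) (-1) := by
  have hI0 : (0 : ℝ) ∈ Icc (0 : ℝ) 1 := ⟨le_rfl, zero_le_one⟩
  have hI1 : (1 : ℝ) ∈ Icc (0 : ℝ) 1 := ⟨zero_le_one, le_rfl⟩
  have hI2 : (1 / 2 : ℝ) ∈ Icc (0 : ℝ) 1 := ⟨by norm_num, by norm_num⟩
  have hE : ∀ j, edge j ∈ Icc (0 : ℝ) 1 := fun j => by
    rcases edge_eq j with h | h <;> rw [h] <;> assumption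
  have hlow : ∀ s ∈ Icc (0 : ℝ) 1, s / 2 ∈ Icc (0 : ℝ) 1 := fun s hs =>
    ⟨by linarith [hs.1], by linarith [hs.2]⟩
  have hupp : ∀ s ∈ Icc (0 : ℝ) 1, (1 + s) / 2 ∈ Icc (0 : ℝ) 1 := fun s hs =>
    ⟨by linarith [hs.1], by linarith [hs.2]⟩
  have hne : ∀ i i' j, ∀ t ∈ Icc (0 : ℝ) 1, ∀ t' ∈ Icc (0 : ℝ) 1, ∀ l ∈ Ioo (0 : ℝ) 1,
      F i (t, l) ≠ F i' (t', edge j) := by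
    intro i i' j t ht t' ht' l hl h
    obtain ⟨-, -, h⟩ := hint i i' t ht t' ht' l hl _ (hE j) h
    rcases edge_eq j with h' | h' <;> rw [h'] at h
    · exact hl.1.ne' h
    · exact hl.2.ne h
  have hI : ∀ s ∈ Ioo (0 : ℝ) 1, s ∈ Icc (0 : ℝ) 1 := fun s hs => Ioo_subset_Icc_self hs
  -- All side midpoints at level 1/2 are one vertex, `none`. Each rectangle contributes one bottom
  -- vertex, its two lower corners being identified; each side index contributes one top vertex. The
  -- edges are, for each of two indices: a lower seam (0), an upper seam (1), a bottom circle (2)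
  -- and a top arc (3). In total 5 - 8 + 2 = -1.
  let v : Option (Fin 2 × Bool) → R4 × ℝ := fun a => match a with
    | none => F 0 (1 / 2, edge 0)
    | some (i, false) => F i (0, edge 0)
    | some (j, true) => F 0 (1, edge j)
  let e : Fin 2 × Fin 4 → ℝ → R4 × ℝ := fun b s => match b with
    | (i, 0) => F i (s / 2, edge 0)
    | (j, 1) => F 0 ((1 + s) / 2, edge j)
    | (i, 2) => F i (0, s)
    | (i, 3) => F i (1, s)
  have hvE : ∀ a, ∃ i j, ∃ t ∈ Icc (0 : ℝ) 1, v a = F i (t, edge j) := by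
    rintro (_ | ⟨i, _ | _⟩)
    · exact ⟨0, 0, _, hI2, rfl⟩
    · exact ⟨i, 0, _, hI0, rfl⟩
    · exact ⟨0, i, _, hI1, rfl⟩
  have hcorner : ∀ i j, ∃ a, v a = F i (0, edge j) := fun i j =>
    ⟨some (i, false), hglue _ _ _ _ 0 hI0 (Or.inl rfl) (Or.inr (by norm_num))⟩
  have hcorner' : ∀ i j, ∃ a, v a = F i (1, edge j) := fun i j =>
    ⟨some (j, true), hglue _ _ _ _ 1 hI1 (Or.inr (by norm_num)) (Or.inl rfl)⟩
  have hcenter : ∀ i j, ∃ a, v a = F i (1 / 2, edge j) := fun i j =>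
    ⟨none, hglue _ _ _ _ _ hI2 (Or.inr le_rfl) (Or.inr le_rfl)⟩
  have key := hasEulerChar_of_rectangles (S := ⋃ i, F i '' (Icc 0 1 ×ˢ Icc 0 1)) v e F
    ?_ hF ?_ ?_ ?_ ?_ ?_ ?_ ?_ ?_ ?_ ?_ rfl
  · convert key using 1
    simp [Fintype.card_option, Fintype.card_prod]
  · rintro ⟨i, b⟩
    fin_cases b
    · exact (hF i).comp (by fun_prop) fun s hs => ⟨hlow s hs, hE 0⟩
    · exact (hF 0).comp (by fun_prop) fun s hs => ⟨hupp s hs, hE i⟩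
    · exact (hF i).comp (by fun_prop) fun s hs => ⟨hI0, hs⟩
    · exact (hF i).comp (by fun_prop) fun s hs => ⟨hI1, hs⟩
  · rintro (_ | ⟨i, _ | _⟩) (_ | ⟨i', _ | _⟩) h
    · rfl
    · have := (hside _ _ _ _ _ hI2 _ hI0 h).1
      norm_num at this
    · have := (hside _ _ _ _ _ hI2 _ hI1 h).1
      norm_num at this
    · have := (hside _ _ _ _ _ hI0 _ hI2 h).1
      norm_num at this
    · obtain ⟨-, rfl | h, -⟩ := hside _ _ _ _ _ hI0 _ hI0 h
      · rfl
      · norm_num at h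
    · have := (hside _ _ _ _ _ hI0 _ hI1 h).1
      norm_num at this
    · have := (hside _ _ _ _ _ hI1 _ hI2 h).1
      norm_num at this
    · have := (hside _ _ _ _ _ hI1 _ hI0 h).1
      norm_num at this
    · obtain ⟨-, -, rfl | h⟩ := hside _ _ _ _ _ hI1 _ hI1 h
      · rfl
      · norm_num at h
  · rintro a ⟨i, b⟩ s hs h
    fin_cases b
    · rcases a with _ | ⟨i', _ | _⟩
      · linarith [(hside _ _ _ _ _ hI2 _ (hlow s (hI s hs)) h).1, hs.2]
      · linarith [(hside _ _ _ _ _ hI0 _ (hlow s (hI s hs)) h).1, hs.1]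
      · linarith [(hside _ _ _ _ _ hI1 _ (hlow s (hI s hs)) h).1, hs.2]
    · rcases a with _ | ⟨i', _ | _⟩
      · linarith [(hside _ _ _ _ _ hI2 _ (hupp s (hI s hs)) h).1, hs.1]
      · linarith [(hside _ _ _ _ _ hI0 _ (hupp s (hI s hs)) h).1, hs.1]
      · linarith [(hside _ _ _ _ _ hI1 _ (hupp s (hI s hs)) h).1, hs.2]
    · obtain ⟨i', j, t, ht, ha⟩ := hvE a
      exact hne _ _ _ _ hI0 _ ht s hs (h.symm.trans ha)
    · obtain ⟨i', j, t, ht, ha⟩ := hvE a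
      exact hne _ _ _ _ hI1 _ ht s hs (h.symm.trans ha)
  · rintro a i ⟨t, s⟩ ⟨ht, hs⟩ h
    obtain ⟨i', j, t', ht', ha⟩ := hvE a
    exact hne _ _ _ _ (hI t ht) _ ht' s hs (h.symm.trans ha)
  · rintro ⟨i, b⟩ ⟨i', b'⟩ s hs s' hs' h
    fin_cases b <;> fin_cases b'
    · obtain ⟨h1, rfl | h2, -⟩ := hside _ _ _ _ _ (hlow s (hI s hs)) _ (hlow s' (hI s' hs')) h
      · exact ⟨rfl, by linarith⟩
      · linarith [hs.2]
    · linarith [(hside _ _ _ _ _ (hlow s (hI s hs)) _ (hupp s' (hI s' hs')) h).1, hs.2, hs'.1]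
    · exact absurd h.symm (hne _ _ _ _ hI0 _ (hlow s (hI s hs)) s' hs')
    · exact absurd h.symm (hne _ _ _ _ hI1 _ (hlow s (hI s hs)) s' hs')
    · linarith [(hside _ _ _ _ _ (hupp s (hI s hs)) _ (hlow s' (hI s' hs')) h).1, hs.1, hs'.2]
    · obtain ⟨h1, -, rfl | h2⟩ := hside _ _ _ _ _ (hupp s (hI s hs)) _ (hupp s' (hI s' hs')) h
      · exact ⟨rfl, by linarith⟩
      · linarith [hs.1]
    · exact absurd h.symm (hne _ _ _ _ hI0 _ (hupp s (hI s hs)) s' hs')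
    · exact absurd h.symm (hne _ _ _ _ hI1 _ (hupp s (hI s hs)) s' hs')
    · exact absurd h (hne _ _ _ _ hI0 _ (hlow s' (hI s' hs')) s hs)
    · exact absurd h (hne _ _ _ _ hI0 _ (hupp s' (hI s' hs')) s hs)
    · obtain ⟨-, rfl, h2⟩ := hint _ _ _ hI0 _ hI0 s hs s' (hI s' hs') h
      exact ⟨rfl, h2⟩
    · exact absurd (hint _ _ _ hI0 _ hI1 s hs s' (hI s' hs') h).1 zero_ne_one
    · exact absurd h (hne _ _ _ _ hI1 _ (hlow s' (hI s' hs')) s hs)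
    · exact absurd h (hne _ _ _ _ hI1 _ (hupp s' (hI s' hs')) s hs)
    · exact absurd (hint _ _ _ hI1 _ hI0 s hs s' (hI s' hs') h).1 one_ne_zero
    · obtain ⟨-, rfl, h2⟩ := hint _ _ _ hI1 _ hI1 s hs s' (hI s' hs') h
      exact ⟨rfl, h2⟩
  · rintro ⟨i, b⟩ i' s hs ⟨t, l⟩ ⟨ht, hl⟩ h
    fin_cases b
    · exact absurd h.symm (hne _ _ _ _ (hI t ht) _ (hlow s (hI s hs)) l hl)
    · exact absurd h.symm (hne _ _ _ _ (hI t ht) _ (hupp s (hI s hs)) l hl)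
    · exact ht.1.ne (hint _ _ _ hI0 _ (hI t ht) s hs l (hI l hl) h).1
    · exact ht.2.ne' (hint _ _ _ hI1 _ (hI t ht) s hs l (hI l hl) h).1
  · rintro i i' ⟨t, l⟩ ⟨ht, hl⟩ ⟨t', l'⟩ ⟨ht', hl'⟩ h
    obtain ⟨rfl, rfl, rfl⟩ := hint _ _ _ (hI t ht) _ (hI t' ht') l hl l' (hI l' hl') h
    exact ⟨rfl, rfl⟩
  · rintro ⟨i, b⟩
    fin_cases b
    · refine ⟨?_, ?_⟩
      · obtain ⟨a, ha⟩ := hcorner i 0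
        exact ⟨a, by simpa [e] using ha⟩
      · obtain ⟨a, ha⟩ := hcenter i 0
        exact ⟨a, by simpa [e] using ha⟩
    · refine ⟨?_, ?_⟩
      · obtain ⟨a, ha⟩ := hcenter 0 i
        exact ⟨a, by simpa [e] using ha⟩
      · obtain ⟨a, ha⟩ := hcorner' 0 i
        exact ⟨a, by simpa [e, one_add_one_eq_two] using ha⟩
    · have h0 := hcorner i 0
      have h1 := hcorner i 1
      rw [edge_zero] at h0
      rw [edge_one] at h1
      exact ⟨h0, h1⟩
    · have h0 := hcorner' i 0
      have h1 := hcorner' i 1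
      rw [edge_zero] at h0
      rw [edge_one] at h1
      exact ⟨h0, h1⟩
  · rintro i ⟨t, l⟩ ⟨ht, hl⟩ hn
    simp only at ht hl
    by_cases hl' : l ∈ Ioo (0 : ℝ) 1
    · right
      by_cases h0 : t = 0
      · exact ⟨(i, 2), l, hl', by rw [h0]⟩
      · by_cases h1 : t = 1
        · exact ⟨(i, 3), l, hl', by rw [h1]⟩
        · exact absurd ⟨⟨lt_of_le_of_ne ht.1 (Ne.symm h0), lt_of_le_of_ne ht.2 h1⟩, hl'⟩ hn
    · obtain ⟨j, rfl⟩ : ∃ j, l = edge j := by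
        apply exists_edge
        by_contra hcon
        push Not at hcon
        exact hl' ⟨lt_of_le_of_ne hl.1 hcon.1.symm, lt_of_le_of_ne hl.2 hcon.2⟩
      rcases lt_trichotomy t (1 / 2) with h | h | h
      · rcases ht.1.eq_or_lt with h0 | h0
        · rw [← h0]
          exact Or.inl (hcorner i j)
        · refine Or.inr ⟨(i, 0), 2 * t, ⟨by linarith, by linarith⟩, ?_⟩
          change F i (2 * t / 2, edge 0) = _
          rw [mul_div_cancel_left₀ _ two_ne_zero]
          exact hglue _ _ _ _ t ht (Or.inl rfl) (Or.inr h.le)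
      · rw [h]
        exact Or.inl (hcenter i j)
      · rcases ht.2.eq_or_lt with h1 | h1
        · rw [h1]
          exact Or.inl (hcorner' i j)
        · refine Or.inr ⟨(j, 1), 2 * t - 1, ⟨by linarith, by linarith⟩, ?_⟩
          change F 0 ((1 + (2 * t - 1)) / 2, edge j) = _
          rw [add_sub_cancel, mul_div_cancel_left₀ _ two_ne_zero]
          exact hglue _ _ _ _ t ht (Or.inr h.le) (Or.inl rfl)
  · intro a
    obtain ⟨i, j, t, ht, h⟩ := hvE a
    rw [h]
    exact mem_iUnion.2 ⟨i, _, ⟨ht, hE j⟩, rfl⟩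
  · rintro ⟨i, b⟩ s hs
    fin_cases b
    · exact mem_iUnion.2 ⟨i, _, ⟨hlow s (hI s hs), hE 0⟩, rfl⟩
    · exact mem_iUnion.2 ⟨0, _, ⟨hupp s (hI s hs), hE i⟩, rfl⟩
    · exact mem_iUnion.2 ⟨i, _, ⟨hI0, hI s hs⟩, rfl⟩
    · exact mem_iUnion.2 ⟨i, _, ⟨hI1, hI s hs⟩, rfl⟩

namespace BandSurgery

variable (D : BandSurgery)

/-- The inverse of the smooth fold on `(-∞, 1/2]`. -/
def ζ : ℝ → ℝ := (exists_smoothFold_inverse D.c_lt).choose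

theorem continuous_ζ : Continuous D.ζ := (exists_smoothFold_inverse D.c_lt).choose_spec.1

theorem ζ_X {x : ℝ} (hx : x ≤ 1 / 2) : D.ζ (D.X x) = x :=
  (exists_smoothFold_inverse D.c_lt).choose_spec.2.1 x hx

theorem X_ζ {v : ℝ} (hv : v ≤ 1 / 2) : D.X (D.ζ v) = v :=
  ((exists_smoothFold_inverse D.c_lt).choose_spec.2.2 v hv).1

theorem ζ_le {v : ℝ} (hv : v ≤ 1 / 2) : D.ζ v ≤ 1 / 2 :=
  ((exists_smoothFold_inverse D.c_lt).choose_spec.2.2 v hv).2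

theorem ζ_half : D.ζ (1 / 2) = 1 / 2 := by
  conv_lhs => rw [← D.X_half]
  exact D.ζ_X le_rfl

theorem ζ_of_le {v : ℝ} (hv : v ≤ D.c) : D.ζ v = v := by
  conv_lhs => rw [← D.X_of_le hv]
  exact D.ζ_X (hv.trans D.c_lt.le)

/-- At the level `t`, the sum of the folded coordinates at the end of a quarter of the saddle. -/
def maxSum (t : ℝ) : ℝ := 1 / (2 * max t (1 - t))

theorem max_pos (t : ℝ) : 0 < max t (1 - t) := by
  rcases le_total t (1 / 2) with h | h
  · exact lt_max_of_lt_right (by linarith)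
  · exact lt_max_of_lt_left (by linarith)

theorem continuous_maxSum : Continuous maxSum :=
  continuous_const.div (by fun_prop) fun t => by have := max_pos t; positivity

theorem maxSum_of_le {t : ℝ} (ht : t ≤ 1 / 2) : (1 - t) * maxSum t = 1 / 2 := by
  rw [maxSum, max_eq_right (by linarith)]
  have : 1 - t ≠ 0 := by linarith
  field_simp

theorem maxSum_of_ge {t : ℝ} (ht : 1 / 2 ≤ t) : t * maxSum t = 1 / 2 := by
  rw [maxSum, max_eq_left (by linarith)]
  have : t ≠ 0 := by linarith
  field_simp

theorem half_le_maxSum {t : ℝ} (ht : t ∈ Icc (0 : ℝ) 1) : 1 / 2 ≤ maxSum t := by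
  rcases le_total t (1 / 2) with h | h
  · nlinarith [maxSum_of_le h, ht.1]
  · nlinarith [maxSum_of_ge h, ht.2]

/-- For U ≥ η the level curve is X = tU, Y = (1 - t)U, and both folded coordinates are bounded by
1/2. So `maxSum t` is where the curve reaches the middle line of the band. -/
theorem le_maxSum_iff {t U : ℝ} (ht : t ∈ Icc (0 : ℝ) 1) :
    U ≤ maxSum t ↔ t * U ≤ 1 / 2 ∧ (1 - t) * U ≤ 1 / 2 := by
  have h0 := half_le_maxSum ht
  rcases le_total t (1 / 2) with h | h
  · have h1 := maxSum_of_le h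
    constructor
    · intro hU
      constructor <;> nlinarith [ht.1]
    · rintro ⟨-, h2⟩
      exact le_of_mul_le_mul_left (h2.trans h1.ge) (by linarith)
  · have h1 := maxSum_of_ge h
    constructor
    · intro hU
      constructor <;> nlinarith [ht.2]
    · rintro ⟨h2, -⟩
      exact le_of_mul_le_mul_left (h2.trans h1.ge) (by linarith)

/-- The point at the level `t` of the quarter `(i, j)` of the band whose folded coordinates have
the sum `U`. -/
def quarterPt (i j : Fin 2) (t U : ℝ) : ℝ × ℝ :=
  (reflect (edgeSign i) (D.ζ (t * D.k U)), reflect (edgeSign j) (D.ζ (U - t * D.k U)))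

theorem mul_k_le {t U : ℝ} (ht : t ∈ Icc (0 : ℝ) 1) (hU : U ≤ maxSum t) :
    t * D.k U ≤ 1 / 2 ∧ U - t * D.k U ≤ 1 / 2 := by
  have h1 : D.η ≤ maxSum t := D.lt_half.le.trans (half_le_maxSum ht)
  have h2 := D.profile.mono hU
  have h3 := D.profile.mono_sub hU
  simp only [D.profile.eq_self _ h1] at h2 h3
  obtain ⟨h4, h5⟩ := (le_maxSum_iff ht).1 (le_refl (maxSum t))
  constructor <;> nlinarith [ht.1, ht.2]

theorem X_quarterPt {i j : Fin 2} {t U : ℝ} (ht : t ∈ Icc (0 : ℝ) 1) (hU : U ≤ maxSum t) :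
    D.X (D.quarterPt i j t U).1 = t * D.k U ∧ D.X (D.quarterPt i j t U).2 = U - t * D.k U := by
  obtain ⟨h1, h2⟩ := D.mul_k_le ht hU
  exact ⟨by rw [quarterPt, D.X_reflect, D.X_ζ h1], by rw [quarterPt, D.X_reflect, D.X_ζ h2]⟩

theorem eqn_quarterPt {i j : Fin 2} {t U : ℝ} (ht : t ∈ Icc (0 : ℝ) 1) (hU : U ≤ maxSum t) :
    D.Eqn (D.quarterPt i j t U) t := by
  obtain ⟨h1, h2⟩ := D.X_quarterPt (i := i) (j := j) ht hU
  rw [Eqn, h1, h2, add_sub_cancel]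

theorem mem_of_neg_le_X {x : ℝ} (hx : x ≤ 1 / 2) (h : -D.ε ≤ D.X x) :
    x ∈ Icc (-D.ε) (1 + D.ε) := by
  refine ⟨?_, by linarith [D.ε_pos]⟩
  by_contra hcon
  have := (D.X_lt_iff hx (by linarith [D.ε_pos, D.c_pos] : -D.ε ≤ D.c)).2 (not_le.1 hcon)
  linarith

theorem quarterPt_mem {i j : Fin 2} {t U : ℝ} (ht : t ∈ Icc (0 : ℝ) 1)
    (hU : U ∈ Icc (-D.ε) (maxSum t)) : D.quarterPt i j t U ∈ square D.ε := by
  obtain ⟨h1, h2⟩ := D.mul_k_le ht hU.2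
  have h3 := mul_nonneg ht.1 (D.profile.nonneg U)
  have h4 := D.profile.mono hU.1
  have h5 := D.profile.mono_sub hU.1
  have h6 := D.lt_margin
  simp only [D.profile.eq_zero (-D.ε) (by linarith)] at h4 h5
  refine ⟨reflect_mem_Icc i (D.mem_of_neg_le_X (D.ζ_le h1) ?_),
    reflect_mem_Icc j (D.mem_of_neg_le_X (D.ζ_le h2) ?_)⟩
  · rw [D.X_ζ h1]
    linarith [D.ε_pos]
  · rw [D.X_ζ h2]
    nlinarith [ht.2]

theorem exists_quarterPt {p : ℝ × ℝ} {t : ℝ} (hp : p ∈ square D.ε) (ht : t ∈ Icc (0 : ℝ) 1)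
    (h : D.Eqn p t) : ∃ i j, ∃ U ∈ Icc (-D.ε) (maxSum t), p = D.quarterPt i j t U := by
  obtain ⟨i, x, hx, hpx⟩ := exists_reflect p.1
  obtain ⟨j, y, hy, hpy⟩ := exists_reflect p.2
  have h0 := h.nonneg ht.1
  have h1 := D.neg_le_X hp.2
  unfold Eqn at h
  refine ⟨i, j, D.X p.1 + D.X p.2, ⟨by linarith, ?_⟩, ?_⟩
  · have h2 := D.X_le_half p.1
    have h3 := D.X_le_half p.2
    rcases le_or_gt (D.X p.1 + D.X p.2) D.η with h4 | h4
    · exact h4.trans (D.lt_half.le.trans (half_le_maxSum ht))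
    · rw [D.profile.eq_self _ h4.le] at h
      rw [le_maxSum_iff ht]
      exact ⟨by linarith, by linarith⟩
  · rw [quarterPt, ← h, add_sub_cancel_left, hpx, hpy, D.X_reflect, D.X_reflect, D.ζ_X hx,
      D.ζ_X hy, ← hpx, ← hpy]

/-- The level curve can meet x = 1/2 only for t ≥ 1/2 and y = 1/2 only for t ≤ 1/2, in both cases at
its end. -/
theorem maxSum_of_eq {t U : ℝ} (ht : t ∈ Icc (0 : ℝ) 1) (hU : U ≤ maxSum t) :
    (t * D.k U = 1 / 2 → U = maxSum t ∧ 1 / 2 ≤ t) ∧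
      (U - t * D.k U = 1 / 2 → U = maxSum t ∧ t ≤ 1 / 2) := by
  have hη := D.lt_half
  have hnn := D.profile.nonneg U
  rw [le_maxSum_iff ht] at hU
  rcases le_or_gt U D.η with h | h
  · have h1 := D.profile.le_of_le h
    constructor <;> intro h2 <;> nlinarith [ht.1, ht.2]
  · have hpos : 0 < U := D.η_pos.trans h
    rw [D.profile.eq_self U h.le]
    constructor <;> intro h2
    · have h3 : 1 / 2 ≤ t := by nlinarith
      refine ⟨mul_left_cancel₀ (by linarith : t ≠ 0) (h2.trans (maxSum_of_ge h3).symm), h3⟩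
    · have h3 : t ≤ 1 / 2 := by nlinarith
      refine ⟨mul_left_cancel₀ (by linarith : 1 - t ≠ 0) ?_, h3⟩
      rw [maxSum_of_le h3]
      linarith

/-- The folded coordinates determine U, and they determine the point up to reflections. A reflection
is visible unless its coordinate is 1/2, so different quarters meet only at their ends. -/
theorem quarterPt_inj {i j i' j' : Fin 2} {t U U' : ℝ} (ht : t ∈ Icc (0 : ℝ) 1)
    (hU : U ≤ maxSum t) (hU' : U' ≤ maxSum t)
    (h : D.quarterPt i j t U = D.quarterPt i' j' t U') :
    U = U' ∧ (i = i' ∨ U = maxSum t ∧ 1 / 2 ≤ t) ∧ (j = j' ∨ U = maxSum t ∧ t ≤ 1 / 2) := by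
  obtain ⟨h1, h2⟩ := D.X_quarterPt (i := i) (j := j) ht hU
  obtain ⟨h3, h4⟩ := D.X_quarterPt (i := i') (j := j') ht hU'
  rw [h] at h1 h2
  have hUU : U = U' := by linarith
  subst hUU
  refine ⟨rfl, ?_, ?_⟩
  · rcases (D.ζ_le (D.mul_k_le ht hU).1).lt_or_eq with hlt | heq
    · exact Or.inl (reflect_eq_reflect hlt hlt (congrArg Prod.fst h)).1
    · refine Or.inr ((D.maxSum_of_eq ht hU).1 ?_)
      rw [← D.X_ζ (D.mul_k_le ht hU).1, heq, D.X_half]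
  · rcases (D.ζ_le (D.mul_k_le ht hU).2).lt_or_eq with hlt | heq
    · exact Or.inl (reflect_eq_reflect hlt hlt (congrArg Prod.snd h)).1
    · refine Or.inr ((D.maxSum_of_eq ht hU).2 ?_)
      rw [← D.X_ζ (D.mul_k_le ht hU).2, heq, D.X_half]

theorem quarterPt_maxSum {i j i' j' : Fin 2} {t : ℝ} (ht : t ∈ Icc (0 : ℝ) 1)
    (hi : i = i' ∨ 1 / 2 ≤ t) (hj : j = j' ∨ t ≤ 1 / 2) :
    D.quarterPt i j t (maxSum t) = D.quarterPt i' j' t (maxSum t) := by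
  have h1 : D.k (maxSum t) = maxSum t := D.profile.eq_self _ (D.lt_half.le.trans (half_le_maxSum ht))
  have h2 : ∀ i, reflect (edgeSign i) (1 / 2) = 1 / 2 := fun i => by simp [reflect]
  rw [quarterPt, quarterPt, h1]
  congr 1
  · rcases hi with rfl | hi
    · rfl
    · rw [maxSum_of_ge hi, ζ_half, h2, h2]
  · rcases hj with rfl | hj
    · rfl
    · rw [← one_sub_mul, maxSum_of_le hj, ζ_half, h2, h2]

theorem quarterPt_neg_margin (i j : Fin 2) (t : ℝ) :
    D.quarterPt i j t (-D.ε) = (edge i, reflect (edgeSign j) (-D.ε)) := by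
  have h := D.lt_margin
  rw [quarterPt, D.profile.eq_zero _ (by linarith), mul_zero, sub_zero, D.ζ_of_le D.c_pos.le,
    D.ζ_of_le (by linarith [D.ε_pos, D.c_pos]), edge]

/-- The parameter along a quarter of the saddle. -/
def quarterSum (t l : ℝ) : ℝ := (1 - 3 * l) * maxSum t - 3 * l * D.ε

/-- The position of the half `i` of the saddle at the level `t`: a quarter of the band, the part of
the component `i` outside the band, and another quarter. -/
def halfPos (i : Fin 2) (q : ℝ × ℝ) : R4 :=
  if q.2 ≤ 1 / 3 then D.b (D.quarterPt i 0 q.1 (D.quarterSum q.1 q.2))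
  else if q.2 ≤ 2 / 3 then D.γ i (D.w i (3 * q.2 - 1))
  else D.b (D.quarterPt i 1 q.1 (D.quarterSum q.1 (1 - q.2)))

/-- One of the two rectangles that form the saddle. -/
def halfMap (i : Fin 2) (q : ℝ × ℝ) : R4 × ℝ := (D.halfPos i q, q.1)

theorem continuous_quarter (i j : Fin 2) {f : ℝ × ℝ → ℝ} (hf : Continuous f) :
    Continuous fun q : ℝ × ℝ => D.b (D.quarterPt i j q.1 (D.quarterSum q.1 (f q))) := by
  have h1 : Continuous fun q : ℝ × ℝ => D.quarterSum q.1 (f q) := by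
    have := continuous_maxSum.comp (continuous_fst (X := ℝ) (Y := ℝ))
    simp only [Function.comp_def] at this
    unfold quarterSum
    fun_prop
  have h2 : Continuous fun q : ℝ × ℝ => q.1 * D.k (D.quarterSum q.1 (f q)) :=
    continuous_fst.mul (D.profile.smooth.continuous.comp h1)
  exact D.smooth.continuous.comp
    (((contDiff_reflect _).continuous.comp (D.continuous_ζ.comp h2)).prodMk
      ((contDiff_reflect _).continuous.comp (D.continuous_ζ.comp (h1.sub h2))))

theorem quarterSum_third (t : ℝ) : D.quarterSum t (1 / 3) = -D.ε := by
  unfold quarterSum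
  ring

theorem reflect_one (x : ℝ) : reflect (edgeSign 1) x = 1 - x := by
  simp only [reflect, edgeSign, Matrix.cons_val_one]
  norm_num
  ring

theorem reflect_zero (x : ℝ) : reflect (edgeSign 0) x = x := by
  simp [reflect, edgeSign]

/-- The pieces fit at 1/3 and 2/3, where a quarter has reached the margin `-ε` and thus an end of
the outer arc. -/
theorem continuous_halfPos (i : Fin 2) : Continuous (D.halfPos i) := by
  refine Continuous.if_le (D.continuous_quarter i 0 continuous_snd) (Continuous.if_le ?_
    (D.continuous_quarter i 1 (continuous_const.sub continuous_snd)) continuous_snd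
      continuous_const ?_) continuous_snd continuous_const ?_
  · refine (D.isLink.smooth i).continuous.comp ?_
    unfold w
    fun_prop
  · rintro ⟨t, l⟩ h
    simp only at h
    subst h
    simp only
    rw [show (3 * (2 / 3) - 1 : ℝ) = 1 by norm_num, show (1 - 2 / 3 : ℝ) = 1 / 3 by norm_num,
      quarterSum_third, quarterPt_neg_margin, γ_w_one, reflect_one, sub_neg_eq_add]
  · rintro ⟨t, l⟩ h
    simp only at h
    subst h
    simp only
    rw [if_pos (by norm_num), show (3 * (1 / 3) - 1 : ℝ) = 0 by norm_num,
      quarterSum_third, quarterPt_neg_margin, γ_w_zero, reflect_zero]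

theorem halfPos_edge (i j : Fin 2) (t : ℝ) :
    D.halfPos i (t, edge j) = D.b (D.quarterPt i j t (maxSum t)) := by
  fin_cases j
  · simp only [Fin.zero_eta, edge_zero, halfPos]
    rw [if_pos (by norm_num), quarterSum]
    simp
  · simp only [Fin.mk_one, edge_one, halfPos]
    rw [if_neg (by norm_num), if_neg (by norm_num), quarterSum]
    simp

theorem quarterSum_mem {t l : ℝ} (ht : t ∈ Icc (0 : ℝ) 1) (hl : l ∈ Icc (0 : ℝ) (1 / 3)) :
    D.quarterSum t l ∈ Icc (-D.ε) (maxSum t) := by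
  have h1 := half_le_maxSum ht
  have h2 := D.ε_pos
  have h3 : D.quarterSum t l = maxSum t - 3 * l * (maxSum t + D.ε) := by unfold quarterSum; ring
  have h4 : 0 < maxSum t + D.ε := by linarith
  rw [h3]
  constructor <;> nlinarith [hl.1, hl.2]

theorem quarterSum_inj {t l l' : ℝ} (ht : t ∈ Icc (0 : ℝ) 1)
    (h : D.quarterSum t l = D.quarterSum t l') : l = l' := by
  have h1 := half_le_maxSum ht
  have h2 := D.ε_pos
  have h3 : 3 * (maxSum t + D.ε) * (l - l') = 0 := by unfold quarterSum at h; linarith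
  rcases mul_eq_zero.1 h3 with h | h <;> linarith

/-- The junctions are assigned to the outer arc; with r < 1/3 strictly, the quarters and the arc
become disjoint. -/
theorem halfPos_cases (i : Fin 2) {t l : ℝ} (hl : l ∈ Icc (0 : ℝ) 1) :
    (∃ j, ∃ r ∈ Ico (0 : ℝ) (1 / 3), l = reflect (edgeSign j) r ∧
      D.halfPos i (t, l) = D.b (D.quarterPt i j t (D.quarterSum t r))) ∨
    ∃ τ ∈ Icc (0 : ℝ) 1, l = (τ + 1) / 3 ∧ D.halfPos i (t, l) = D.γ i (D.w i τ) := by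
  rcases lt_or_ge l (1 / 3) with h | h
  · exact Or.inl ⟨0, l, ⟨hl.1, h⟩, (reflect_zero l).symm, if_pos h.le⟩
  · rcases le_or_gt l (2 / 3) with h' | h'
    · refine Or.inr ⟨3 * l - 1, ⟨by linarith, by linarith⟩, by ring, ?_⟩
      rcases h.eq_or_lt with rfl | h
      · unfold halfPos
        rw [if_pos (by norm_num), show (3 * (1 / 3) - 1 : ℝ) = 0 by norm_num,
          quarterSum_third, quarterPt_neg_margin, γ_w_zero, reflect_zero]
      · unfold halfPos
        rw [if_neg (not_le.2 h), if_pos h']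
    · refine Or.inl ⟨1, 1 - l, ⟨by linarith [hl.2], by linarith⟩, ?_, ?_⟩
      · rw [reflect_one]
        ring
      · unfold halfPos
        rw [if_neg (by simp only; linarith), if_neg (not_le.2 h')]

theorem neg_margin_lt_quarterSum {t r : ℝ} (ht : t ∈ Icc (0 : ℝ) 1) (hr : r ∈ Ico (0 : ℝ) (1 / 3)) :
    -D.ε < D.quarterSum t r := by
  refine lt_of_le_of_ne (D.quarterSum_mem ht ⟨hr.1, hr.2.le⟩).1 fun h => ?_
  rw [← D.quarterSum_third t] at h
  exact hr.2.ne (D.quarterSum_inj ht h).symm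

theorem quarter_ne_wall {i i' j : Fin 2} {t r τ : ℝ} (ht : t ∈ Icc (0 : ℝ) 1)
    (hr : r ∈ Ico (0 : ℝ) (1 / 3)) (hτ : τ ∈ Icc (0 : ℝ) 1) :
    D.b (D.quarterPt i j t (D.quarterSum t r)) ≠ D.γ i' (D.w i' τ) := by
  intro h
  have hU := D.quarterSum_mem ht ⟨hr.1, hr.2.le⟩
  obtain ⟨h1, h2⟩ := D.w_of_eq hτ (D.quarterPt_mem ht hU) h
  obtain ⟨h3, h4⟩ := D.X_quarterPt (i := i) (j := j) ht hU.2
  rw [h1, X_edge] at h3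
  have h5 : D.X (D.quarterPt i j t (D.quarterSum t r)).2 = -D.ε := by
    rcases h2 with ⟨h2, -⟩ | ⟨h2, -⟩ <;> rw [h2]
    · exact D.X_left
    · exact D.X_right
  linarith [D.neg_margin_lt_quarterSum ht hr]

theorem halfPos_inj {i i' : Fin 2} {t l l' : ℝ} (ht : t ∈ Icc (0 : ℝ) 1) (hl : l ∈ Icc (0 : ℝ) 1)
    (hl' : l' ∈ Icc (0 : ℝ) 1) (h : D.halfPos i (t, l) = D.halfPos i' (t, l')) :
    (i = i' ∧ l = l') ∨ ∃ j, l = edge j := by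
  rcases D.halfPos_cases i hl with ⟨j, r, hr, hlr, h1⟩ | ⟨τ, hτ, hlr, h1⟩ <;>
    rcases D.halfPos_cases i' hl' with ⟨j', r', hr', hlr', h1'⟩ | ⟨τ', hτ', hlr', h1'⟩ <;>
    rw [h1, h1'] at h
  · have hU := D.quarterSum_mem ht ⟨hr.1, hr.2.le⟩
    have hU' := D.quarterSum_mem ht ⟨hr'.1, hr'.2.le⟩
    obtain ⟨h2, h3, h4⟩ := D.quarterPt_inj ht hU.2 hU'.2
      (D.injOn (D.quarterPt_mem ht hU) (D.quarterPt_mem ht hU') h)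
    have hrr := D.quarterSum_inj ht h2
    by_cases hm : D.quarterSum t r = maxSum t
    · have h0 : D.quarterSum t 0 = maxSum t := by simp [quarterSum]
      have hr0 : r = 0 := D.quarterSum_inj ht (hm.trans h0.symm)
      rw [hr0] at hlr
      exact Or.inr ⟨j, hlr⟩
    · simp only [hm, false_and, or_false] at h3 h4
      exact Or.inl ⟨h3, by rw [hlr, hlr', h4, hrr]⟩
  · exact absurd h (D.quarter_ne_wall ht hr hτ')
  · exact absurd h.symm (D.quarter_ne_wall ht hr' hτ)
  · obtain ⟨h2, h3⟩ := D.w_eq hτ hτ' h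
    exact Or.inl ⟨h2, by rw [hlr, hlr', h3]⟩

theorem saddle_eq_iUnion : D.saddle = ⋃ i, D.halfMap i '' (Icc 0 1 ×ˢ Icc 0 1) := by
  ext ⟨x, t⟩
  simp only [mem_iUnion, mem_image, Prod.exists, mem_prod, halfMap, Prod.mk.injEq]
  constructor
  · rintro ⟨ht, ⟨p, hp, hpt, rfl⟩ | ⟨i, τ, hτ, rfl⟩⟩
    · simp only at ht hpt
      obtain ⟨i, j, U, hU, rfl⟩ := D.exists_quarterPt hp ht hpt
      have h1 := half_le_maxSum ht
      have h2 := D.ε_pos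
      have h3 : 0 < maxSum t + D.ε := by linarith
      -- This parameter solves `quarterSum t r = U`, which is affine in r.
      have hr : (maxSum t - U) / (maxSum t + D.ε) / 3 ∈ Icc (0 : ℝ) (1 / 3) := by
        refine ⟨by have := sub_nonneg.2 hU.2; positivity, ?_⟩
        have := (div_le_one h3).2 (by linarith [hU.1] : maxSum t - U ≤ maxSum t + D.ε)
        linarith
      have hUr : D.quarterSum t ((maxSum t - U) / (maxSum t + D.ε) / 3) = U := by
        unfold quarterSum
        field_simp
        ring
      set r := (maxSum t - U) / (maxSum t + D.ε) / 3
      fin_cases j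
      · refine ⟨i, t, r, ⟨ht, hr.1, by linarith [hr.2]⟩, ?_, rfl⟩
        unfold halfPos
        rw [if_pos hr.2, hUr]
        rfl
      · refine ⟨i, t, 1 - r, ⟨ht, by linarith [hr.2], by linarith [hr.1]⟩, ?_, rfl⟩
        rcases hr.2.eq_or_lt with h | h
        · unfold halfPos
          rw [if_neg (by simp only; linarith), if_pos (by simp only; linarith)]
          simp only [h]
          rw [h, quarterSum_third] at hUr
          rw [← hUr, show (3 * (1 - 1 / 3) - 1 : ℝ) = 1 by norm_num, Fin.mk_one,
            quarterPt_neg_margin, γ_w_one, reflect_one, sub_neg_eq_add]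
        · unfold halfPos
          rw [if_neg (by simp only; linarith), if_neg (by simp only; linarith)]
          simp only [sub_sub_cancel, hUr]
          rfl
    · refine ⟨i, t, (τ + 1) / 3, ⟨ht, by linarith [hτ.1], by linarith [hτ.2]⟩, ?_, rfl⟩
      rcases hτ.1.eq_or_lt with h | h
      · unfold halfPos
        rw [if_pos (by simp only; linarith), ← h]
        simp only [zero_add, quarterSum_third, quarterPt_neg_margin, γ_w_zero, reflect_zero]
      · unfold halfPos
        rw [if_neg (by simp only; linarith), if_pos (by simp only; linarith [hτ.2])]
        simp only
        congr 2
        ring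
  · rintro ⟨i, t, l, ⟨ht, hl⟩, rfl, rfl⟩
    refine ⟨ht, ?_⟩
    rcases D.halfPos_cases i hl with ⟨j, r, hr, hlr, h⟩ | ⟨τ, hτ, hlr, h⟩
    · have hU := D.quarterSum_mem ht ⟨hr.1, hr.2.le⟩
      exact Or.inl ⟨_, D.quarterPt_mem ht hU, D.eqn_quarterPt ht hU.2, h.symm⟩
    · exact Or.inr ⟨i, τ, hτ, h.symm⟩

theorem continuous_halfMap (i : Fin 2) : Continuous (D.halfMap i) :=
  (D.continuous_halfPos i).prodMk continuous_fst

/-- Below level 1/2 the two ends of each half meet, closing up two circles; above it the ends of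
different halves meet, forming a single circle. This is the crosswise gluing of two rectangles. -/
theorem hasEulerChar_saddle : HasEulerChar D.saddle (-1) := by
  rw [saddle_eq_iUnion]
  refine hasEulerChar_pants (fun i => (D.continuous_halfMap i).continuousOn) ?_ ?_ ?_
  · intro i i' t ht t' ht' l hl l' hl' h
    simp only [halfMap, Prod.mk.injEq] at h
    obtain ⟨h, rfl⟩ := h
    rcases D.halfPos_inj ht (Ioo_subset_Icc_self hl) hl' h with h | ⟨j, rfl⟩
    · exact ⟨rfl, h⟩
    · rcases edge_eq j with h' | h' <;> rw [h'] at hl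
      · exact absurd hl.1 (lt_irrefl _)
      · exact absurd hl.2 (lt_irrefl _)
  · intro i i' j j' t ht t' ht' h
    simp only [halfMap, Prod.mk.injEq, halfPos_edge] at h
    obtain ⟨h, rfl⟩ := h
    have hU : maxSum t ∈ Icc (-D.ε) (maxSum t) :=
      ⟨by linarith [half_le_maxSum ht, D.ε_pos], le_rfl⟩
    have := D.quarterPt_inj ht le_rfl le_rfl
      (D.injOn (D.quarterPt_mem ht hU) (D.quarterPt_mem ht hU) h)
    exact ⟨rfl, this.2.1.imp id And.right, this.2.2.imp id And.right⟩
  · intro i i' j j' t ht hi hj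
    simp only [halfMap, halfPos_edge, D.quarterPt_maxSum ht hi hj]

/-- The saddle is a cobordism from the link to the result of the band surgery, up to orientation. -/
theorem isCobordism_saddle {K : OrientedLink} (hK : K.IsKnot)
    (h : K.carrier = ((⋃ i, range (D.γ i)) \ D.b '' square D.ε) ∪
      D.b '' {p ∈ square D.ε | D.Eqn p 1}) :
    IsCobordism D.saddle D.bottomLink K ∨ IsCobordism D.saddle D.bottomLink.reverse K := by
  have hF : ∀ i, ContinuousOn (D.halfMap i) (Icc 0 1 ×ˢ Icc 0 1) := fun i =>
    (D.continuous_halfMap i).continuousOn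
  refine isCobordism_or_reverse hK (isCompact_of_sweep hF D.saddle_eq_iUnion) (fun x hx => hx.1)
    D.isLocalParam_of_mem_charts D.exists_chart D.compatible_of_mem_charts
    D.boundaryOriented_bottom D.saddle_bottom (D.saddle_top.trans h.symm)
    (components_of_sweep hF (fun _ _ _ => rfl) D.saddle_eq_iUnion)

end BandSurgery

/-! ### The boundary of an annulus -/

/-- The closed curve γ embeds the compact circle ℝ/ℤ, so β is a path in that circle and lifts
through the covering by ℝ. -/
theorem exists_lift_of_mem_range {γ : ℝ → R4} (hγ : Continuous γ) (hper : ∀ t, γ (t + 1) = γ t)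
    (hinj : ∀ s t, γ s = γ t → ∃ k : ℤ, t = s + k) {β : ℝ → R4} {l r : ℝ} (hlr : l < r)
    (hβ : ContinuousOn β (Icc l r)) (hr : ∀ y ∈ Icc l r, β y ∈ range γ) :
    ∃ s : ℝ → ℝ, ContinuousOn s (Icc l r) ∧ ∀ y ∈ Icc l r, γ (s y) = β y := by
  have : Fact ((0 : ℝ) < 1) := ⟨one_pos⟩
  let Γ : AddCircle (1 : ℝ) → R4 := Function.Periodic.lift (f := γ) hper
  have hΓcoe : ∀ x : ℝ, Γ (x : AddCircle (1 : ℝ)) = γ x := fun x => rfl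
  have hΓ : Continuous Γ := continuous_coinduced_dom.2 hγ
  have hΓinj : Function.Injective Γ := by
    intro x y
    induction x using QuotientAddGroup.induction_on with | _ x
    induction y using QuotientAddGroup.induction_on with | _ y
    intro h
    obtain ⟨k, rfl⟩ := hinj x y h
    change ((x : ℝ) : AddCircle (1 : ℝ)) = ((x + k : ℝ) : AddCircle (1 : ℝ))
    rw [AddCircle.coe_add]
    have : ((k : ℝ) : AddCircle (1 : ℝ)) = 0 := (AddCircle.coe_eq_zero_iff 1).2 ⟨k, by simp⟩
    rw [this, add_zero]
  have hemb := (hΓ.isClosedEmbedding hΓinj).isEmbedding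
  choose! u hu using hr
  have hθ : ContinuousOn (fun y => ((u y : ℝ) : AddCircle (1 : ℝ))) (Icc l r) := by
    rw [hemb.isInducing.continuousOn_iff]
    exact hβ.congr fun y hy => hu y hy
  have hmem : ∀ x : unitInterval, l + x * (r - l) ∈ Icc l r := fun x =>
    ⟨by nlinarith [x.2.1], by nlinarith [x.2.2]⟩
  let path : C(unitInterval, AddCircle (1 : ℝ)) :=
    ⟨fun x => ((u (l + x * (r - l)) : ℝ) : AddCircle (1 : ℝ)),
      hθ.comp_continuous (by fun_prop) hmem⟩
  obtain ⟨lift, hlift, -⟩ := (AddCircle.isCoveringMap_coe (1 : ℝ)).exists_path_lifts path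
    (u (l + (0 : unitInterval) * (r - l))) rfl
  refine ⟨fun y => lift (projIcc 0 1 zero_le_one ((y - l) / (r - l))),
    (lift.continuous.comp (continuous_projIcc.comp (by fun_prop))).continuousOn, fun y hy => ?_⟩
  have hd : 0 < r - l := sub_pos.2 hlr
  have hy' : (y - l) / (r - l) ∈ Icc (0 : ℝ) 1 :=
    ⟨div_nonneg (sub_nonneg.2 hy.1) hd.le, (div_le_one hd).2 (by linarith [hy.2])⟩
  simp only [projIcc_of_mem zero_le_one hy']
  have h1 := congrFun hlift ⟨_, hy'⟩
  simp only [Function.comp_apply, path, ContinuousMap.coe_mk] at h1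
  rw [← hΓcoe, h1, hΓcoe]
  have : l + (y - l) / (r - l) * (r - l) = y := by field_simp; ring
  rw [this]
  exact hu y hy

theorem edge_mem_Icc (i : Fin 2) : edge i ∈ Icc (0 : ℝ) 1 := by
  rcases edge_eq i with h | h <;> rw [h] <;> norm_num

theorem edge_inj {i j : Fin 2} (h : edge i = edge j) : i = j := by
  fin_cases i <;> fin_cases j <;> simp [edge_zero, edge_one] at h ⊢

theorem annulusBdry_eq (a : ℝ × ℝ → R4) :
    annulusBdry a = ⋃ i, range fun s => a (s, edge i) := by
  ext x
  simp only [annulusBdry, mem_image, mem_prod, mem_univ, true_and, mem_insert_iff,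
    mem_singleton_iff, Prod.exists, mem_iUnion, mem_range]
  constructor
  · rintro ⟨s, r, hr, rfl⟩
    obtain ⟨i, rfl⟩ := exists_edge hr
    exact ⟨i, s, rfl⟩
  · rintro ⟨i, s, rfl⟩
    exact ⟨s, edge i, edge_eq i, rfl⟩

namespace IsAnnulus

variable {a : ℝ × ℝ → R4} (ha : IsAnnulus a)
include ha

theorem continuous_circle (r : ℝ) : Continuous fun s => a (s, r) :=
  ha.smooth.continuous.comp (by fun_prop)

theorem isCompact_circle (r : ℝ) : IsCompact (range fun s => a (s, r)) := by
  have : (range fun s => a (s, r)) = (fun s => a (s, r)) '' Icc 0 1 := by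
    refine Subset.antisymm ?_ (image_subset_range _ _)
    have hper : Function.Periodic (fun s => a (s, r)) 1 := fun s => ha.periodic s r
    have := hper.image_Icc one_pos 0
    rw [zero_add] at this
    exact this.ge
  rw [this]
  exact isCompact_Icc.image (ha.continuous_circle r)

theorem disjoint_circle {i j : Fin 2} (hij : i ≠ j) :
    Disjoint (range fun s => a (s, edge i)) (range fun s => a (s, edge j)) := by
  rw [Set.disjoint_left]
  rintro _ ⟨s, rfl⟩ ⟨s', h⟩
  exact hij (edge_inj (ha.injective s' s _ (edge_mem_Icc j) _ (edge_mem_Icc i) h).1).symm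

/-- The boundary circles of an annulus, with orientations, form a link. -/
theorem isLink {n : ℕ} {ρ : Fin n → Fin 2} (hρ : Function.Injective ρ) {μ : Fin n → ℝ}
    (hμ : ∀ i, μ i = 1 ∨ μ i = -1) : IsLink fun i s => a (μ i * s, edge (ρ i)) := by
  have hper : ∀ s r, a (s - 1, r) = a (s, r) := fun s r => by
    rw [← ha.periodic, sub_add_cancel]
  refine ⟨fun i => ha.smooth.comp (by fun_prop), fun i t => ?_, fun i t =>
    ha.norm_eq_one _ _ (edge_mem_Icc _), fun i t h => ?_, fun i j s t h => ?_⟩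
  · rcases hμ i with h | h
    · simp only [h, one_mul, ha.periodic]
    · simp only [h]
      rw [← hper (-1 * t)]
      congr 2
      ring
  · have h1 : HasDerivAt (fun s : ℝ => ((μ i * s, edge (ρ i)) : ℝ × ℝ)) (μ i, 0) t :=
      ((hasDerivAt_id t).const_mul (μ i)).prodMk (hasDerivAt_const t _) |>.congr_deriv (by simp)
    have h2 := ((ha.smooth.differentiable (by simp)) (μ i * t, edge (ρ i))).hasFDerivAt.comp_hasDerivAt
      t h1
    have h3 := h2.deriv
    simp only [Function.comp_def] at h3
    rw [h3] at h
    have h4 := ha.immersion _ _ (edge_mem_Icc (ρ i)) (h.trans (map_zero _).symm)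
    have h5 : μ i = 0 := congrArg Prod.fst h4
    rcases hμ i with h | h <;> rw [h] at h5 <;> norm_num at h5
  · obtain ⟨h1, k, hk⟩ := ha.injective _ _ _ (edge_mem_Icc _) _ (edge_mem_Icc _) h
    obtain rfl := hρ (edge_inj h1)
    refine ⟨rfl, ?_⟩
    rcases hμ i with h | h <;> rw [h] at hk
    · exact ⟨k, by linarith⟩
    · exact ⟨-k, by push_cast; linarith⟩

end IsAnnulus

/-! ### The edges of a band -/

theorem edge_mem_square {ε : ℝ} (hε : 0 < ε) (i : Fin 2) {y : ℝ} (hy : y ∈ Icc (-ε) (1 + ε)) :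
    ((edge i, y) : ℝ × ℝ) ∈ square ε := by
  have := edge_mem_Icc i
  exact ⟨⟨by linarith [this.1], by linarith [this.2]⟩, hy⟩

namespace IsBand

variable {a b : ℝ × ℝ → R4} {ε : ℝ} (hb : IsBand a b ε) (ha : IsAnnulus a)
include hb ha

/-- An edge of the band is connected and lies in the union of two disjoint closed circles. -/
theorem exists_circle (i : Fin 2) :
    ∃ r : Fin 2, ∀ y ∈ Icc (-ε) (1 + ε), b (edge i, y) ∈ range fun s => a (s, edge r) := by
  have hpre : IsPreconnected ((fun y => b (edge i, y)) '' Icc (-ε) (1 + ε)) :=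
    isPreconnected_Icc.image _ (hb.smooth.continuous.comp (by fun_prop)).continuousOn
  rw [isPreconnected_iff_subset_of_disjoint_closed] at hpre
  have := hpre _ _ (ha.isCompact_circle (edge 0)).isClosed (ha.isCompact_circle (edge 1)).isClosed
    ?_ ?_
  · rcases this with h | h
    · exact ⟨0, fun y hy => h (mem_image_of_mem _ hy)⟩
    · exact ⟨1, fun y hy => h (mem_image_of_mem _ hy)⟩
  · rintro _ ⟨y, hy, rfl⟩
    have h1 := (hb.bdry _ (edge_mem_square hb.margin_pos i hy)).2 (edge_eq i)
    rw [annulusBdry_eq, mem_iUnion, Fin.exists_fin_two] at h1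
    exact h1
  · rw [(ha.disjoint_circle zero_ne_one).inter_eq, inter_empty]

/-- If the result of the band surgery is connected, the two edges of the band lie on different
boundary circles of the annulus. -/
theorem circle_ne {g : ℝ → ℝ} (hg : IsRounding ε g) (hconn : IsPreconnected (surgeredBdry a b ε g))
    {r r' : Fin 2} (h : ∀ y ∈ Icc (-ε) (1 + ε), b (edge 0, y) ∈ range fun s => a (s, edge r))
    (h' : ∀ y ∈ Icc (-ε) (1 + ε), b (edge 1, y) ∈ range fun s => a (s, edge r')) : r ≠ r' := by
  rintro rfl
  have hq : ∃ q : Fin 2, q ≠ r := ⟨r + 1, by fin_cases r <;> simp⟩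
  obtain ⟨q, hq⟩ := hq
  have hdisj : ∀ p ∈ square ε, b p ∉ range fun s => a (s, edge q) := by
    intro p hp hpq
    have h1 : b p ∈ annulusBdry a := by
      rw [annulusBdry_eq]
      exact mem_iUnion.2 ⟨q, hpq⟩
    obtain ⟨i, hi⟩ := exists_edge ((hb.bdry p hp).1 h1)
    have h2 : b p ∈ range fun s => a (s, edge r) := by
      have : p = (edge i, p.2) := Prod.ext hi rfl
      rw [this]
      fin_cases i
      · exact h _ hp.2
      · exact h' _ hp.2
    exact Set.disjoint_left.1 (ha.disjoint_circle hq) hpq h2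
  have hclosed : IsClosed (b '' bandCurve ε g) := by
    have h1 : IsClosed {p : ℝ × ℝ | fold p.1 - fold p.2 = g (fold p.1 + fold p.2)} := by
      have hf : Continuous fold := by unfold fold; fun_prop
      exact isClosed_eq (by fun_prop) (hg.1.continuous.comp (by fun_prop))
    exact (((BandSurgery.isCompact_square ε).inter_right h1).image hb.smooth.continuous).isClosed
  -- If both edges were on circle r, the band would miss circle q, and q would be separated from the
  -- rest of the surgered curve. The rest is nonempty: it contains the midpoint (1/2, 0) of a free
  -- side.
  rw [isPreconnected_iff_subset_of_disjoint_closed] at hconn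
  have hcover := hconn _ _ (ha.isCompact_circle (edge q)).isClosed
    ((ha.isCompact_circle (edge r)).isClosed.union hclosed) ?_ ?_
  · rcases hcover with hs | hs
    · obtain ⟨η, hη, hη', habs⟩ := hg.2.2
      have hε := hb.margin_pos
      have hp : ((1 / 2, 0) : ℝ × ℝ) ∈ bandCurve ε g := by
        refine ⟨⟨⟨by simp only; linarith, by simp only; linarith⟩,
          ⟨by simp only; linarith, by simp only; linarith⟩⟩, ?_⟩
        have h1 : fold (1 / 2) = 1 / 2 := by norm_num [fold]
        have h2 : fold 0 = 0 := by norm_num [fold]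
        simp only [h1, h2, sub_zero, add_zero]
        rw [habs _ (by rw [abs_of_pos (by norm_num)]; exact hη'.le), abs_of_pos (by norm_num)]
      exact hdisj _ hp.1 (hs (Or.inr (mem_image_of_mem b hp)))
    · have h1 : a (0, edge q) ∈ surgeredBdry a b ε g := by
        refine Or.inl ⟨?_, ?_⟩
        · rw [annulusBdry_eq]
          exact mem_iUnion.2 ⟨q, 0, rfl⟩
        · rintro ⟨p, hp, hpq⟩
          exact hdisj p hp ⟨0, hpq.symm⟩
      rcases hs h1 with h2 | ⟨p, hp, hpq⟩
      · exact Set.disjoint_left.1 (ha.disjoint_circle hq) ⟨0, rfl⟩ h2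
      · exact hdisj p hp.1 ⟨0, hpq.symm⟩
  · rintro x (⟨hx, -⟩ | hx)
    · rw [annulusBdry_eq, mem_iUnion] at hx
      obtain ⟨i, hi⟩ := hx
      rcases eq_or_ne i r with rfl | hir
      · exact Or.inr (Or.inl hi)
      · obtain rfl : i = q := by fin_cases i <;> fin_cases q <;> fin_cases r <;> simp_all
        exact Or.inl hi
    · exact Or.inr (Or.inr hx)
  · refine eq_empty_of_forall_notMem ?_
    rintro x ⟨-, h1, h2 | ⟨p, hp, rfl⟩⟩
    · exact Set.disjoint_left.1 (ha.disjoint_circle hq) h1 h2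
    · exact hdisj p hp.1 h1

end IsBand

theorem edge_add_mul_mem (i : Fin 2) {ε u : ℝ} (hu : u ∈ Icc 0 ε) :
    edge i - edgeSign i * u ∈ Icc (-ε) (1 + ε) ∧
      (edge i - edgeSign i * u ≤ 0 ∨ 1 ≤ edge i - edgeSign i * u) := by
  obtain ⟨h1, h2⟩ := hu
  fin_cases i
  · simp only [Fin.zero_eta, edge_zero, edgeSign, Matrix.cons_val_zero]
    exact ⟨⟨by linarith, by linarith⟩, Or.inl (by linarith)⟩
  · simp only [Fin.mk_one, edge_one, edgeSign, Matrix.cons_val_one]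
    norm_num
    exact ⟨⟨by linarith, by linarith⟩, Or.inr (by linarith)⟩

theorem edgeSign_mul_edge_le (i : Fin 2) {x : ℝ} (hx : x ∈ Icc (0 : ℝ) 1) :
    edgeSign i * edge i ≤ edgeSign i * x := by
  obtain ⟨h1, h2⟩ := hx
  fin_cases i
  · simp [edge_zero, edgeSign, h1]
  · simp [edge_one, edgeSign, h2]

theorem IsAnnulus.add_int {a : ℝ × ℝ → R4} (ha : IsAnnulus a) (s r : ℝ) (k : ℤ) :
    a (s + k, r) = a (s, r) := by
  have hper : Function.Periodic (fun s => a (s, r)) 1 := fun s => ha.periodic s r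
  simpa using hper.int_mul k s

/-- A point of the annulus has coordinates with `s` in any given half-open interval of length
one. -/
theorem IsAnnulus.exists_coord {a : ℝ × ℝ → R4} (ha : IsAnnulus a) {x : R4} (hx : x ∈ annulusSet a)
    (s₀ : ℝ) : ∃ q ∈ Ioc (s₀ - 1 / 2) (s₀ + 1 / 2) ×ˢ Icc (0 : ℝ) 1, a q = x := by
  obtain ⟨⟨s, r⟩, ⟨-, hr⟩, rfl⟩ := hx
  obtain ⟨k, hk⟩ := exists_int_mem_Ioc s (s₀ - 1 / 2)
  refine ⟨(s + k, r), ⟨⟨hk.1, by linarith [hk.2]⟩, hr⟩, ha.add_int s r k⟩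

/-- If a curve starts on the boundary circle `edge r` and runs in the annulus, its velocity points
into the annulus. -/
theorem IsAnnulus.edgeSign_mul_nonneg {a : ℝ × ℝ → R4} (ha : IsAnnulus a) {r : Fin 2} {s₀ : ℝ}
    {β : ℝ → R4} {ε : ℝ} (hε : 0 < ε) (hβ0 : β 0 = a (s₀, edge r))
    (hβ : ∀ u ∈ Icc 0 ε, β u ∈ annulusSet a) {w : ℝ × ℝ}
    (hd : HasDerivAt β (fderiv ℝ a (s₀, edge r) w) 0) : 0 ≤ edgeSign r * w.2 := by
  have h0ε : (0 : ℝ) ∈ Icc 0 ε := ⟨le_rfl, hε.le⟩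
  have hex : ∀ u, ∃ q : ℝ × ℝ, u ∈ Icc 0 ε →
      q ∈ Ioc (s₀ - 1 / 2) (s₀ + 1 / 2) ×ˢ Icc (0 : ℝ) 1 ∧ a q = β u := by
    intro u
    by_cases hu : u ∈ Icc 0 ε
    · obtain ⟨q, hq, h⟩ := ha.exists_coord (hβ u hu) s₀
      exact ⟨q, fun _ => ⟨hq, h⟩⟩
    · exact ⟨0, fun h => absurd h hu⟩
  choose q hq using hex
  -- In a closed window of length one centred at `s₀`, no other point is congruent to `s₀`; so the
  -- coordinates of the curve, chosen arbitrarily in the window, converge to the starting point.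
  have huniq : ∀ x ∈ Icc (s₀ - 1 / 2) (s₀ + 1 / 2) ×ˢ Icc (0 : ℝ) 1,
      a x = a (s₀, edge r) → x = (s₀, edge r) := by
    rintro ⟨s, t⟩ ⟨hs, ht⟩ h
    obtain ⟨h1, k, hk⟩ := ha.injective _ _ _ ht _ (edge_mem_Icc r) h
    have hk1 : (k : ℝ) < 1 := by linarith [hs.1]
    have hk2 : (-1 : ℝ) < k := by linarith [hs.2]
    have hk3 : k = 0 := by
      have : k < 1 := by exact_mod_cast hk1
      have : -1 < k := by exact_mod_cast hk2
      omega
    rw [hk3, Int.cast_zero, add_zero] at hk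
    exact Prod.ext hk.symm h1
  have hq0 : q 0 = (s₀, edge r) := by
    obtain ⟨h1, h2⟩ := hq 0 h0ε
    exact huniq _ ⟨Ioc_subset_Icc_self h1.1, h1.2⟩ (h2.trans hβ0)
  have hcont : ContinuousWithinAt q (Icc 0 ε) 0 := by
    unfold ContinuousWithinAt
    rw [hq0]
    refine tendsto_of_isCompact_of_fiber_unique (isCompact_Icc.prod isCompact_Icc)
      ha.smooth.continuous.continuousOn ?_ huniq ?_
    · filter_upwards [self_mem_nhdsWithin] with u hu
      exact ⟨Ioc_subset_Icc_self (hq u hu).1.1, (hq u hu).1.2⟩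
    · rw [← hβ0]
      refine Filter.Tendsto.congr' ?_ hd.continuousAt.continuousWithinAt.tendsto
      filter_upwards [self_mem_nhdsWithin] with u hu
      exact (hq u hu).2.symm
  obtain ⟨w', hw', hw⟩ := exists_hasDerivWithinAt_lift (f := a) (q := q) (y₀ := 0) (s := Icc 0 ε)
    (f' := fderiv ℝ a (s₀, edge r)) (v := fderiv ℝ a (s₀, edge r) w)
    (by rw [hq0]; exact ha.smooth.contDiffAt.hasStrictFDerivAt (by simp))
    (ha.immersion _ _ (edge_mem_Icc r)) hcont (uniqueDiffOn_Icc hε 0 h0ε)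
    (hd.hasDerivWithinAt.congr (fun u hu => (hq u hu).2) (hq 0 h0ε).2)
  obtain rfl := ha.immersion _ _ (edge_mem_Icc r) hw
  have hr : HasDerivWithinAt (fun u => edgeSign r * (q u).2) (edgeSign r * w'.2) (Icc 0 ε) 0 :=
    ((ContinuousLinearMap.snd ℝ ℝ ℝ).hasFDerivAt.comp_hasDerivWithinAt 0 hw').const_mul _
  -- Over the annulus the signed radial coordinate is least on the circle `edge r`, so its one-sided
  -- derivative there is nonnegative.
  have hmin : IsLocalMinOn (fun u => edgeSign r * (q u).2) (Icc 0 ε) 0 := by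
    refine IsMinOn.localize fun u hu => ?_
    simp only [hq0]
    exact edgeSign_mul_edge_le r (hq u hu).1.2
  have := hmin.hasFDerivWithinAt_nonneg hr.hasFDerivWithinAt (y := ε)
    (mem_posTangentConeAt_of_segment_subset (by rw [zero_add, segment_eq_Icc hε.le]))
  simp only [ContinuousLinearMap.toSpanSingleton_apply, smul_eq_mul] at this
  exact nonneg_of_mul_nonneg_right this hε

/-- The orientability of annulus and band relates the directions of the two edges of the band. -/
theorem IsBand.hasDerivAt_lift {a b : ℝ × ℝ → R4} {ε : ℝ} (hb : IsBand a b ε) (ha : IsAnnulus a)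
    {σ : ℝ} (hσ : ∀ p ∈ square ε, p.1 ≤ 0 ∨ 1 ≤ p.1 →
      ∀ q : ℝ × ℝ, q.2 ∈ Icc (0 : ℝ) 1 → a q = b p →
        ∃ M : (ℝ × ℝ) →L[ℝ] (ℝ × ℝ), fderiv ℝ b p = (fderiv ℝ a q).comp M ∧ 0 < σ * M.det)
    {i r : Fin 2} {s : ℝ → ℝ} (hs : ContinuousOn s (Icc (-ε) (1 + ε)))
    (hsb : ∀ y ∈ Icc (-ε) (1 + ε), a (s y, edge r) = b (edge i, y)) {y : ℝ}
    (hy : y ∈ Ioo (-ε) (1 + ε)) :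
    ∃ d, HasDerivAt s d y ∧ 0 < σ * (edgeSign i * edgeSign r) * d := by
  have hyI := Ioo_subset_Icc_self hy
  have hp := edge_mem_square hb.margin_pos i hyI
  have hb' := (hb.smooth.differentiable (by simp) (edge i, y)).hasFDerivAt
  have hnhds : Icc (-ε) (1 + ε) ∈ nhds y := Icc_mem_nhds hy.1 hy.2
  obtain ⟨M, hM, hdet⟩ := hσ _ hp ((edge_eq i).imp le_of_eq fun h => h.ge) (s y, edge r)
    (edge_mem_Icc r) (hsb y hyI)
  have hM' : ∀ v, fderiv ℝ b (edge i, y) v = fderiv ℝ a (s y, edge r) (M v) := fun v => by rw [hM]; rfl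
  have hdy : HasDerivAt (fun t => b (edge i, t)) (fderiv ℝ b (edge i, y) (0, 1)) y :=
    hb'.comp_hasDerivAt y ((hasDerivAt_const y (edge i)).prodMk (hasDerivAt_id y))
  obtain ⟨w, hw, hwv⟩ := exists_hasDerivAt_lift (f := a) (q := fun t => (s t, edge r)) (y₀ := y)
    (ha.smooth.contDiffAt.hasStrictFDerivAt (by simp)) (ha.immersion _ _ (edge_mem_Icc r))
    ((hs.continuousAt hnhds).prodMk continuousAt_const)
    (hdy.congr_of_eventuallyEq (by filter_upwards [hnhds] with t ht using hsb t ht))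
  rw [hM'] at hwv
  obtain rfl := ha.immersion _ _ (edge_mem_Icc r) hwv
  have hd1 : HasDerivAt s (M (0, 1)).1 y :=
    (ContinuousLinearMap.fst ℝ ℝ ℝ).hasFDerivAt.comp_hasDerivAt y hw
  have hd2 : (M (0, 1)).2 = 0 :=
    ((ContinuousLinearMap.snd ℝ ℝ ℝ).hasFDerivAt.comp_hasDerivAt y hw).unique (hasDerivAt_const y _)
  -- Stepping outwards across the attaching edge leads into the collar, which lies in the annulus.
  have hx : HasDerivAt (fun u : ℝ => ((edge i - edgeSign i * u, y) : ℝ × ℝ)) (-edgeSign i, 0) 0 := by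
    refine HasDerivAt.prodMk ?_ (hasDerivAt_const _ _)
    simpa using ((hasDerivAt_id (0 : ℝ)).const_mul (edgeSign i)).const_sub (edge i)
  have hbx : HasDerivAt (fun u : ℝ => b (edge i - edgeSign i * u, y))
      (fderiv ℝ a (s y, edge r) (M (-edgeSign i, 0))) 0 := by
    rw [← hM']
    refine HasFDerivAt.comp_hasDerivAt (f := fun u : ℝ => ((edge i - edgeSign i * u, y) : ℝ × ℝ))
      0 ?_ hx
    simpa using hb'
  have hsign := ha.edgeSign_mul_nonneg hb.margin_pos (r := r) (s₀ := s y)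
    (by simp [hsb y hyI]) (fun u hu => ?_) hbx
  -- As the edge runs along the circle, M (0, 1) = (d, 0), so det M = -d · (M (1, 0)).2. The collar
  -- fixes the weak sign of the second factor, and the strict sign of the determinant then
  -- determines that of d.
  · refine ⟨_, hd1, ?_⟩
    have h1 : M (-edgeSign i, 0) = -edgeSign i • M (1, 0) := by
      rw [← map_smul]
      simp
    rw [h1] at hsign
    simp only [Prod.smul_snd, smul_eq_mul] at hsign
    rw [det_prod_real, hd2] at hdet
    have h2 : edgeSign i * edgeSign r * (edgeSign i * edgeSign r) = 1 := by
      linear_combination edgeSign r * edgeSign r * edgeSign_mul_self i + edgeSign_mul_self r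
    have h3 : 0 < σ * (edgeSign i * edgeSign r) * (M (0, 1)).1 *
        (edgeSign r * (-edgeSign i * (M (1, 0)).2)) := by
      linear_combination hdet + σ * (M (0, 1)).1 * (M (1, 0)).2 * h2
    exact pos_of_mul_pos_left h3 hsign
  · obtain ⟨h1, h2⟩ := edge_add_mul_mem i hu
    exact hb.collar _ ⟨h1, hyI⟩ h2

/-- A permutation of two indices either fixes both or swaps them, so both signs are kept or both
reversed. Hence both edges of the band run in the same direction of the annulus parameter. -/
theorem edgeSign_mul_eq_of_injective {ρ : Fin 2 → Fin 2} (hρ : Function.Injective ρ) (i : Fin 2) :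
    edgeSign i * edgeSign (ρ i) = edgeSign (ρ 0) := by
  have h01 : ρ 0 ≠ ρ 1 := fun h => zero_ne_one (hρ h)
  fin_cases i
  · simp [edgeSign]
  · simp only [Fin.mk_one]
    generalize ρ 0 = x at *
    generalize ρ 1 = y at *
    fin_cases x <;> fin_cases y <;> simp [edgeSign] at h01 ⊢

theorem edgeSign_mul_edgeSign_eq (i j : Fin 2) :
    edgeSign i * edgeSign j = 1 ∨ edgeSign i * edgeSign j = -1 := by
  rcases edgeSign_eq i with h | h <;> rcases edgeSign_eq j with h' | h' <;> rw [h, h'] <;> norm_num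

/-- The two boundary circles of an annulus, oriented oppositely: the circle `edge (ρ i)` has the
direction `edgeSign m * edgeSign i`. -/
def boundaryCurves (a : ℝ × ℝ → R4) (ρ : Fin 2 → Fin 2) (m : Fin 2) (i : Fin 2) (s : ℝ) : R4 :=
  a (edgeSign m * edgeSign i * s, edge (ρ i))

theorem IsAnnulus.isLink_boundaryCurves {a : ℝ × ℝ → R4} (ha : IsAnnulus a) {ρ : Fin 2 → Fin 2}
    (hρ : Function.Injective ρ) (m : Fin 2) : IsLink (boundaryCurves a ρ m) :=
  ha.isLink hρ fun i => edgeSign_mul_edgeSign_eq m i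

theorem iUnion_range_boundaryCurves {a : ℝ × ℝ → R4} {ρ : Fin 2 → Fin 2}
    (hρ : Function.Injective ρ) (m : Fin 2) :
    (⋃ i, range (boundaryCurves a ρ m i)) = annulusBdry a := by
  rw [annulusBdry_eq]
  ext x
  simp only [mem_iUnion, mem_range, boundaryCurves]
  constructor
  · rintro ⟨i, s, rfl⟩
    exact ⟨ρ i, _, rfl⟩
  · rintro ⟨j, s, rfl⟩
    obtain ⟨i, rfl⟩ := (Finite.injective_iff_surjective.1 hρ) j
    refine ⟨i, edgeSign m * edgeSign i * s, ?_⟩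
    congr 2
    linear_combination s * edgeSign m * edgeSign m * edgeSign_mul_self i + s * edgeSign_mul_self m

/-- Annulus and band give rise to band surgery data on the suitably oriented boundary of the annulus,
if the result of the surgery is connected. -/
theorem IsBand.exists_bandSurgery {a b : ℝ × ℝ → R4} {ε : ℝ} {g : ℝ → ℝ} (hb : IsBand a b ε)
    (ha : IsAnnulus a) (hg : IsRounding ε g) (hconn : IsPreconnected (surgeredBdry a b ε g)) :
    ∃ (D : BandSurgery) (ρ : Fin 2 → Fin 2) (m : Fin 2), Function.Injective ρ ∧
      D.γ = boundaryCurves a ρ m ∧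
      surgeredBdry a b ε g = ((⋃ i, range (D.γ i)) \ D.b '' square D.ε) ∪
        D.b '' {p ∈ square D.ε | D.Eqn p 1} := by
  have hε := hb.margin_pos
  choose ρ hρ using hb.exists_circle ha
  have hinj : Function.Injective ρ := by
    have h01 := hb.circle_ne ha hg hconn (hρ 0) (hρ 1)
    intro i j hij
    fin_cases i <;> fin_cases j
    · rfl
    · exact absurd hij h01
    · exact absurd hij.symm h01
    · rfl
  obtain ⟨σ, hσ⟩ := hb.orientable
  have hlift : ∀ i, ∃ s : ℝ → ℝ, ContinuousOn s (Icc (-ε) (1 + ε)) ∧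
      ∀ y ∈ Icc (-ε) (1 + ε), a (s y, edge (ρ i)) = b (edge i, y) := fun i =>
    exists_lift_of_mem_range (ha.continuous_circle _) (fun t => ha.periodic t _)
      (fun s t h => (ha.injective _ _ _ (edge_mem_Icc _) _ (edge_mem_Icc _) h).2) (by linarith)
      (hb.smooth.continuous.comp (by fun_prop)).continuousOn (hρ i)
  choose s hs hsb using hlift
  obtain ⟨m, hm⟩ : ∃ m : Fin 2, ∀ i, ∀ y ∈ Ioo (-ε) (1 + ε),
      ∃ d, HasDerivAt (s i) d y ∧ 0 < edgeSign m * d := by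
    have h1 : ∀ i, ∀ y ∈ Ioo (-ε) (1 + ε),
        ∃ d, HasDerivAt (s i) d y ∧ 0 < σ * edgeSign (ρ 0) * d := by
      intro i y hy
      obtain ⟨d, hd, hpos⟩ := hb.hasDerivAt_lift ha hσ (hs i) (hsb i) hy
      rw [edgeSign_mul_eq_of_injective hinj] at hpos
      exact ⟨d, hd, hpos⟩
    -- The sign is common to both edges and only its orientation matters; it is recorded by m. A
    -- vanishing product is excluded by the strict inequality.
    rcases le_total 0 (σ * edgeSign (ρ 0)) with h | h
    · refine ⟨0, fun i y hy => ?_⟩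
      obtain ⟨d, hd, hpos⟩ := h1 i y hy
      exact ⟨d, hd, by simpa [edgeSign] using pos_of_mul_pos_right hpos h⟩
    · refine ⟨1, fun i y hy => ?_⟩
      obtain ⟨d, hd, hpos⟩ := h1 i y hy
      exact ⟨d, hd, by simpa [edgeSign] using neg_of_mul_pos_right hpos h⟩
  obtain ⟨η, k, hηε, hη, hk, hgk⟩ := hg.exists_profile
  have hmm : ∀ i, edgeSign m * edgeSign i * (edgeSign m * edgeSign i) = 1 := fun i => by
    linear_combination edgeSign m * edgeSign m * edgeSign_mul_self i + edgeSign_mul_self m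
  let D : BandSurgery :=
    { γ := boundaryCurves a ρ m
      b := b
      ε := ε
      η := η
      k := k
      e := fun i y => edgeSign m * edgeSign i * s i y
      isLink := ha.isLink_boundaryCurves hinj m
      smooth := hb.smooth
      norm_eq_one := hb.norm_eq_one
      injOn := hb.injOn
      immersion := hb.immersion
      profile := hk
      lt_margin := hηε
      lt_half := hη
      edge_apply := fun i y hy => by
        rw [boundaryCurves, ← mul_assoc, hmm, one_mul, hsb i y hy]
      continuousOn_e := fun i => continuousOn_const.mul (hs i)
      deriv_e := fun i y hy => by
        obtain ⟨d, hd, hpos⟩ := hm i y hy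
        refine ⟨_, hd.const_mul _, ?_⟩
        have : edgeSign i * (edgeSign m * edgeSign i * d) = edgeSign m * d := by
          linear_combination edgeSign m * d * edgeSign_mul_self i
        rwa [this]
      bdry := fun p hp i t h => by
        rw [← hb.bdry p hp, ← iUnion_range_boundaryCurves hinj m, mem_iUnion]
        exact ⟨i, t, h.symm⟩ }
  refine ⟨D, ρ, m, hinj, rfl, ?_⟩
  -- With g u = 2 k u - u, the equation x - y = g (x + y) becomes x = k (x + y), the saddle equation
  -- at t = 1.
  have hcurve : bandCurve ε g = {p ∈ square ε | D.Eqn p 1} := by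
    ext p
    have h1 : D.Eqn p 1 ↔ fold p.1 = k (fold p.1 + fold p.2) := by
      rw [profile_fold_iff hk D.η_lt_c.le D.c_lt, BandSurgery.Eqn, one_mul]
      rfl
    simp only [bandCurve, mem_ofPred_eq, h1, hgk]
    refine and_congr_right fun _ => ⟨fun h => by linarith, fun h => by linarith⟩
  rw [surgeredBdry, hcurve, ← iUnion_range_boundaryCurves hinj m]

/-! ### The boundary of a negative Hopf band -/

/-- The rotation by the angle `θ` in the plane of the imaginary parts of the two coordinates. -/
def imRotation (θ : ℝ) (x : R4) : R4 :=
  !₂[x 0, Real.cos θ * x 1 - Real.sin θ * x 3, x 2, Real.sin θ * x 1 + Real.cos θ * x 3]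

/-- The rotation `imRotation θ` as a linear isometry. -/
def imRotationIsometry (θ : ℝ) : R4 →ₗᵢ[ℝ] R4 where
  toFun := imRotation θ
  map_add' x y := by
    ext k
    fin_cases k <;> simp [imRotation] <;> ring
  map_smul' c x := by
    ext k
    fin_cases k <;> simp [imRotation] <;> ring
  norm_map' x := by
    change ‖imRotation θ x‖ = ‖x‖
    rw [EuclideanSpace.norm_eq, EuclideanSpace.norm_eq]
    congr 1
    simp only [imRotation, Fin.sum_univ_four, Real.norm_eq_abs, sq_abs]
    simp
    linear_combination (x 1 ^ 2 + x 3 ^ 2) * Real.sin_sq_add_cos_sq θ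

theorem IsLink.comp_isometry {n : ℕ} {γ : Fin n → ℝ → R4} (h : IsLink γ) (R : R4 →ₗᵢ[ℝ] R4) :
    IsLink fun i s => R (γ i s) := by
  refine ⟨fun i => R.contDiff.comp (h.smooth i), fun i t => ?_, fun i t => ?_, fun i t h0 => ?_,
    fun i j s t hst => h.injective i j s t (R.injective hst)⟩
  · simp only [h.periodic]
  · rw [R.norm_map, h.norm_eq_one]
  · have h1 := R.toContinuousLinearMap.hasFDerivAt.comp_hasDerivAt t
      ((h.smooth i).differentiable (by simp) t).hasDerivAt
    have h2 := h1.deriv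
    change deriv (fun s => R (γ i s)) t = R (deriv (γ i) t) at h2
    rw [h2] at h0
    exact h.deriv_ne_zero i t (R.injective (h0.trans (map_zero R).symm))

theorem hopfNeg_eq (j : Fin 2) (s : ℝ) :
    hopfCurves (-1) j s = stdNegHopfBand (edgeSign j * s, edge j) := by
  have h1 : (2 * Real.pi * -s) = -(2 * Real.pi * s) := by ring
  ext k
  fin_cases j <;> fin_cases k <;>
    simp [hopfCurves, stdNegHopfBand, edgeSign, edge_zero, edge_one, h1]

/-- The half turn of the imaginary plane conjugates both complex coordinates, which on the standard
band is s ↦ -s. -/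
theorem imRotation_stdNegHopfBand {θ κ : ℝ} (hκ : κ = 1 ∨ κ = -1) (hc : Real.cos θ = κ)
    (hs : Real.sin θ = 0) (s r : ℝ) :
    imRotation θ (stdNegHopfBand (κ * s, r)) = stdNegHopfBand (s, r) := by
  have h1 : (2 * Real.pi * -s) = -(2 * Real.pi * s) := by ring
  rcases hκ with rfl | rfl <;> ext k <;> fin_cases k <;>
    simp [imRotation, stdNegHopfBand, hc, hs, h1]

/-- The isotopy of bands carries the boundary circles to those of the standard band with opposite
directions. This is `hopfNeg` or its total reverse, and a rotation through the angle 0 or π joins it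
to `hopfNeg`. -/
theorem isotopic_boundaryCurves {a : ℝ × ℝ → R4} (ha : IsNegHopfBand a) {ρ : Fin 2 → Fin 2}
    (hρ : Function.Injective ρ) (m : Fin 2) (h : IsLink (boundaryCurves a ρ m)) :
    ∃ L : OrientedLink, Isotopic ⟨2, two_pos, boundaryCurves a ρ m, h⟩ L ∧ Isotopic L hopfNeg := by
  obtain ⟨G, hG, hGa, hG0, hG1⟩ := ha
  have hlink : ∀ t ∈ Icc (0 : ℝ) 1, IsLink (boundaryCurves (G t) ρ m) := fun t ht =>
    (hGa t ht).isLink_boundaryCurves hρ m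
  have h1 : (1 : ℝ) ∈ Icc (0 : ℝ) 1 := ⟨zero_le_one, le_rfl⟩
  refine ⟨⟨2, two_pos, _, hlink 1 h1⟩, ⟨Equiv.refl _, fun t => boundaryCurves (G t) ρ m,
    fun i => hG.comp (by fun_prop : ContDiff ℝ ∞ fun p : ℝ × ℝ =>
      (p.1, (edgeSign m * edgeSign i * p.2, edge (ρ i)))), hlink, fun i s =>
      hG0 _ _ (edge_mem_Icc _), fun i s => rfl⟩, ?_⟩
  -- The sign κ measures the directions of both circles against those of `hopfNeg`; it is the same
  -- for both since `ρ` is a permutation.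
  set κ := edgeSign m * edgeSign (ρ 0) with hκ
  have hκ1 : κ = 1 ∨ κ = -1 := edgeSign_mul_edgeSign_eq _ _
  have hκi : ∀ i, edgeSign m * edgeSign i = κ * edgeSign (ρ i) := fun i => by
    rw [hκ, ← edgeSign_mul_eq_of_injective hρ i]
    linear_combination -edgeSign m * edgeSign i * edgeSign_mul_self (ρ i)
  let θ : ℝ → ℝ := fun t => (1 - κ) / 2 * Real.pi * t
  have hθ0 : θ 0 = 0 := mul_zero _
  have hθ1 : Real.cos (θ 1) = κ ∧ Real.sin (θ 1) = 0 := by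
    simp only [θ]
    rcases hκ1 with h | h <;> rw [h] <;> norm_num
  have hsmooth := (hlink 1 h1).smooth
  refine ⟨Equiv.ofBijective ρ (Finite.injective_iff_bijective.1 hρ),
    fun t i s => imRotation (θ t) (boundaryCurves (G 1) ρ m i s), fun i => ?_,
    fun t _ => (hlink 1 h1).comp_isometry (imRotationIsometry (θ t)), fun i s => ?_, fun i s => ?_⟩
  · have hco : ∀ k, ContDiff ℝ ∞ fun p : ℝ × ℝ => boundaryCurves (G 1) ρ m i p.2 k := fun k =>
      (contDiff_euclidean.1 (hsmooth i) k).comp contDiff_snd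
    have hc : ContDiff ℝ ∞ fun p : ℝ × ℝ => Real.cos (θ p.1) := by fun_prop
    have hs : ContDiff ℝ ∞ fun p : ℝ × ℝ => Real.sin (θ p.1) := by fun_prop
    rw [contDiff_euclidean]
    intro k
    fin_cases k
    · exact hco 0
    · exact (hc.mul (hco 1)).sub (hs.mul (hco 3))
    · exact hco 2
    · exact (hs.mul (hco 1)).add (hc.mul (hco 3))
  · simp only [hθ0]
    ext k
    fin_cases k <;> simp [imRotation]
  · change imRotation (θ 1) (boundaryCurves (G 1) ρ m i s) = hopfCurves (-1) (ρ i) s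
    rw [boundaryCurves, hG1 _ _ (edge_mem_Icc _), hκi, mul_assoc,
      imRotation_stdNegHopfBand hκ1 hθ1.1 hθ1.2, hopfNeg_eq]

/-! ### The theorem -/

theorem OrientedLink.IsKnot.isPreconnected_carrier {K : OrientedLink} (hK : K.IsKnot) :
    IsPreconnected K.carrier := by
  have h1 : K.carrier = range (K.γ ⟨0, K.n_pos⟩) := by
    refine Subset.antisymm (iUnion_subset fun i => ?_) (subset_iUnion_of_subset _ Subset.rfl)
    have : i = ⟨0, K.n_pos⟩ := by
      have h2 : K.n = 1 := hK
      exact Fin.ext (by have := i.2; simp only; omega)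
    rw [this]
  rw [h1]
  exact isPreconnected_range (K.isLink.smooth _).continuous

theorem eq_of_isotopic {ν : OrientedLink → ℤ}
    (hν : ∀ (L L' : OrientedLink) (S : Set (R4 × ℝ)) (χ : ℤ),
      IsCobordism S L L' → HasEulerChar S χ → |ν L - ν L'| ≤ -χ)
    {L L' : OrientedLink} (h : Isotopic L L') : ν L = ν L' := by
  obtain ⟨S, hS, hχ⟩ := h.exists_isCobordism
  have := hν L L' S 0 hS hχ
  rw [neg_zero, abs_nonpos_iff] at this
  exact sub_eq_zero.1 this

/-- The saddle joins the oriented boundary of the band, on which ν is -1, to K, and -χ = 1. -/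
theorem abs_add_one_le_one {ν : OrientedLink → ℤ}
    (hν : ∀ (L L' : OrientedLink) (S : Set (R4 × ℝ)) (χ : ℤ),
      IsCobordism S L L' → HasEulerChar S χ → |ν L - ν L'| ≤ -χ)
    (hneg : ν hopfNeg = -1) {K : OrientedLink} (hK : K.IsKnot)
    (h : HasNegSpecialAnnulusPresentation K) : |-1 - ν K| ≤ 1 := by
  obtain ⟨P, hP⟩ := h
  obtain ⟨g, hg, K', hK', hiso⟩ := P.isotopic
  have hKnot : K'.IsKnot := by
    obtain ⟨e, -⟩ := hiso
    have h1 := Fintype.card_congr e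
    simp only [Fintype.card_fin] at h1
    exact h1.symm.trans hK
  obtain ⟨D, ρ, m, hρ, hγ, hsurg⟩ := P.isBand.exists_bandSurgery P.isAnnulus hg
    (hK' ▸ hKnot.isPreconnected_carrier)
  -- Allowing every m covers the bottom link as well as its reverse, which corresponds to `m + 1`.
  have hL : ∀ (m : Fin 2) (γ : Fin 2 → ℝ → R4) (hlink : IsLink γ),
      γ = boundaryCurves P.annulus ρ m → ν ⟨2, two_pos, γ, hlink⟩ = -1 := by
    rintro m _ hlink rfl
    obtain ⟨L, h1, h2⟩ := isotopic_boundaryCurves hP hρ m hlink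
    rw [eq_of_isotopic hν h1, eq_of_isotopic hν h2, hneg]
  rw [eq_of_isotopic hν hiso]
  rcases D.isCobordism_saddle hKnot (hK'.trans hsurg) with h | h
  · have h1 := hν _ _ _ _ h D.hasEulerChar_saddle
    rwa [BandSurgery.bottomLink, hL m _ _ hγ] at h1
  · have h1 := hν _ _ _ _ h D.hasEulerChar_saddle
    have h2 : ν D.bottomLink.reverse = -1 := by
      refine hL (m + 1) _ _ ?_
      funext i s
      have h3 : edgeSign (m + 1) = -edgeSign m := by fin_cases m <;> simp [edgeSign]
      change D.γ i (-s) = boundaryCurves P.annulus ρ (m + 1) i s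
      rw [hγ]
      simp only [boundaryCurves, h3]
      congr 2
      ring
    rwa [h2] at h1

end AnnulusLink

end

theorem theorem6p4 (ν : AnnulusLink.OrientedLink → ℤ)
    (hν : ∀ (L L' : AnnulusLink.OrientedLink) (S : Set (AnnulusLink.R4 × ℝ)) (χ : ℤ),
      AnnulusLink.IsCobordism S L L' → AnnulusLink.HasEulerChar S χ → |ν L - ν L'| ≤ -χ)
    (hpos : ν AnnulusLink.hopfPos = 1) (hneg : ν AnnulusLink.hopfNeg = -1)
    (K : AnnulusLink.OrientedLink) (hK : K.IsKnot) :
    (AnnulusLink.HasNegSpecialAnnulusPresentation K → -2 ≤ ν K ∧ ν K ≤ 0) ∧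
    (ν K = 2 → ¬ AnnulusLink.HasNegSpecialAnnulusPresentation K) := by
  have key : AnnulusLink.HasNegSpecialAnnulusPresentation K → -2 ≤ ν K ∧ ν K ≤ 0 := fun h => by
    have := abs_le.1 (AnnulusLink.abs_add_one_le_one hν hneg hK h)
    constructor <;> linarith [this.1, this.2]
  exact ⟨key, fun h2 h => by linarith [(key h).2]⟩
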